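/- Let $k$ be a field of arbitrary characteristic and $d\ge 1$ an integer such that $k$ has at least $d$ elements. Let $\widetilde{\mathcal O}=k[\![t_1]\!]\times\dots\times k[\![t_d]\!]$ and let $\mathcal O\subseteq\widetilde{\mathcal O}$ be a local $k$-subalgebra of finite codimension $\delta=\dim_k\widetilde{\mathcal O}/\mathcal O$ (for instance the completed local ring, with its normalization, of an algebraic curve over $k$ at a point that is totally rational, i.e. all $d$ points of the normalization above it have residue field $k$). For $\underline z\in\widetilde{\mathcal O}$ let $\underline v(\underline z)=(v_1(z_1),\dots,v_d(z_d))$ be its vector of $t_i$-orders, let $S=\{\underline v(\underline z)\mid \underline z\in\mathcal O \text{ a non-zero-divisor}\}\subseteq\mathbb N^d$, and for $\underline n\in\mathbb N^d$ put $\|\underline n\|=n_1+\dots+n_d$, $T^{\underline n}=T_1^{n_1}\cdots T_d^{n_d}$. Let $\mathcal M_k=K_0(\mathrm{Var}_k)[\mathbb L^{-1}]$, where $K_0(\mathrm{Var}_k)$ is the Grothendieck ring of $k$-varieties and $\mathbb L=[\mathbb A^1_k]$. (When $k$ is not algebraically closed, subsets defined by polynomial conditions on coefficients are understood through their points over all extension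 fields of $k$, i.e. scheme-theoretically.) Let $\mathcal J=\widetilde{\mathcal O}^\times/\mathcal O^\times$, an affine algebraic group over $k$. For $\underline n\in S$ let $\mathcal I_{\underline n}$ be the set of ideals $\underline z\mathcal O$ with $\underline z\in\mathcal O$, $\underline v(\underline z)=\underline n$, identified with a subset of $\mathcal J$ by sending $\underline t^{\underline n}\underline\mu\,\mathcal O$, $\underline\mu\in\widetilde{\mathcal O}^\times$, to the class of $\underline\mu$. This subset is a finite disjoint union of locally closed subvarieties of $\mathcal J$, hence has a class $[\mathcal I_{\underline n}]\in K_0(\mathrm{Var}_k)$; put $$Z(T_1,\dots,T_d,\mathcal O)=\sum_{\underline n\in S}[\mathcal I_{\underline n}]\,\mathbb L^{-\|\underline n\|}\,T^{\underline n}\in\mathcal M_k[\![T_1,\dots,T_d]\!].$$ For $\underline n\in\mathbb N^d$ let $J^{\underline n}=\widetilde{\mathcal O}/\underline t^{\underline n+\underline 1}\widetilde{\mathcal O}$ and let $\pi_{\underline n}:\mathbb P\widetilde{\mathcal O}\to\mathbb PJ^{\underline n}\sqcup\{\mathrm{pt}\}$ be the natural map (points with zero jet go to $\mathrm{pt}$).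 A subset $X\subseteq\mathbb P\widetilde{\mathcal O}$ is cylindric if $X=\pi_{\underline n}^{-1}(Y)$ for some $\underline n$ and some constructible $Y\subseteq\mathbb PJ^{\underline n}$, and then $\chi_g(X)=[Y]\,\mathbb L^{-\|\underline n+\underline 1\|}$. The function $\underline z\mapsto T^{\underline v(\underline z)}$ on $\mathbb P\widetilde{\mathcal O}$ (with value $0$ if some $z_i=0$) is integrable over $\mathbb P\mathcal O$, i.e. it takes countably many values, its fibres over non-zero values, and the intersections of these fibres with $\mathbb P\mathcal O$, are cylindric, and the sum $$P_g(T_1,\dots,T_d,\mathcal O)=\int_{\mathbb P\mathcal O}T^{\underline v(\underline z)}\,d\chi_g=\sum_{a\ne0}\chi_g\bigl(\{\underline z\in\mathbb P\mathcal O\mid T^{\underline v(\underline z)}=a\}\bigr)\,a$$ over $a\in\mathbb Z[\![T_1,\dots,T_d]\!]$ makes sense in $\mathcal M_k[\![T_1,\dots,T_d]\!]$ (each coefficient receives finitely many contributions). Moreover $$Z(T_1,\dots,T_d,\mathcal O)=\mathbb L^{\delta+1}\,P_g(T_1,\dots,T_d,\mathcal O).$$ -/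

import Mathlib

universe u

open AlgebraicGeometry CategoryTheory

noncomputable section

namespace CurveZeta

attribute [local instance] MvPolynomial.gradedAlgebra

/-! ### The Grothendieck ring of varieties -/

/-- Algebraic varieties over the field `k`: separated schemes of finite type over `Spec k`.
(Non-reduced schemes are allowed; since `V` and its reduction have the same class, this gives
the same Grothendieck ring as reduced schemes.) -/
structure Variety (k : Type u) [Field k] where
  X : Over (Spec (CommRingCat.of k))
  finiteType : LocallyOfFiniteType X.hom
  quasiCompact : QuasiCompact X.hom
  separated : IsSeparated X.hom

/-- The spectrum of a `k`-algebra as a scheme over `k`. -/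
def specOver (k A : Type u) [Field k] [CommRing A] [Algebra k A] :
    Over (Spec (CommRingCat.of k)) :=
  Over.mk (Spec.map (CommRingCat.ofHom (algebraMap k A)))

/-- The spectrum of a finitely generated `k`-algebra as a variety. -/
def Variety.spec (k A : Type u) [Field k] [CommRing A] [Algebra k A] [h : Algebra.FiniteType k A] :
    Variety k where
  X := specOver k A
  finiteType := (HasRingHomProperty.Spec_iff (P := @LocallyOfFiniteType)).2
    (by simpa [RingHom.finiteType_algebraMap] using h)
  quasiCompact := inferInstanceAs (QuasiCompact (Spec.map _))
  separated := inferInstanceAs (IsSeparated (Spec.map _))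

/-- The relations of the Grothendieck ring, in the free commutative ring on all varieties. -/
inductive K0Rel (k : Type u) [Field k] : FreeCommRing (Variety k) → Prop
  /-- isomorphic varieties have the same class -/
  | iso (V W : Variety k) (e : V.X ≅ W.X) :
      K0Rel k (FreeCommRing.of V - FreeCommRing.of W)
  /-- `[V] = [V ∖ Z] + [Z]` for `Z` closed in `V` -/
  | scissor (V U Z : Variety k) (j : U.X ⟶ V.X) (i : Z.X ⟶ V.X)
      (hj : IsOpenImmersion j.left) (hi : IsClosedImmersion i.left)
      (h : Set.range j.left = (Set.range i.left)ᶜ) :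
      K0Rel k (FreeCommRing.of V - (FreeCommRing.of U + FreeCommRing.of Z))
  /-- `[V × W] = [V] [W]` -/
  | prod (V W P : Variety k) (p : P.X ⟶ V.X) (q : P.X ⟶ W.X)
      (h : IsPullback p.left q.left V.X.hom W.X.hom) :
      K0Rel k (FreeCommRing.of P - FreeCommRing.of V * FreeCommRing.of W)
  /-- `1 = [point]` -/
  | point : K0Rel k (FreeCommRing.of (Variety.spec k k) - 1)

/-- The Grothendieck ring `K₀(Var_k)`. -/
abbrev K0 (k : Type u) [Field k] : Type (u + 1) :=
  FreeCommRing (Variety k) ⧸ Ideal.span {x | K0Rel k x}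

/-- The class `[V]` of a variety. -/
def K0.cls {k : Type u} [Field k] (V : Variety k) : K0 k :=
  Ideal.Quotient.mk _ (FreeCommRing.of V)

/-- The class `𝕃` of the affine line in `K₀(Var_k)`. -/
def K0.line (k : Type u) [Field k] : K0 k := K0.cls (Variety.spec k (Polynomial k))

/-- The localization `ℳ_k = K₀(Var_k)[𝕃⁻¹]`. -/
abbrev Mot (k : Type u) [Field k] : Type (u + 1) := Localization.Away (K0.line k)

/-- `𝕃` in `ℳ_k`. -/
def Mot.L (k : Type u) [Field k] : Mot k := algebraMap (K0 k) (Mot k) (K0.line k)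

/-- `𝕃⁻¹` in `ℳ_k`. -/
def Mot.Linv (k : Type u) [Field k] : Mot k := IsLocalization.Away.invSelf (K0.line k)

/-- `x` is the class of the (constructible) subset `Y` of the `k`-scheme `V`: the set `Y` is a
finite disjoint union of subvarieties (locally closed in `V`), and `x` is the sum of their
classes. -/
def HasClass {k : Type u} [Field k] (V : Over (Spec (CommRingCat.of k))) (Y : Set V.left)
    (x : K0 k) : Prop :=
  ∃ (r : ℕ) (W : Fin r → Variety k) (ι : ∀ a, (W a).X ⟶ V),
    (∀ a, IsImmersion (ι a).left) ∧
    (∀ a b, a ≠ b → Disjoint (Set.range (ι a).left) (Set.range (ι b).left)) ∧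
    (⋃ a, Set.range (ι a).left) = Y ∧ x = ∑ a, K0.cls (W a)

open Classical in
/-- The class `[Y]` of a constructible subset `Y` of the `k`-scheme `V`. -/
def setClass {k : Type u} [Field k] (V : Over (Spec (CommRingCat.of k))) (Y : Set V.left) : K0 k :=
  if h : ∃ x, HasClass V Y x then h.choose else 0

/-! ### The projectivized normalization, its jets, and the generalized Euler characteristic

The normalization of the local ring is `k⟦t₁⟧ × ⋯ × k⟦t_d⟧`, written `Fin d → PowerSeries k`.
Over a field that is not algebraically closed a constructible condition on jets is not determined
by its `k`-rational solutions; as usual in motivic integration, a subset means a set of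
points with coordinates in arbitrary extension fields of `k`, and constructible sets are sets of
points of schemes. -/

/-- A point of `ℙ(k⟦t₁⟧ × ⋯ × k⟦t_d⟧)` with coordinates in an extension field `K` of `k`. -/
structure PPoint (k : Type u) [Field k] (d : ℕ) where
  K : Type u
  [field : Field K]
  [algebra : Algebra k K]
  pt : Projectivization K (Fin d → PowerSeries K)

attribute [instance] PPoint.field PPoint.algebra

/-- The index set of the coefficients `a_{i,j}`, `j ≤ n_i`, that make up an `n`-jet. -/
abbrev JetIndex {d : ℕ} (n : Fin d →₀ ℕ) : Type := {p : Fin d × ℕ // p.2 ≤ n p.1}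

/-- The number `‖n‖ = n₁ + ⋯ + n_d`. -/
def nrm {d : ℕ} (n : Fin d →₀ ℕ) : ℕ := ∑ i, n i

/-- The number `‖n + 1‖`, where `1 = (1, …, 1)`. -/
def nrmSucc {d : ℕ} (n : Fin d →₀ ℕ) : ℕ := ∑ i, (n i + 1)

/-- The projective space over `k` with homogeneous coordinates indexed by `σ`. -/
def projSpace (k : Type u) [Field k] (σ : Type) : Over (Spec (CommRingCat.of k)) :=
  Over.mk (Proj.toSpecZero (MvPolynomial.homogeneousSubmodule σ k) ≫
    Spec.map (CommRingCat.ofHom (algebraMap k (MvPolynomial.homogeneousSubmodule σ k 0))))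

/-- The point of projective space with the homogeneous coordinates `w` in an extension field of
`k`: it corresponds to the ideal generated by the homogeneous polynomials over `k` that
vanish at `w`. -/
def projPoint {k : Type u} [Field k] {σ : Type} {K : Type u} [Field K] [Algebra k K]
    (w : σ → K) (hw : w ≠ 0) : (projSpace k σ).left :=
  show ProjectiveSpectrum (MvPolynomial.homogeneousSubmodule σ k) from
  { asHomogeneousIdeal :=
      (RingHom.ker (MvPolynomial.aeval (R := k) w)).homogeneousCore
        (MvPolynomial.homogeneousSubmodule σ k)
    isPrime := Ideal.IsPrime.homogeneousCore (RingHom.ker_isPrime _)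
    not_irrelevant_le := by
      intro h
      apply hw
      funext s
      have h1 : (MvPolynomial.X s : MvPolynomial σ k) ∈
          HomogeneousIdeal.irrelevant (MvPolynomial.homogeneousSubmodule σ k) := by
        rw [HomogeneousIdeal.mem_irrelevant_iff, GradedRing.proj_apply,
          DirectSum.decompose_of_mem_ne (ℳ := MvPolynomial.homogeneousSubmodule σ k)
            (i := 1) (j := 0)]
        · exact MvPolynomial.isHomogeneous_X k s
        · exact one_ne_zero
      have h2 := Ideal.toIdeal_homogeneousCore_le _ _ (h h1)
      simpa using h2 }

open Classical in
/-- The map `π_n` from `ℙ(k⟦t₁⟧ × ⋯ × k⟦t_d⟧)` to the disjoint union `ℙ^× J^n` of the projectivized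
space of `n`-jets and a point (`none`, for the points with vanishing `n`-jet). -/
def jetMap {k : Type u} [Field k] {d : ℕ} (n : Fin d →₀ ℕ) (z : PPoint k d) :
    Option (projSpace k (JetIndex n)).left :=
  if h : (fun p : JetIndex n => PowerSeries.coeff p.1.2 (z.pt.rep p.1.1)) ≠ 0 then
    some (projPoint _ h)
  else none

/-- `X = π_n⁻¹(Y)` for a constructible subset `Y` of `ℙ J^n`. -/
def IsCylinderOver {k : Type u} [Field k] {d : ℕ} (X : Set (PPoint k d)) (n : Fin d →₀ ℕ)
    (Y : Set (projSpace k (JetIndex n)).left) : Prop :=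
  Topology.IsConstructible Y ∧ X = jetMap n ⁻¹' (some '' Y)

/-- Cylindric subsets of `ℙ(k⟦t₁⟧ × ⋯ × k⟦t_d⟧)`. -/
def IsCylindric {k : Type u} [Field k] {d : ℕ} (X : Set (PPoint k d)) : Prop :=
  ∃ (n : Fin d →₀ ℕ) (Y : Set (projSpace k (JetIndex n)).left), IsCylinderOver X n Y

open Classical in
/-- The generalized Euler characteristic `χ_g(X) = [Y] 𝕃^{-‖n+1‖}` of a cylindric subset
`X = π_n⁻¹(Y)`. -/
def eulerChar {k : Type u} [Field k] {d : ℕ} (X : Set (PPoint k d)) : Mot k :=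
  if h : IsCylindric X then
    algebraMap (K0 k) (Mot k) (setClass (projSpace k (JetIndex h.choose)) h.choose_spec.choose) *
      Mot.Linv k ^ nrmSucc h.choose
  else 0

/-- `φ` is a cylindric function, integrable over `X`: it has countably many values, the sets
`φ⁻¹(a)` and `X ∩ φ⁻¹(a)`, `a ≠ 0`, are cylindric, and the sum `∑_{a ≠ 0} χ_g(X ∩ φ⁻¹(a)) a` makes
sense in `ℳ_k⟦T₁, …, T_d⟧`, i.e. each coefficient gets only finitely many contributions. -/
def IsIntegrable {k : Type u} [Field k] {d : ℕ} (X : Set (PPoint k d))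
    (φ : PPoint k d → MvPowerSeries (Fin d) ℤ) : Prop :=
  (Set.range φ).Countable ∧
  (∀ a, a ≠ 0 → IsCylindric (φ ⁻¹' {a}) ∧ IsCylindric (X ∩ φ ⁻¹' {a})) ∧
  ∀ m : Fin d →₀ ℕ,
    {a | a ≠ 0 ∧ eulerChar (X ∩ φ ⁻¹' {a}) * ((MvPowerSeries.coeff m a : ℤ) : Mot k) ≠ 0}.Finite

/-- The integral `∫_X φ dχ_g = ∑_{a ≠ 0} χ_g(X ∩ φ⁻¹(a)) a` in `ℳ_k⟦T₁, …, T_d⟧`. -/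
def integral {k : Type u} [Field k] {d : ℕ} (X : Set (PPoint k d))
    (φ : PPoint k d → MvPowerSeries (Fin d) ℤ) : MvPowerSeries (Fin d) (Mot k) :=
  fun m => ∑ᶠ (a : MvPowerSeries (Fin d) ℤ) (_ : a ≠ 0),
    eulerChar (X ∩ φ ⁻¹' {a}) * ((MvPowerSeries.coeff m a : ℤ) : Mot k)

open Classical in
/-- The function `z ↦ T^{v(z)}`, with the value `0` if some coordinate of `z` vanishes. -/
def tPowVal {k : Type u} [Field k] {d : ℕ} (z : PPoint k d) : MvPowerSeries (Fin d) ℤ :=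
  if ∀ i, z.pt.rep i ≠ 0 then
    MvPowerSeries.monomial (Finsupp.equivFunOnFinite.symm fun i => (z.pt.rep i).order.toNat) 1
  else 0

/-! ### The local ring

The local ring is a `k`-subalgebra `O` of finite codimension of its normalization. -/

/-- The singularity degree `δ`, the codimension of `O` in its normalization. -/
def sdelta {k : Type u} [Field k] {d : ℕ} (O : Subalgebra k (Fin d → PowerSeries k)) : ℕ :=
  Module.finrank k ((Fin d → PowerSeries k) ⧸ Subalgebra.toSubmodule O)

/-- The semigroup of values `S` of `O`: the values of the elements of `O` that are no
zero divisors. -/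
def semigroup {k : Type u} [Field k] {d : ℕ} (O : Subalgebra k (Fin d → PowerSeries k)) :
    Set (Fin d →₀ ℕ) :=
  {n | ∃ z ∈ O, ∀ i, (z i).order = n i}

/-- The points of `O` with coordinates in the extension field `K` of `k`: the tuples of power series
over `K` whose coefficients satisfy all linear equations over `k` (each involving finitely many
coefficients `a_{i,j}`) that hold on `O`. -/
def points {k : Type u} [Field k] {d : ℕ} (O : Subalgebra k (Fin d → PowerSeries k))
    (K : Type u) [Field K] [Algebra k K] : Set (Fin d → PowerSeries K) :=
  {z | ∀ l : (Fin d × ℕ) →₀ k,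
    (∀ y ∈ O, (l.sum fun p c => c * PowerSeries.coeff p.2 (y p.1)) = 0) →
    (l.sum fun p c => algebraMap k K c * PowerSeries.coeff p.2 (z p.1)) = 0}

/-- The subset `ℙO` of `ℙ(k⟦t₁⟧ × ⋯ × k⟦t_d⟧)`. -/
def projPoints {k : Type u} [Field k] {d : ℕ} (O : Subalgebra k (Fin d → PowerSeries k)) :
    Set (PPoint k d) :=
  {z | z.pt.rep ∈ points O z.K}

/-- The generalized Poincaré series `P_g(T₁, …, T_d, O) = ∫_{ℙO} T^{v(z)} dχ_g`. -/
def poincare {k : Type u} [Field k] {d : ℕ} (O : Subalgebra k (Fin d → PowerSeries k)) :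
    MvPowerSeries (Fin d) (Mot k) :=
  integral (projPoints O) tPowVal

/-! ### The algebraic group `J`, the quotient of the units of the normalization by those of `O` -/

/-- The ring of regular functions `k[a_{i,j}, a_{i,0}⁻¹]` on the units of
`k⟦t₁⟧ × ⋯ × k⟦t_d⟧`, with `a_{i,j}` the coefficient of `t_i ^ j`. -/
abbrev UnitRing (k : Type u) [Field k] (d : ℕ) : Type u :=
  Localization.Away (∏ i : Fin d, (MvPolynomial.X (i, 0) : MvPolynomial (Fin d × ℕ) k))

/-- The value of regular functions at a unit with coordinates in `K`. -/
def evalUnit {k : Type u} [Field k] {d : ℕ} {K : Type u} [Field K] [Algebra k K]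
    (μ : (Fin d → PowerSeries K)ˣ) : UnitRing k d →ₐ[k] K :=
  IsLocalization.liftAlgHom (M := Submonoid.powers
      (∏ i : Fin d, (MvPolynomial.X (i, 0) : MvPolynomial (Fin d × ℕ) k)))
    (f := MvPolynomial.aeval (R := k) fun p : Fin d × ℕ =>
      PowerSeries.coeff p.2 ((μ : Fin d → PowerSeries K) p.1))
    (by
      rintro ⟨_, m, rfl⟩
      have h : ∀ i, PowerSeries.constantCoeff ((μ : Fin d → PowerSeries K) i) ≠ 0 := fun i =>
        ((PowerSeries.isUnit_iff_constantCoeff).1 (Pi.isUnit_iff.1 μ.isUnit i)).ne_zero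
      simp [Finset.prod_ne_zero_iff, h])

/-- `w` is a unit of `O`, with coordinates in `K`. -/
def IsUnitPoint {k : Type u} [Field k] {d : ℕ} (O : Subalgebra k (Fin d → PowerSeries k))
    {K : Type u} [Field K] [Algebra k K] (w : (Fin d → PowerSeries K)ˣ) : Prop :=
  (w : Fin d → PowerSeries K) ∈ points O K ∧ ((w⁻¹ : (Fin d → PowerSeries K)ˣ) :
    Fin d → PowerSeries K) ∈ points O K

/-- The coordinate ring of the affine algebraic group `J`, the quotient of the group of units of the
normalization by the group of units of `O`: the regular functions on the former that are
invariant under the latter. -/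
def jacRing {k : Type u} [Field k] {d : ℕ} (O : Subalgebra k (Fin d → PowerSeries k)) :
    Subalgebra k (UnitRing k d) where
  carrier := {f | ∀ (K : Type u) [Field K] [Algebra k K] (μ w : (Fin d → PowerSeries K)ˣ),
    IsUnitPoint O w → evalUnit (k := k) (μ * w) f = evalUnit (k := k) μ f}
  mul_mem' := fun hf hg K _ _ μ w hw => by rw [map_mul, map_mul, hf K μ w hw, hg K μ w hw]
  add_mem' := fun hf hg K _ _ μ w hw => by rw [map_add, map_add, hf K μ w hw, hg K μ w hw]
  algebraMap_mem' := fun c K _ _ μ w _ => by rw [AlgHom.commutes, AlgHom.commutes]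

/-- The algebraic group `J`, as a scheme over `k`. -/
def jac {k : Type u} [Field k] {d : ℕ} (O : Subalgebra k (Fin d → PowerSeries k)) :
    Over (Spec (CommRingCat.of k)) :=
  specOver k (jacRing O)

/-- The point of `J` given by (the class of) the unit `μ` with coordinates in `K`. -/
def jacPoint {k : Type u} [Field k] {d : ℕ} (O : Subalgebra k (Fin d → PowerSeries k))
    {K : Type u} [Field K] [Algebra k K] (μ : (Fin d → PowerSeries K)ˣ) : (jac O).left :=
  show PrimeSpectrum (jacRing O) from
    ⟨RingHom.ker ((evalUnit (k := k) μ).comp (jacRing O).val), RingHom.ker_isPrime _⟩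

/-! ### The zeta function -/

/-- The principal ideal `z O`, with coordinates in `K`. -/
def principal {k : Type u} [Field k] {d : ℕ} (O : Subalgebra k (Fin d → PowerSeries k))
    {K : Type u} [Field K] [Algebra k K] (z : Fin d → PowerSeries K) :
    Set (Fin d → PowerSeries K) :=
  {y | ∃ w ∈ points O K, y = z * w}

/-- The set `ℐ_n` of the ideals `z O` with `z ∈ O`, `v(z) = n`, with coordinates in `K`. -/
def idealSet {k : Type u} [Field k] {d : ℕ} (O : Subalgebra k (Fin d → PowerSeries k))
    (n : Fin d →₀ ℕ) (K : Type u) [Field K] [Algebra k K] : Set (Set (Fin d → PowerSeries K)) :=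
  {I | ∃ z ∈ points O K, (∀ i, (z i).order = n i) ∧ I = principal O z}

/-- The element `t^n = (t₁^{n₁}, …, t_d^{n_d})`. -/
def tPow {d : ℕ} (K : Type u) [Field K] (n : Fin d →₀ ℕ) : Fin d → PowerSeries K :=
  fun i => PowerSeries.X ^ n i

/-- The subset `σ_n(ℐ_n)` of `J`, where `σ_n` sends the ideal `t^n μ O`, with `μ` a unit of the
normalization, to the class of `μ`. -/
def sigmaIdeals {k : Type u} [Field k] {d : ℕ} (O : Subalgebra k (Fin d → PowerSeries k))
    (n : Fin d →₀ ℕ) : Set (jac O).left :=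
  {p | ∃ (K : Type u) (_ : Field K) (_ : Algebra k K) (μ : (Fin d → PowerSeries K)ˣ),
    principal O (tPow K n * (μ : Fin d → PowerSeries K)) ∈ idealSet O n K ∧ p = jacPoint O μ}

open Classical in
/-- The zeta function `Z(T₁, …, T_d, O) = ∑_{n ∈ S} [ℐ_n] 𝕃^{-‖n‖} T^n`. -/
def zeta {k : Type u} [Field k] {d : ℕ} (O : Subalgebra k (Fin d → PowerSeries k)) :
    MvPowerSeries (Fin d) (Mot k) :=
  fun n => if n ∈ semigroup O then
    algebraMap (K0 k) (Mot k) (setClass (jac O) (sigmaIdeals O n)) * Mot.Linv k ^ nrm n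
  else 0

end CurveZeta

end

open AlgebraicGeometry CategoryTheory

noncomputable section

namespace CurveZeta

attribute [local instance] MvPolynomial.gradedAlgebra MvPolynomial.algebraMvPolynomial

/-! ### Topological preliminaries -/

/-! The identity is proved coefficient by coefficient. Since `O` has finite codimension, it contains
everything divisible by some `t^M`, so membership in `O` is a finite system of linear equations
modulo `t^M`. An element of value `n` is `t^n μ` with `μ` a unit, and whether it lies in `O` depends
only on the class of `μ` in `J`. Jets of order `n + M - 1` see both `μ` modulo `t^M` and the
equations of `O`. So the projectivized jets of elements of `O` with value `n` map onto `ℐ_n ⊆ J`,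
with fibre the units of `O` modulo `t^M` and modulo scalars.

This fibration is globally trivial. Gaussian elimination on the coefficients, ordered by exponent
first, yields a set `E` of free parameters for `O` modulo `t^M` (`exists_frame`). In this order
multiplication by a unit is triangular with invertible diagonal (`Frame.isUnit_det_matrix`), so
modulo `t^M` each class in `J` has exactly one representative whose coefficients in `E` are those of
`1`. This normal form is a section of the quotient map (`Frame.retraction_coe`), and the `|E| - 1`
remaining parameters are coordinates on the fibres (`Frame.jetSet_eq`). The jets therefore have
class `[ℐ_n] 𝕃^(|E|-1)` and Euler characteristic `[ℐ_n] 𝕃^(|E|-1-‖n‖-dM)`. With `δ + |E| = dM`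
(`Frame.sdelta_add_card`) this is `[ℐ_n] 𝕃^(-‖n‖-δ-1)`.

Two foundations are needed: classes of constructible sets do not depend on the decomposition
(`HasClass.unique`), and `χ_g` does not depend on the jet order, because linear projections of
projective spaces are affine bundles (`IsCylinderOver.eulerChar_eq`). The bound `d ≤ |k|` enters
only for `n` outside `S`, where no point over any extension field may have value `n`
(`mem_semigroup_of_mem_points`). -/

theorem exists_interior_nonempty_of_iUnion_eq_univ {X : Type*} [TopologicalSpace X] [Nonempty X]
    {α : Type*} [Finite α] (F : α → Set X) (hF : ∀ a, IsClosed (F a)) (h : ⋃ a, F a = Set.univ) :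
    ∃ a, (interior (F a)).Nonempty := by
  by_contra! hne
  have : interior (⋃ a ∈ (Set.univ : Set α), F a) = ∅ := by
    refine Set.Finite.induction_on (motive := fun s _ => interior (⋃ a ∈ s, F a) = ∅) _
      Set.finite_univ (by simp) ?_
    intro a s _ hs ih
    rw [Set.biUnion_insert, interior_union_isClosed_of_interior_empty (hF a), hne a]
    rw [ih]
  simp [h] at this

/-- Some closure has nonempty interior, and a locally closed set is open in its closure. -/
theorem exists_isOpen_subset_of_isLocallyClosed_cover {X : Type*} [TopologicalSpace X] [Nonempty X]
    {α : Type*} [Finite α] (F : α → Set X) (hF : ∀ a, IsLocallyClosed (F a))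
    (h : ⋃ a, F a = Set.univ) : ∃ a, ∃ U : Set X, IsOpen U ∧ U.Nonempty ∧ U ⊆ F a := by
  obtain ⟨a, ha⟩ := exists_interior_nonempty_of_iUnion_eq_univ (fun a => closure (F a))
    (fun a => isClosed_closure)
    (Set.eq_univ_of_subset (Set.iUnion_mono fun a => subset_closure) h)
  obtain ⟨O, C, hO, hC, e⟩ := hF a
  refine ⟨a, interior (closure (F a)) ∩ O, isOpen_interior.inter hO, ?_, ?_⟩
  · obtain ⟨x, hx⟩ := ha
    obtain ⟨y, hy, hy'⟩ := mem_closure_iff.1 (interior_subset hx) _ isOpen_interior hx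
    exact ⟨y, hy, (e.subset hy').1⟩
  · rintro x ⟨hx, hxO⟩
    refine e.symm.subset ⟨hxO, ?_⟩
    exact hC.closure_subset_iff.2 (e.subset.trans Set.inter_subset_right) (interior_subset hx)

/-- Allowing every `Z` makes the induction work: for a union, the second set is tested on the part
of `Z` already separated from the first. This feeds the Noetherian induction that gives
constructible sets a class. -/
theorem _root_.Topology.IsConstructible.exists_isOpen_subset_or_disjoint {X : Type*}
    [TopologicalSpace X] {Y : Set X} (hY : Topology.IsConstructible Y) (Z : Set X)
    (hZ : Z.Nonempty) :
    ∃ U : Set X, IsOpen U ∧ (Z ∩ U).Nonempty ∧ (Z ∩ U ⊆ Y ∨ Disjoint (Z ∩ U) Y) := by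
  induction hY using Topology.IsConstructible.empty_union_induction generalizing Z with
  | open_retrocompact U hU _ =>
    by_cases h : (Z ∩ U).Nonempty
    · exact ⟨U, hU, h, .inl Set.inter_subset_right⟩
    · refine ⟨Set.univ, isOpen_univ, by simpa, .inr ?_⟩
      rw [Set.inter_univ]
      exact Set.disjoint_iff_inter_eq_empty.2 (Set.not_nonempty_iff_eq_empty.1 h)
  | union s hs t ht ihs iht =>
    obtain ⟨U, hU, hne, h | h⟩ := ihs Z hZ
    · exact ⟨U, hU, hne, .inl (h.trans Set.subset_union_left)⟩
    obtain ⟨U', hU', hne', h'⟩ := iht (Z ∩ U) hne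
    refine ⟨U ∩ U', hU.inter hU', by rwa [← Set.inter_assoc], ?_⟩
    rw [← Set.inter_assoc]
    refine h'.imp (fun h => h.trans Set.subset_union_right) fun h' => ?_
    exact Set.disjoint_union_right.2 ⟨h.mono_left Set.inter_subset_left, h'⟩
  | compl s hs ih =>
    obtain ⟨U, hU, hne, h⟩ := ih Z hZ
    refine ⟨U, hU, hne, h.symm.imp (fun h => ?_) (fun h => ?_)⟩
    · exact Set.subset_compl_iff_disjoint_right.2 h
    · exact Set.disjoint_compl_right_iff_subset.2 h

/-! ### Subvarieties and their classes -/

variable {k : Type u} [Field k]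

attribute [instance] Variety.finiteType Variety.quasiCompact Variety.separated

instance Variety.isNoetherian (V : Variety k) : IsNoetherian V.X.left :=
  have := LocallyOfFiniteType.isLocallyNoetherian V.X.hom
  have : CompactSpace V.X.left := (quasiCompact_iff_compactSpace (Y := Spec (CommRingCat.of k))
    (f := V.X.hom)).1 inferInstance
  { }

/-- The variety structure on a scheme immersed in a variety. -/
def Variety.ofImmersion (V : Variety k) {Y : Scheme.{u}} (f : Y ⟶ V.X.left) [IsImmersion f] :
    Variety k where
  X := Over.mk (f ≫ V.X.hom)
  finiteType := inferInstanceAs (LocallyOfFiniteType (f ≫ V.X.hom))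
  quasiCompact := by
    have : TopologicalSpace.NoetherianSpace Y :=
      (Scheme.Hom.isEmbedding f).isInducing.noetherianSpace
    exact inferInstanceAs (QuasiCompact (f ≫ V.X.hom))
  separated := inferInstanceAs (IsSeparated (f ≫ V.X.hom))

/-- The immersion of `Variety.ofImmersion` as a morphism over `k`. -/
def Variety.ofImmersionHom (V : Variety k) {Y : Scheme.{u}} (f : Y ⟶ V.X.left) [IsImmersion f] :
    (V.ofImmersion f).X ⟶ V.X :=
  Over.homMk f

theorem exists_isOpenImmersion_range_eq {X : Scheme.{u}} {U : Set X} (hU : IsOpen U) :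
    ∃ (Y : Scheme.{u}) (f : Y ⟶ X), IsOpenImmersion f ∧ Set.range f = U :=
  ⟨_, Scheme.Opens.ι ⟨U, hU⟩, inferInstance, by simp⟩

theorem exists_isClosedImmersion_range_eq {X : Scheme.{u}} {C : Set X} (hC : IsClosed C) :
    ∃ (Y : Scheme.{u}) (f : Y ⟶ X), IsClosedImmersion f ∧ Set.range f = C :=
  ⟨_, (Scheme.IdealSheafData.vanishingIdeal ⟨C, hC⟩).subschemeι, inferInstance, by
    rw [Scheme.IdealSheafData.range_subschemeι]
    exact Scheme.IdealSheafData.coe_support_vanishingIdeal _⟩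

theorem range_comp {X Y Z : Scheme.{u}} (f : X ⟶ Y) (g : Y ⟶ Z) :
    Set.range (f ≫ g) = g '' Set.range f := by
  ext x
  simp

/-! ### Consequences of the defining relations. -/

namespace K0

theorem cls_congr {V W : Variety k} (e : V.X ≅ W.X) : cls V = cls W := by
  rw [← sub_eq_zero]
  exact Ideal.Quotient.eq_zero_iff_mem.2 (Ideal.subset_span (K0Rel.iso V W e))

theorem cls_scissor {V U Z : Variety k} (j : U.X ⟶ V.X) (i : Z.X ⟶ V.X)
    (hj : IsOpenImmersion j.left) (hi : IsClosedImmersion i.left)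
    (h : Set.range j.left = (Set.range i.left)ᶜ) : cls V = cls U + cls Z := by
  rw [← sub_eq_zero]
  exact Ideal.Quotient.eq_zero_iff_mem.2 (Ideal.subset_span (K0Rel.scissor V U Z j i hj hi h))

theorem cls_prod {V W P : Variety k} (p : P.X ⟶ V.X) (q : P.X ⟶ W.X)
    (h : IsPullback p.left q.left V.X.hom W.X.hom) : cls P = cls V * cls W := by
  rw [← sub_eq_zero]
  exact Ideal.Quotient.eq_zero_iff_mem.2 (Ideal.subset_span (K0Rel.prod V W P p q h))

theorem cls_point : cls (Variety.spec k k) = 1 := by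
  rw [← sub_eq_zero]
  exact Ideal.Quotient.eq_zero_iff_mem.2 (Ideal.subset_span K0Rel.point)

theorem cls_eq_zero (V : Variety k) [IsEmpty V.X.left] : cls V = 0 := by
  have h := cls_scissor (𝟙 V.X) (𝟙 V.X) (by simp; infer_instance) (by simp; infer_instance)
    (by ext x; exact (IsEmpty.false (α := V.X.left) x).elim)
  simpa using h

/-- A surjective immersion is closed with empty complement, so the scissor relation applies;
nilpotents thus do not affect classes. -/
theorem cls_eq_of_surjective {V Z : Variety k} (i : Z.X ⟶ V.X) [IsImmersion i.left]
    (hs : Function.Surjective i.left) : cls Z = cls V := by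
  have hi : IsClosedImmersion i.left := .of_isPreimmersion _ (by
    rw [hs.range_eq]; exact isClosed_univ)
  obtain ⟨U, j, hj, hU⟩ := exists_isOpenImmersion_range_eq (X := V.X.left) isOpen_empty
  have : IsEmpty (V.ofImmersion j).X.left := Set.range_eq_empty_iff.1 hU
  rw [cls_scissor (V.ofImmersionHom j) i (inferInstanceAs (IsOpenImmersion j)) hi,
    cls_eq_zero (V.ofImmersion j), zero_add]
  rw [hs.range_eq, Set.range_eq_empty, Set.compl_univ]

end K0

/-- The intersection of two subvarieties, as a subvariety of the first. -/
def Variety.inter (W : Variety k) {V : Scheme.{u}} (f : W.X.left ⟶ V) {Y : Scheme.{u}} (g : Y ⟶ V)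
    [IsImmersion g] : Variety k :=
  W.ofImmersion (Limits.pullback.fst f g)

/-- Noetherian induction: one piece contains a nonempty open `U`, over which the other pieces are
empty. Cutting the variety and every piece along `U` leaves the complement of `U`, a smaller closed
set with the induced partition. -/
theorem K0.cls_eq_sum {α : Type*} [Fintype α] (V : Variety k) (P : α → Variety k)
    (ι : ∀ a, (P a).X ⟶ V.X) (hι : ∀ a, IsImmersion (ι a).left)
    (hd : ∀ a b, a ≠ b → Disjoint (Set.range (ι a).left) (Set.range (ι b).left))
    (hc : ⋃ a, Set.range (ι a).left = Set.univ) : cls V = ∑ a, cls (P a) := by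
  -- Generalized to varieties closed in the fixed `V`, so that the induction can run over closed
  -- subsets of one Noetherian space.
  suffices H : ∀ (C : TopologicalSpace.Closeds V.X.left) (Z : Variety k) (z : Z.X ⟶ V.X),
      IsClosedImmersion z.left → Set.range z.left = C →
      ∀ (P : α → Variety k) (ι : ∀ a, (P a).X ⟶ Z.X), (∀ a, IsImmersion (ι a).left) →
      (∀ a b, a ≠ b → Disjoint (Set.range (ι a).left) (Set.range (ι b).left)) →
      (⋃ a, Set.range (ι a).left = Set.univ) → cls Z = ∑ a, cls (P a) from
    H ⊤ V (𝟙 _) (by rw [Over.id_left]; infer_instance) (by simp) P ι hι hd hc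
  clear! P
  intro C
  induction C using WellFoundedLT.induction with
  | ind C ih =>
  intro Z z hz hzC P ι hι hd hc
  by_cases hne : Nonempty Z.X.left
  swap
  · have : IsEmpty Z.X.left := not_nonempty_iff.1 hne
    have (a : α) : IsEmpty (P a).X.left := (ι a).left.base.hom.1.isEmpty
    rw [cls_eq_zero, Finset.sum_eq_zero]
    exact fun a _ => cls_eq_zero _
  obtain ⟨a₀, U, hU, ⟨x₀, hx₀⟩, hUa⟩ := exists_isOpen_subset_of_isLocallyClosed_cover
    (fun a => Set.range (ι a).left) (fun a => (ι a).left.isLocallyClosed_range) hc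
  obtain ⟨ZU, j, hj, hrU⟩ := exists_isOpenImmersion_range_eq hU
  obtain ⟨ZC, i, hi, hrange⟩ := exists_isClosedImmersion_range_eq hU.isClosed_compl
  let Q (a : α) : Variety k := (P a).inter (ι a).left j
  let R (a : α) : Variety k := (P a).inter (ι a).left i
  have hP (a : α) : cls (P a) = cls (Q a) + cls (R a) := by
    refine cls_scissor ((P a).ofImmersionHom _) ((P a).ofImmersionHom _)
      (inferInstanceAs (IsOpenImmersion (Limits.pullback.fst (ι a).left j)))
      (inferInstanceAs (IsClosedImmersion (Limits.pullback.fst (ι a).left i))) ?_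
    change Set.range (Limits.pullback.fst (ι a).left j) =
      (Set.range (Limits.pullback.fst (ι a).left i))ᶜ
    rw [Scheme.Pullback.range_fst, Scheme.Pullback.range_fst, hrange, hrU, Set.preimage_compl,
      compl_compl]
  have hZ : cls Z = cls (Z.ofImmersion j) + cls (Z.ofImmersion i) := by
    refine cls_scissor (Z.ofImmersionHom _) (Z.ofImmersionHom _)
      (inferInstanceAs (IsOpenImmersion j)) (inferInstanceAs (IsClosedImmersion i)) ?_
    change Set.range j = (Set.range i)ᶜ
    rw [hrange, hrU, compl_compl]
  have hQ : cls (Z.ofImmersion j) = ∑ a, cls (Q a) := by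
    let q (a : α) : (Q a).X ⟶ (Z.ofImmersion j).X :=
      Over.homMk (Limits.pullback.snd (ι a).left j) (by
        change Limits.pullback.snd (ι a).left j ≫ j ≫ Z.X.hom =
          Limits.pullback.fst (ι a).left j ≫ (P a).X.hom
        rw [← Limits.pullback.condition_assoc, Over.w])
    have hq (a : α) : Set.range (q a).left = j ⁻¹' (Set.range (ι a).left) :=
      Scheme.Pullback.range_snd _ _
    -- Over `U` the piece `a₀` is everything and the others are empty.
    rw [Finset.sum_eq_single a₀]
    · have : IsImmersion (q a₀).left :=
        inferInstanceAs (IsImmersion (Limits.pullback.snd (ι a₀).left j))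
      refine (cls_eq_of_surjective (q a₀) ?_).symm
      refine Set.range_eq_univ.1 ((hq a₀).trans (Set.eq_univ_iff_forall.2 fun x => ?_))
      exact hUa (hrU ▸ ⟨x, rfl⟩)
    · intro b _ hb
      have : IsEmpty (Q b).X.left := by
        refine (Set.range_eq_empty_iff (f := (q b).left)).1
          ((hq b).trans (Set.eq_empty_iff_forall_notMem.2 fun x hx => ?_))
        exact Set.disjoint_left.1 (hd _ _ hb) hx (hUa (hrU ▸ ⟨x, rfl⟩))
      exact cls_eq_zero _
    · simp
  have hR : cls (Z.ofImmersion i) = ∑ a, cls (R a) := by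
    let q (a : α) : (R a).X ⟶ (Z.ofImmersion i).X :=
      Over.homMk (Limits.pullback.snd (ι a).left i) (by
        change Limits.pullback.snd (ι a).left i ≫ i ≫ Z.X.hom =
          Limits.pullback.fst (ι a).left i ≫ (P a).X.hom
        rw [← Limits.pullback.condition_assoc, Over.w])
    have hq (a : α) : Set.range (q a).left = i ⁻¹' (Set.range (ι a).left) :=
      Scheme.Pullback.range_snd _ _
    have hcl : IsClosedImmersion (i ≫ z.left) := inferInstance
    refine ih ⟨Set.range (i ≫ z.left), (Scheme.Hom.isClosedEmbedding _).isClosed_range⟩ ?_ _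
      (Z.ofImmersionHom _ ≫ z) hcl rfl R q
      (fun a => inferInstanceAs (IsImmersion (Limits.pullback.snd (ι a).left i))) ?_ ?_
    · rw [← SetLike.coe_ssubset_coe, ← hzC]
      change Set.range (i ≫ z.left) ⊂ _
      rw [range_comp]
      refine Set.ssubset_iff_of_subset (Set.image_subset_range _ _) |>.2 ⟨z.left x₀, ⟨_, rfl⟩, ?_⟩
      rintro ⟨y, hy, e⟩
      obtain rfl := z.left.isEmbedding.injective e
      exact hrange.subset hy hx₀
    · intro a b hab
      exact ((hd a b hab).preimage _).mono (hq a).le (hq b).le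
    · rw [Set.iUnion_congr hq]
      exact (Set.preimage_iUnion.symm.trans (congrArg (i ⁻¹' ·) hc)).trans Set.preimage_univ
  rw [hZ, hQ, hR, ← Finset.sum_add_distrib]
  exact Finset.sum_congr rfl fun a _ => (hP a).symm

/-! ### Classes of constructible sets -/

theorem hasClass_of_fintype {V : Over (Spec (CommRingCat.of k))} {Y : Set V.left} {α : Type*}
    [Fintype α] (W : α → Variety k) (ι : ∀ a, (W a).X ⟶ V) (hι : ∀ a, IsImmersion (ι a).left)
    (hd : ∀ a b, a ≠ b → Disjoint (Set.range (ι a).left) (Set.range (ι b).left))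
    (hY : ⋃ a, Set.range (ι a).left = Y) : HasClass V Y (∑ a, K0.cls (W a)) := by
  let e := (Fintype.equivFin α).symm
  refine ⟨Fintype.card α, W ∘ e, fun a => ι (e a), fun a => hι _,
    fun a b h => hd _ _ (e.injective.ne h), ?_, ?_⟩
  · rw [← hY]
    exact e.surjective.iUnion_comp fun a => Set.range (ι a).left
  · exact (Equiv.sum_comp e (fun a => K0.cls (W a))).symm

/-- Both sums equal the sum over the common refinement by fibre products. Hence the arbitrary choice
in `setClass` is harmless. -/
theorem HasClass.unique {V : Over (Spec (CommRingCat.of k))} {Y : Set V.left} {x y : K0 k}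
    (hx : HasClass V Y x) (hy : HasClass V Y y) : x = y := by
  obtain ⟨r, W, ι, hι, hd, hY, rfl⟩ := hx
  obtain ⟨r', W', ι', hι', hd', hY', rfl⟩ := hy
  have h1 (a : Fin r) : K0.cls (W a) = ∑ b, K0.cls ((W a).inter (ι a).left (ι' b).left) := by
    refine K0.cls_eq_sum _ _ (fun b => (W a).ofImmersionHom _)
      (fun b => inferInstanceAs (IsImmersion (Limits.pullback.fst (ι a).left (ι' b).left))) ?_ ?_
    · intro b c hbc
      change Disjoint (Set.range (Limits.pullback.fst (ι a).left (ι' b).left))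
        (Set.range (Limits.pullback.fst (ι a).left (ι' c).left))
      rw [Scheme.Pullback.range_fst, Scheme.Pullback.range_fst]
      exact (hd' b c hbc).preimage _
    · change ⋃ b, Set.range (Limits.pullback.fst (ι a).left (ι' b).left) = _
      simp_rw [Scheme.Pullback.range_fst]
      rw [← Set.preimage_iUnion, hY', ← hY, Set.eq_univ_iff_forall]
      exact fun x => Set.mem_iUnion.2 ⟨a, x, rfl⟩
  have h2 (b : Fin r') : K0.cls (W' b) = ∑ a, K0.cls ((W a).inter (ι a).left (ι' b).left) := by
    refine K0.cls_eq_sum _ _ (fun a => Over.homMk (Limits.pullback.snd (ι a).left (ι' b).left) ?_)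
      (fun a => ?_) ?_ ?_
    · change Limits.pullback.snd (ι a).left (ι' b).left ≫ (W' b).X.hom =
        Limits.pullback.fst (ι a).left (ι' b).left ≫ (W a).X.hom
      rw [← Over.w (ι' b), ← Limits.pullback.condition_assoc, Over.w]
    · exact inferInstanceAs (IsImmersion (Limits.pullback.snd (ι a).left (ι' b).left))
    · intro a c hac
      change Disjoint (Set.range (Limits.pullback.snd (ι a).left (ι' b).left))
        (Set.range (Limits.pullback.snd (ι c).left (ι' b).left))
      rw [Scheme.Pullback.range_snd, Scheme.Pullback.range_snd]
      exact (hd a c hac).preimage _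
    · change ⋃ a, Set.range (Limits.pullback.snd (ι a).left (ι' b).left) = _
      simp_rw [Scheme.Pullback.range_snd]
      rw [← Set.preimage_iUnion, hY, ← hY', Set.eq_univ_iff_forall]
      exact fun x => Set.mem_iUnion.2 ⟨b, x, rfl⟩
  rw [Finset.sum_congr rfl fun a _ => h1 a, Finset.sum_comm]
  exact Finset.sum_congr rfl fun b _ => (h2 b).symm

theorem setClass_eq {V : Over (Spec (CommRingCat.of k))} {Y : Set V.left} {x : K0 k}
    (hx : HasClass V Y x) : setClass V Y = x := by
  have h : ∃ x, HasClass V Y x := ⟨x, hx⟩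
  rw [setClass, dif_pos h]
  exact h.choose_spec.unique hx

theorem HasClass.empty (V : Over (Spec (CommRingCat.of k))) : HasClass V ∅ 0 :=
  ⟨0, Fin.elim0, fun a => a.elim0, fun a => a.elim0, fun a => a.elim0, by simp, by simp⟩

theorem HasClass.union {V : Over (Spec (CommRingCat.of k))} {Y Y' : Set V.left} {x y : K0 k}
    (hx : HasClass V Y x) (hy : HasClass V Y' y) (hYY : Disjoint Y Y') :
    HasClass V (Y ∪ Y') (x + y) := by
  obtain ⟨r, W, ι, hι, hd, hY, rfl⟩ := hx
  obtain ⟨r', W', ι', hι', hd', hY', rfl⟩ := hy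
  have key := hasClass_of_fintype (V := V) (Y := Y ∪ Y') (α := Fin r ⊕ Fin r') (Sum.elim W W')
    (fun a => match a with | .inl a => ι a | .inr b => ι' b)
    (fun a => match a with | .inl a => hι a | .inr b => hι' b) ?_ ?_
  · simpa using key
  · have hs (a b) : Disjoint (Set.range (ι a).left) (Set.range (ι' b).left) :=
      hYY.mono (by rw [← hY]; exact Set.subset_iUnion (fun a => Set.range (ι a).left) a)
        (by rw [← hY']; exact Set.subset_iUnion (fun a => Set.range (ι' a).left) b)
    rintro (a | a) (b | b) hab
    · exact hd a b (by simpa using hab)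
    · exact hs a b
    · exact (hs b a).symm
    · exact hd' a b (by simpa using hab)
  · rw [Set.iUnion_sum, ← hY, ← hY']
    rfl

theorem HasClass.image {V E : Over (Spec (CommRingCat.of k))} (f : V ⟶ E) [IsImmersion f.left]
    {Y : Set V.left} {x : K0 k} (hx : HasClass V Y x) : HasClass E (f.left '' Y) x := by
  obtain ⟨r, W, ι, hι, hd, hY, rfl⟩ := hx
  have hr (a) : Set.range (ι a ≫ f).left = f.left '' Set.range (ι a).left := by
    rw [Over.comp_left, range_comp]
  refine ⟨r, W, fun a => ι a ≫ f, fun a => ?_, fun a b hab => ?_, ?_, rfl⟩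
  · rw [Over.comp_left]; infer_instance
  · rw [hr, hr]
    exact Set.disjoint_image_of_injective f.left.isEmbedding.injective (hd a b hab)
  · simp_rw [hr]
    rw [← Set.image_iUnion, hY]

theorem hasClass_range {V : Over (Spec (CommRingCat.of k))} (W : Variety k) (ι : W.X ⟶ V)
    [h : IsImmersion ι.left] : HasClass V (Set.range ι.left) (K0.cls W) := by
  simpa using hasClass_of_fintype (V := V) (Y := Set.range ι.left) (α := Unit) (fun _ => W)
    (fun _ => ι) (fun _ => h) (fun a b hab => (hab rfl).elim) (Set.iUnion_const _)

theorem exists_hasClass_of_isClosed (V : Variety k) {Y : Set V.X.left} (hY : IsClosed Y) :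
    ∃ x, HasClass V.X Y x := by
  obtain ⟨Z, i, hi, rfl⟩ := exists_isClosedImmersion_range_eq hY
  exact ⟨_, hasClass_range _ (V.ofImmersionHom i) (h := inferInstanceAs (IsImmersion i))⟩

theorem exists_hasClass_of_isLocallyClosed (V : Variety k) {Y : Set V.X.left}
    (hY : IsLocallyClosed Y) : ∃ x, HasClass V.X Y x := by
  obtain ⟨O, C, hO, hC, rfl⟩ := hY
  obtain ⟨U, j, hj, rfl⟩ := exists_isOpenImmersion_range_eq hO
  obtain ⟨x, hx⟩ := exists_hasClass_of_isClosed (V.ofImmersion j) (Y := j ⁻¹' C)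
    (hC.preimage j.continuous)
  have : IsImmersion (V.ofImmersionHom j).left := inferInstanceAs (IsImmersion j)
  have h := hx.image (V.ofImmersionHom j)
  refine ⟨x, ?_⟩
  convert h using 1
  change _ = j '' (j ⁻¹' C)
  rw [Set.image_preimage_eq_inter_range, Set.inter_comm]

/-- Noetherian induction on `C`: on a nonempty open part of `C` the set is everything or nothing, so
it is locally closed or empty there, and the rest of `C` is a smaller closed set. -/
theorem exists_hasClass_of_isConstructible (V : Variety k) {Y : Set V.X.left}
    (hY : Topology.IsConstructible Y) : ∃ x, HasClass V.X Y x := by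
  suffices H : ∀ C : TopologicalSpace.Closeds V.X.left, ∃ x, HasClass V.X (Y ∩ C) x by
    simpa using H ⊤
  intro C
  induction C using WellFoundedLT.induction with
  | ind C ih =>
  by_cases hne : (C : Set V.X.left).Nonempty
  swap
  · rw [Set.not_nonempty_iff_eq_empty] at hne
    exact ⟨0, by rw [hne, Set.inter_empty]; exact HasClass.empty _⟩
  obtain ⟨U, hU, ⟨x₀, hx₀, hx₀U⟩, h⟩ := hY.exists_isOpen_subset_or_disjoint _ hne
  obtain ⟨x, hx⟩ := ih ⟨C ∩ Uᶜ, C.isClosed.inter hU.isClosed_compl⟩ (by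
    rw [← SetLike.coe_ssubset_coe]
    refine Set.ssubset_iff_of_subset Set.inter_subset_left |>.2 ⟨x₀, hx₀, fun h => h.2 hx₀U⟩)
  change HasClass V.X (Y ∩ (C ∩ Uᶜ)) x at hx
  obtain h | h := h
  · obtain ⟨y, hy⟩ := exists_hasClass_of_isLocallyClosed V
      (C.isClosed.isLocallyClosed.inter hU.isLocallyClosed)
    refine ⟨y + x, ?_⟩
    convert hy.union hx ?_ using 1
    · ext p
      have := @h p
      simp only [Set.mem_inter_iff, Set.mem_union, Set.mem_compl_iff] at this ⊢
      tauto
    · rw [Set.disjoint_left]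
      exact fun p hp hp' => hp'.2.2 hp.2
  · refine ⟨x, ?_⟩
    convert hx using 1
    ext p
    have := @Set.disjoint_left.1 h p
    simp only [Set.mem_inter_iff, Set.mem_compl_iff] at this ⊢
    tauto

/-! ### Affine spaces -/

variable {k : Type u} [Field k]

/-- The morphism of spectra over `k` given by a homomorphism of `k`-algebras. -/
def specMap {A B : Type u} [CommRing A] [CommRing B] [Algebra k A] [Algebra k B] (f : A →ₐ[k] B) :
    specOver k B ⟶ specOver k A :=
  Over.homMk (Spec.map (CommRingCat.ofHom f.toRingHom)) (by
    change Spec.map _ ≫ Spec.map _ = Spec.map _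
    rw [← Spec.map_comp, ← CommRingCat.ofHom_comp]
    congr 2
    exact f.comp_algebraMap)

/-- Isomorphic algebras have isomorphic spectra. -/
def specIso {A B : Type u} [CommRing A] [CommRing B] [Algebra k A] [Algebra k B] (f : A ≃ₐ[k] B) :
    specOver k B ≅ specOver k A :=
  Over.isoMk (Scheme.Spec.mapIso f.toRingEquiv.toCommRingCatIso.op) (by
    change Spec.map _ ≫ Spec.map _ = Spec.map _
    rw [← Spec.map_comp]
    congr 1
    ext x
    exact f.commutes x)

theorem isPullback_spec_mvPolynomial (A B : Type u) [CommRing A] [CommRing B] [Algebra A B]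
    (ι : Type) :
    IsPullback
      (Spec.map (CommRingCat.ofHom (algebraMap B (MvPolynomial ι B))))
      (Spec.map (CommRingCat.ofHom (MvPolynomial.map (algebraMap A B))))
      (Spec.map (CommRingCat.ofHom (algebraMap A B)))
      (Spec.map (CommRingCat.ofHom (algebraMap A (MvPolynomial ι A)))) :=
  isPullback_SpecMap_of_isPushout _ _ _ _ (CommRingCat.isPushout_of_isPushout A B
    (MvPolynomial ι A) (MvPolynomial ι B))

theorem K0.cls_spec_congr {A B : Type u} [CommRing A] [CommRing B] [Algebra k A] [Algebra k B]
    [Algebra.FiniteType k A] [Algebra.FiniteType k B] (f : A ≃ₐ[k] B) :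
    cls (Variety.spec k A) = cls (Variety.spec k B) :=
  (K0.cls_congr (V := Variety.spec k B) (W := Variety.spec k A) (specIso f)).symm

instance {A : Type u} [CommRing A] [Algebra k A] [Algebra.FiniteType k A] (ι : Type) [Finite ι] :
    Algebra.FiniteType k (MvPolynomial ι A) :=
  Algebra.FiniteType.trans (S := A) inferInstance inferInstance

theorem K0.cls_spec_mvPolynomial (ι : Type) [Finite ι] :
    cls (Variety.spec k (MvPolynomial ι k)) = K0.line k ^ Nat.card ι := by
  refine (?_ : ∀ h : Finite ι, cls (Variety.spec k (MvPolynomial ι k)) =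
    K0.line k ^ Nat.card ι) inferInstance
  refine Finite.induction_empty_option (P := fun ι => ∀ h : Finite ι,
      cls (Variety.spec k (MvPolynomial ι k)) = K0.line k ^ Nat.card ι) ?_ ?_ ?_ ι
  · intro α β e ih h
    have := Finite.of_equiv _ e.symm
    rw [← Nat.card_congr e, ← ih this]
    exact (K0.cls_spec_congr (MvPolynomial.renameEquiv k e)).symm
  · intro h
    rw [Nat.card_of_isEmpty, pow_zero, ← K0.cls_point]
    exact K0.cls_spec_congr (MvPolynomial.isEmptyAlgEquiv k PEmpty)
  · intro ι _ ih h
    rw [K0.cls_spec_congr (MvPolynomial.optionEquivRight k ι), Finite.card_option, pow_succ',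
      ← ih inferInstance]
    refine K0.cls_prod (V := Variety.spec k (Polynomial k)) (W := Variety.spec k (MvPolynomial ι k))
      (P := Variety.spec k (MvPolynomial ι (Polynomial k)))
      (specMap (IsScalarTower.toAlgHom k (Polynomial k) (MvPolynomial ι (Polynomial k))))
      (specMap (MvPolynomial.mapAlgHom (Algebra.ofId k (Polynomial k)))) ?_
    exact isPullback_spec_mvPolynomial k (Polynomial k) ι

/-! ### Classes of preimages in relative affine spaces. -/

section Cylinder

variable {A : Type u} [CommRing A] [Algebra k A] (ι : Type) [Finite ι]

/-- The projection from the affine space over `Spec A` to `Spec A`. -/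
def affineProj (k A : Type u) [Field k] [CommRing A] [Algebra k A] (ι : Type) :
    specOver k (MvPolynomial ι A) ⟶ specOver k A :=
  specMap (IsScalarTower.toAlgHom k A (MvPolynomial ι A))

instance : LocallyOfFiniteType ((affineProj k A ι).left) := by
  refine (HasRingHomProperty.Spec_iff (P := @LocallyOfFiniteType)).2 ?_
  exact RingHom.finiteType_algebraMap.2 (inferInstance : Algebra.FiniteType A (MvPolynomial ι A))

instance : QuasiCompact (affineProj k A ι).left := inferInstanceAs (QuasiCompact (Spec.map _))

instance : IsSeparated (affineProj k A ι).left := inferInstanceAs (IsSeparated (Spec.map _))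

/-- The pull back of the affine space over `Spec A` to a variety over `Spec A`. -/
def Variety.affinePullback (W : Variety k) (f : W.X ⟶ specOver k A) : Variety k where
  X := Over.mk (Limits.pullback.fst (C := Scheme.{u}) f.left ((affineProj k A ι).left) ≫ W.X.hom)
  finiteType := inferInstanceAs (LocallyOfFiniteType (_ ≫ _))
  quasiCompact := inferInstanceAs (QuasiCompact (_ ≫ _))
  separated := inferInstanceAs (IsSeparated (_ ≫ _))

/-- Pasting pullback squares identifies affine space over `Spec A`, pulled back to `W`, with the
product of `W` and affine space over `k`. -/
theorem K0.cls_affinePullback (W : Variety k) (f : W.X ⟶ specOver k A) :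
    cls (W.affinePullback ι f) = cls W * K0.line k ^ Nat.card ι := by
  rw [← K0.cls_spec_mvPolynomial]
  have h1 := (IsPullback.of_hasPullback (C := Scheme.{u}) f.left (affineProj k A ι).left).flip.paste_horiz
    (isPullback_spec_mvPolynomial k A ι).flip
  refine K0.cls_prod (P := W.affinePullback ι f) (V := W) (W := Variety.spec k (MvPolynomial ι k))
    (Over.homMk (Limits.pullback.fst (C := Scheme.{u}) f.left (affineProj k A ι).left))
    (Over.homMk (Limits.pullback.snd (C := Scheme.{u}) f.left (affineProj k A ι).left ≫
      Spec.map (CommRingCat.ofHom (MvPolynomial.map (algebraMap k A)))) ?_) ?_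
  · exact h1.w.trans (congrArg (Limits.pullback.fst (C := Scheme.{u}) f.left
      (affineProj k A ι).left ≫ ·) (Over.w f))
  · have := h1.flip
    rwa [show f.left ≫ Spec.map (CommRingCat.ofHom (algebraMap k A)) = W.X.hom from Over.w f]
      at this

/-- The pull back of the affine space over `Spec A` is a subvariety of the latter. -/
def Variety.affinePullbackHom (W : Variety k) (f : W.X ⟶ specOver k A) :
    (W.affinePullback ι f).X ⟶ specOver k (MvPolynomial ι A) :=
  Over.homMk (Limits.pullback.snd (C := Scheme.{u}) f.left (affineProj k A ι).left) (by
    change Limits.pullback.snd (C := Scheme.{u}) f.left (affineProj k A ι).left ≫ _ =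
      Limits.pullback.fst (C := Scheme.{u}) f.left (affineProj k A ι).left ≫ W.X.hom
    rw [← Over.w f, Limits.pullback.condition_assoc, Over.w])

variable {ι}

/-- Each piece lies in the image of `g`, so its base change along `g` is a surjective immersion into
it and has the same class. -/
theorem HasClass.preimage_immersion {V V' : Over (Spec (CommRingCat.of k))} (g : V' ⟶ V)
    [IsImmersion g.left] {Y : Set V.left} {x : K0 k} (hx : HasClass V Y x)
    (hY : Y ⊆ Set.range g.left) : HasClass V' (g.left ⁻¹' Y) x := by
  obtain ⟨r, W, ι, hι, hd, hY', rfl⟩ := hx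
  let p (a) : ((W a).inter (ι a).left g.left).X ⟶ V' :=
    Over.homMk (Limits.pullback.snd (ι a).left g.left) (by
      change Limits.pullback.snd (ι a).left g.left ≫ V'.hom =
        Limits.pullback.fst (ι a).left g.left ≫ (W a).X.hom
      rw [← Over.w (ι a), Limits.pullback.condition_assoc, Over.w])
  have hp (a) : Set.range (p a).left = g.left ⁻¹' Set.range (ι a).left :=
    Scheme.Pullback.range_snd _ _
  refine ⟨r, _, p, fun a => ?_, fun a b hab => ?_, ?_, Finset.sum_congr rfl fun a _ => ?_⟩
  · exact inferInstanceAs (IsImmersion (Limits.pullback.snd (ι a).left g.left))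
  · exact ((hd a b hab).preimage _).mono (hp a).le (hp b).le
  · rw [Set.iUnion_congr hp, ← hY', Set.preimage_iUnion]
  · have : IsImmersion ((W a).ofImmersionHom (Limits.pullback.fst (ι a).left g.left)).left :=
      inferInstanceAs (IsImmersion (Limits.pullback.fst (ι a).left g.left))
    refine (K0.cls_eq_of_surjective
      ((W a).ofImmersionHom (Limits.pullback.fst (ι a).left g.left)) ?_).symm
    refine Set.range_eq_univ.1 ((Scheme.Pullback.range_fst _ _).trans
      (Set.eq_univ_iff_forall.2 fun x => hY ?_))
    rw [← hY']
    exact Set.mem_iUnion.2 ⟨a, x, rfl⟩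

theorem HasClass.preimage_affineProj {Y : Set (specOver k A).left} {x : K0 k}
    (hx : HasClass (specOver k A) Y x) :
    HasClass (specOver k (MvPolynomial ι A)) ((affineProj k A ι).left ⁻¹' Y)
      (x * K0.line k ^ Nat.card ι) := by
  obtain ⟨r, W, j, hj, hd, rfl, rfl⟩ := hx
  have hp (a) : Set.range ((W a).affinePullbackHom ι (j a)).left =
      (affineProj k A ι).left ⁻¹' Set.range (j a).left :=
    Scheme.Pullback.range_snd _ _
  refine ⟨r, _, fun a => (W a).affinePullbackHom ι (j a), fun a => ?_, fun a b hab => ?_, ?_, ?_⟩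
  · exact inferInstanceAs (IsImmersion (Limits.pullback.snd (C := Scheme.{u}) (j a).left
      ((affineProj k A ι).left)))
  · exact ((hd a b hab).preimage _).mono (hp a).le (hp b).le
  · rw [Set.iUnion_congr hp, Set.preimage_iUnion]
  · rw [Finset.sum_mul]
    exact Finset.sum_congr rfl fun a _ => (K0.cls_affinePullback _ _ _).symm

/-- Used twice: for linear projections of jet spaces on an affine chart, and for the bundle of units
over `J`. -/
theorem HasClass.cylinder {V E : Over (Spec (CommRingCat.of k))} (g : specOver k A ⟶ V)
    [IsImmersion g.left] (h : specOver k (MvPolynomial ι A) ⟶ E) [IsImmersion h.left]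
    {Y : Set V.left} {x : K0 k} (hx : HasClass V Y x) (hY : Y ⊆ Set.range g.left) :
    HasClass E (h.left '' ((affineProj k A ι).left ⁻¹' (g.left ⁻¹' Y))) (x * K0.line k ^ Nat.card ι) :=
  ((hx.preimage_immersion g hY).preimage_affineProj).image h

end Cylinder

/-! ### Points with coordinates in extension fields -/

section SpecPoint

variable {k : Type u} [Field k] {A B : Type u} [CommRing A] [Algebra k A] [CommRing B] [Algebra k B]
  {K : Type u} [Field K] [Algebra k K]

/-- The point of `Spec A` given by a homomorphism to a field. -/
def specPoint (χ : A →ₐ[k] K) : (specOver k A).left :=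
  show PrimeSpectrum A from ⟨RingHom.ker χ, RingHom.ker_isPrime _⟩

/-- The field is the fraction field of the quotient by the prime. Thus equalities of sets of points
can be tested on points with coordinates in fields. -/
theorem exists_eq_specPoint (y : (specOver k A).left) :
    ∃ (K : Type u) (_ : Field K) (_ : Algebra k K) (χ : A →ₐ[k] K), y = specPoint χ := by
  let P : PrimeSpectrum A := y
  have hP := P.2
  refine ⟨FractionRing (A ⧸ P.asIdeal), inferInstance, inferInstance,
    (IsScalarTower.toAlgHom k (A ⧸ P.asIdeal) (FractionRing (A ⧸ P.asIdeal))).comp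
      (Ideal.Quotient.mkₐ k P.asIdeal), ?_⟩
  refine PrimeSpectrum.ext ?_
  ext a
  change a ∈ P.asIdeal ↔ algebraMap (A ⧸ P.asIdeal) (FractionRing (A ⧸ P.asIdeal))
    (Ideal.Quotient.mk _ a) = 0
  rw [map_eq_zero_iff _ (IsFractionRing.injective _ _), Ideal.Quotient.eq_zero_iff_mem]

end SpecPoint

/-! ### Projective spaces -/

section ProjSpace

variable {k : Type u} [Field k] {σ : Type}

/-- The homogeneous polynomial `f` vanishes at the point `x` of projective space. -/
def VanishesAt (f : MvPolynomial σ k) (x : (projSpace k σ).left) : Prop :=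
  f ∈ (show ProjectiveSpectrum (MvPolynomial.homogeneousSubmodule σ k) from x).asHomogeneousIdeal

theorem vanishesAt_projPoint {K : Type u} [Field K] [Algebra k K] {w : σ → K} (hw : w ≠ 0)
    {f : MvPolynomial σ k} {n : ℕ} (hf : f.IsHomogeneous n) :
    VanishesAt f (projPoint (k := k) w hw) ↔ MvPolynomial.aeval w f = 0 := by
  constructor
  · exact fun h => Ideal.toIdeal_homogeneousCore_le _ _ h
  · intro h
    exact Ideal.mem_homogeneousCore_of_homogeneous_of_mem ⟨n, hf⟩ h

/-- Forms of degree `0` are constants and separate no points; positive degree is what the comparison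
with basic open sets requires. -/
theorem projSpace_ext {x y : (projSpace k σ).left}
    (h : ∀ n, 0 < n → ∀ f : MvPolynomial σ k, f.IsHomogeneous n → (VanishesAt f x ↔ VanishesAt f y)) :
    x = y := by
  let x' : ProjectiveSpectrum (MvPolynomial.homogeneousSubmodule σ k) := x
  let y' : ProjectiveSpectrum (MvPolynomial.homogeneousSubmodule σ k) := y
  have h0 (z : ProjectiveSpectrum (MvPolynomial.homogeneousSubmodule σ k)) (f : MvPolynomial σ k)
      (hf : f.IsHomogeneous 0) : f ∈ z.asHomogeneousIdeal ↔ f = 0 := by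
    obtain ⟨c, rfl⟩ : ∃ c, f = MvPolynomial.C c := by
      rw [← MvPolynomial.mem_homogeneousSubmodule, MvPolynomial.homogeneousSubmodule_zero,
        Submodule.mem_one] at hf
      obtain ⟨c, rfl⟩ := hf
      exact ⟨c, rfl⟩
    refine ⟨fun h => by_contra fun hc => z.isPrime.ne_top ?_, fun h => h ▸ zero_mem _⟩
    refine Ideal.eq_top_of_isUnit_mem _ h (IsUnit.map _ (Ne.isUnit fun hc' => hc ?_))
    rw [hc', map_zero]
  have h' : ∀ n, ∀ f : MvPolynomial σ k, f.IsHomogeneous n →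
      (f ∈ x'.asHomogeneousIdeal ↔ f ∈ y'.asHomogeneousIdeal) := by
    intro n f hf
    obtain rfl | hn := n.eq_zero_or_pos
    · rw [h0 _ _ hf, h0 _ _ hf]
    · exact h n hn f hf
  refine ProjectiveSpectrum.ext (HomogeneousIdeal.ext' ?_)
  intro n f hf
  exact h' n f hf

theorem aeval_smul_of_isHomogeneous {K : Type u} [CommRing K] [Algebra k K] (w : σ → K) (c : K)
    {f : MvPolynomial σ k} {n : ℕ} (hf : f.IsHomogeneous n) :
    MvPolynomial.aeval (c • w) f = c ^ n * MvPolynomial.aeval w f := by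
  simp only [MvPolynomial.aeval_def, MvPolynomial.eval₂_eq, Finset.mul_sum]
  refine Finset.sum_congr rfl fun e he => ?_
  have hn : e.degree = n := by
    rw [← hf (MvPolynomial.mem_support_iff.1 he), Finsupp.degree_eq_weight_one]
    rfl
  simp only [Pi.smul_apply, smul_eq_mul, mul_pow, Finset.prod_mul_distrib]
  rw [Finset.prod_pow_eq_pow_sum, ← hn, Finsupp.degree_apply]
  ring

theorem projPoint_smul {K : Type u} [Field K] [Algebra k K] {w : σ → K} (hw : w ≠ 0) {c : K}
    (hc : c ≠ 0) (hcw : c • w ≠ 0) : projPoint (k := k) (c • w) hcw = projPoint w hw := by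
  refine projSpace_ext fun n _ f hf => ?_
  rw [vanishesAt_projPoint _ hf, vanishesAt_projPoint _ hf, aeval_smul_of_isHomogeneous _ _ hf]
  simp [hc]

/-- The coordinates live in the fraction field of the homogeneous coordinate ring modulo the prime,
that is, at the generic point of the cone. They are not all zero because the prime does not contain
the irrelevant ideal. -/
theorem exists_eq_projPoint (x : (projSpace k σ).left) :
    ∃ (K : Type u) (_ : Field K) (_ : Algebra k K) (w : σ → K) (hw : w ≠ 0),
      x = projPoint (k := k) w hw := by
  let P : ProjectiveSpectrum (MvPolynomial.homogeneousSubmodule σ k) := x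
  let I : Ideal (MvPolynomial σ k) := P.asHomogeneousIdeal.toIdeal
  have hI : I.IsPrime := P.isPrime
  let χ : MvPolynomial σ k →ₐ[k] FractionRing (MvPolynomial σ k ⧸ I) :=
    (IsScalarTower.toAlgHom k (MvPolynomial σ k ⧸ I) (FractionRing (MvPolynomial σ k ⧸ I))).comp
      (Ideal.Quotient.mkₐ k I)
  have hχ (f) : χ f = 0 ↔ VanishesAt f x := by
    change algebraMap (MvPolynomial σ k ⧸ I) (FractionRing (MvPolynomial σ k ⧸ I))
      (Ideal.Quotient.mk _ f) = 0 ↔ _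
    rw [map_eq_zero_iff _ (IsFractionRing.injective _ _), Ideal.Quotient.eq_zero_iff_mem]
    rfl
  have hw (f) : MvPolynomial.aeval (fun s => χ (MvPolynomial.X s)) f = χ f :=
    DFunLike.congr_fun (MvPolynomial.aeval_unique χ).symm f
  have hne : (fun s => χ (MvPolynomial.X s)) ≠ 0 := by
    intro h0
    apply P.not_irrelevant_le
    rw [HomogeneousIdeal.irrelevant_le]
    intro n hn f hf
    refine (hχ f).1 ?_
    rw [← hw, h0, ← zero_smul (FractionRing (MvPolynomial σ k ⧸ I)) (0 : σ → _), aeval_smul_of_isHomogeneous _ _ hf, zero_pow hn.ne',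
      zero_mul]
  refine ⟨_, inferInstance, inferInstance, _, hne, projSpace_ext fun n _ f hf => ?_⟩
  rw [vanishesAt_projPoint _ hf, hw, hχ]

/-! ### Standard affine charts. -/

open HomogeneousLocalization

variable (k) in
/-- Setting the coordinate `p` equal to `1` in a polynomial. -/
def dehomogenize (p : σ) : MvPolynomial σ k →ₐ[k] MvPolynomial {s : σ // s ≠ p} k :=
  open Classical in
  MvPolynomial.aeval fun s => if h : s = p then 1 else MvPolynomial.X ⟨s, h⟩

theorem X_mem_homogeneousSubmodule (p : σ) :
    (MvPolynomial.X p : MvPolynomial σ k) ∈ MvPolynomial.homogeneousSubmodule σ k 1 :=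
  MvPolynomial.isHomogeneous_X k p

variable (k) in
/-- The isomorphism between the degree `0` part of `k[x_s][x_p⁻¹]` and a polynomial ring. -/
def awayDehomogenize (p : σ) :
    Away (MvPolynomial.homogeneousSubmodule σ k) (MvPolynomial.X p : MvPolynomial σ k) →+*
      MvPolynomial {s : σ // s ≠ p} k :=
  (IsLocalization.Away.lift (S := Localization.Away (MvPolynomial.X p : MvPolynomial σ k))
    (MvPolynomial.X p : MvPolynomial σ k) (g := (dehomogenize k p).toRingHom)
    (by simp [dehomogenize])).comp (algebraMap _ _)

theorem awayDehomogenize_mk (p : σ) (n : ℕ) (f : MvPolynomial σ k)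
    (hf : f ∈ MvPolynomial.homogeneousSubmodule σ k (n • 1)) :
    awayDehomogenize k p (Away.mk _ (X_mem_homogeneousSubmodule p) n f hf) = dehomogenize k p f := by
  rw [awayDehomogenize, RingHom.comp_apply, HomogeneousLocalization.algebraMap_apply, Away.val_mk,
    Localization.mk_eq_mk', IsLocalization.Away.lift, IsLocalization.lift_mk'_spec]
  simp [dehomogenize]

theorem awayDehomogenize_bijective (p : σ) : Function.Bijective (awayDehomogenize k p) := by
  constructor
  · rw [injective_iff_map_eq_zero]
    intro x hx
    obtain ⟨n, a, ha, rfl⟩ := Away.mk_surjective _ (X_mem_homogeneousSubmodule p) x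
    rw [awayDehomogenize_mk] at hx
    -- For injectivity: evaluating the dehomogenization of `a` at the quotients `x_s / x_p` gives `a
    -- / x_p ^ n`, so a vanishing dehomogenization forces that fraction to vanish.
    let R := Localization.Away (MvPolynomial.X p : MvPolynomial σ k)
    let c : R := IsLocalization.Away.invSelf (MvPolynomial.X p : MvPolynomial σ k)
    have hc : algebraMap (MvPolynomial σ k) R (MvPolynomial.X p) * c = 1 :=
      IsLocalization.Away.mul_invSelf _
    let w : σ → R := fun s => algebraMap (MvPolynomial σ k) R (MvPolynomial.X s)
    have hw : MvPolynomial.aeval w a = algebraMap (MvPolynomial σ k) R a :=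
      DFunLike.congr_fun (MvPolynomial.aeval_unique (IsScalarTower.toAlgHom k _ R)).symm a
    have h1 : (MvPolynomial.aeval fun s : {s : σ // s ≠ p} => (c • w) s).comp (dehomogenize k p) =
        MvPolynomial.aeval (c • w) := by
      ext s
      by_cases h : s = p
      · subst h
        simpa [dehomogenize, w, mul_comm c] using hc.symm
      · simp [dehomogenize, h]
    have h2 := DFunLike.congr_fun h1 a
    rw [AlgHom.comp_apply, hx, map_zero, aeval_smul_of_isHomogeneous _ _ (n := n) (by simpa using ha),
      hw] at h2
    apply HomogeneousLocalization.val_injective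
    rw [Away.val_mk, HomogeneousLocalization.val_zero, Localization.mk_eq_mk',
      IsLocalization.mk'_eq_zero_iff]
    have hcu : IsUnit (c ^ n) := (IsUnit.of_mul_eq_one_right _ hc).pow n
    have h3 : algebraMap (MvPolynomial σ k) R a = 0 := hcu.mul_right_eq_zero.1 h2.symm
    exact (IsLocalization.map_eq_zero_iff (.powers (MvPolynomial.X p : MvPolynomial σ k)) R a).1 h3
  · intro f
    induction f using MvPolynomial.induction_on with
    | C c =>
      refine ⟨Away.mk _ (X_mem_homogeneousSubmodule p) 0 (MvPolynomial.C c)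
        (by simp), ?_⟩
      rw [awayDehomogenize_mk]
      simp [dehomogenize]
    | add f g hf hg =>
      obtain ⟨x, rfl⟩ := hf
      obtain ⟨y, rfl⟩ := hg
      exact ⟨x + y, map_add _ _ _⟩
    | mul_X f s hf =>
      obtain ⟨x, rfl⟩ := hf
      refine ⟨x * Away.mk _ (X_mem_homogeneousSubmodule p) 1 (MvPolynomial.X s.1)
        (by simpa using MvPolynomial.isHomogeneous_X _ _), ?_⟩
      rw [map_mul, awayDehomogenize_mk]
      simp [dehomogenize, s.2]

variable (k) in
/-- The standard affine chart of projective space where the coordinate `p` does not vanish. -/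
def projChart (p : σ) : specOver k (MvPolynomial {s : σ // s ≠ p} k) ⟶ projSpace k σ :=
  Over.homMk (Spec.map (CommRingCat.ofHom (awayDehomogenize k p)) ≫
    Proj.awayι (MvPolynomial.homogeneousSubmodule σ k) (MvPolynomial.X p)
      (X_mem_homogeneousSubmodule p) one_pos) (by
    change (Spec.map (CommRingCat.ofHom (awayDehomogenize k p)) ≫
      Proj.awayι (MvPolynomial.homogeneousSubmodule σ k) (MvPolynomial.X p)
      (X_mem_homogeneousSubmodule p) one_pos) ≫ Proj.toSpecZero _ ≫ Spec.map _ = Spec.map _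
    rw [Category.assoc, Proj.awayι_toSpecZero_assoc, ← Spec.map_comp, ← Spec.map_comp]
    congr 1
    refine CommRingCat.hom_ext (RingHom.ext fun c => ?_)
    have h := awayDehomogenize_mk p 0 (MvPolynomial.C c)
      (by simp)
    refine Eq.trans (congrArg (awayDehomogenize k p) ?_) (h.trans ?_)
    · apply HomogeneousLocalization.val_injective
      change Localization.mk _ _ = Localization.mk _ _
      congr 1
    · exact (dehomogenize k p).commutes c)

instance (p : σ) : IsIso (Spec.map (CommRingCat.ofHom (awayDehomogenize k p))) := by
  have : IsIso (CommRingCat.ofHom (awayDehomogenize k p)) :=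
    (RingEquiv.ofBijective _ (awayDehomogenize_bijective p)).toCommRingCatIso.isIso_hom
  infer_instance

instance (p : σ) : IsOpenImmersion (projChart k p).left := by
  exact inferInstanceAs (IsOpenImmersion (Spec.map (CommRingCat.ofHom (awayDehomogenize k p)) ≫
    Proj.awayι (MvPolynomial.homogeneousSubmodule σ k) (MvPolynomial.X p)
      (X_mem_homogeneousSubmodule p) one_pos))

theorem mem_range_projChart (p : σ) {x : (projSpace k σ).left} :
    x ∈ Set.range (projChart k p).left ↔ ¬ VanishesAt (MvPolynomial.X p) x := by
  have h1 : Set.range (projChart k p).left = Set.range (Proj.awayι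
      (MvPolynomial.homogeneousSubmodule σ k) (MvPolynomial.X p)
      (X_mem_homogeneousSubmodule p) one_pos) := by
    refine (range_comp (Spec.map (CommRingCat.ofHom (awayDehomogenize k p))) (Proj.awayι
      (MvPolynomial.homogeneousSubmodule σ k) (MvPolynomial.X p)
      (X_mem_homogeneousSubmodule p) one_pos)).trans ?_
    rw [(Scheme.Hom.surjective
      (Spec.map (CommRingCat.ofHom (awayDehomogenize k p)))).range_eq, Set.image_univ]
  rw [h1, ← Scheme.Hom.coe_opensRange, Proj.opensRange_awayι]
  exact Proj.mem_basicOpen _ _ _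

/-- Points are compared through forms: the chart pulls the basic open set of `f` back to that of the
dehomogenized `f`, whose value under `χ` is `f(w)` since `w p = 1`. -/
theorem projChart_specPoint (p : σ) {K : Type u} [Field K] [Algebra k K]
    (χ : MvPolynomial {s : σ // s ≠ p} k →ₐ[k] K) {w : σ → K} (hw : w ≠ 0) (hp : w p = 1)
    (hχ : ∀ s : {s : σ // s ≠ p}, χ (MvPolynomial.X s) = w s) :
    (projChart k p).left (specPoint χ) = projPoint _ hw := by
  refine projSpace_ext fun n hn f hf => ?_
  rw [vanishesAt_projPoint _ hf, ← not_iff_not]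
  have h1 : χ.comp (dehomogenize k p) =
      MvPolynomial.aeval w := by
    ext s
    by_cases h : s = p
    · simp [dehomogenize, h, hp]
    · simp [dehomogenize, h, hχ]
  have h2 : awayDehomogenize k p (Away.isLocalizationElem (X_mem_homogeneousSubmodule p)
      (𝒜 := MvPolynomial.homogeneousSubmodule σ k) hf) = dehomogenize k p (f ^ 1) :=
    awayDehomogenize_mk _ _ _ _
  have h3 := Proj.awayι_preimage_basicOpen (MvPolynomial.homogeneousSubmodule σ k)
    (X_mem_homogeneousSubmodule p) one_pos hf hn
  have h4 := congrArg (fun U => Spec.map (CommRingCat.ofHom (awayDehomogenize k p)) (specPoint χ) ∈ U)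
    h3
  rw [← h1, AlgHom.comp_apply]
  refine h4.to_iff.trans ?_
  refine (PrimeSpectrum.mem_basicOpen _ _).trans ?_
  change ¬ (χ (awayDehomogenize k p _) = 0) ↔ _
  rw [h2, pow_one]

end ProjSpace

/-! ### Linear projections of projective spaces -/

section LinearProjection

variable {k : Type u} [Field k] {σ τ : Type}

instance : IsScalarTower k (MvPolynomial.homogeneousSubmodule σ k 0) (MvPolynomial σ k) :=
  ⟨fun a b c => by
    change ((a • b : MvPolynomial.homogeneousSubmodule σ k 0) : MvPolynomial σ k) • c =
      a • (b : MvPolynomial σ k) • c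
    rw [SetLike.val_smul, smul_assoc]⟩

instance [Finite σ] :
    Algebra.FiniteType (MvPolynomial.homogeneousSubmodule σ k 0) (MvPolynomial σ k) :=
  Algebra.FiniteType.of_restrictScalars_finiteType k _ _

instance : LocallyOfFiniteType (Spec.map (CommRingCat.ofHom
    (algebraMap k (MvPolynomial.homogeneousSubmodule σ k 0)))) := by
  refine (HasRingHomProperty.Spec_iff (P := @LocallyOfFiniteType)).2 ?_
  refine RingHom.FiniteType.of_surjective _ ?_
  rintro ⟨f, hf⟩
  rw [MvPolynomial.homogeneousSubmodule_zero, Submodule.mem_one] at hf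
  obtain ⟨c, rfl⟩ := hf
  exact ⟨c, rfl⟩

variable (k σ) in
/-- Projective space as a variety. -/
def projVariety [Finite σ] : Variety k where
  X := projSpace k σ
  finiteType := inferInstanceAs (LocallyOfFiniteType (Proj.toSpecZero (MvPolynomial.homogeneousSubmodule σ k) ≫
    Spec.map (CommRingCat.ofHom (algebraMap k (MvPolynomial.homogeneousSubmodule σ k 0)))))
  quasiCompact := inferInstanceAs (QuasiCompact (Proj.toSpecZero (MvPolynomial.homogeneousSubmodule σ k) ≫
    Spec.map (CommRingCat.ofHom (algebraMap k (MvPolynomial.homogeneousSubmodule σ k 0)))))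
  separated := inferInstanceAs (IsSeparated (Proj.toSpecZero (MvPolynomial.homogeneousSubmodule σ k) ≫
    Spec.map (CommRingCat.ofHom (algebraMap k (MvPolynomial.homogeneousSubmodule σ k 0)))))

instance [Finite σ] : TopologicalSpace.NoetherianSpace (projSpace k σ).left :=
  inferInstanceAs (TopologicalSpace.NoetherianSpace (projVariety k σ).X.left)

theorem exists_hasClass_projSpace [Finite σ] {Y : Set (projSpace k σ).left}
    (hY : Topology.IsConstructible Y) : ∃ x, HasClass (projSpace k σ) Y x :=
  exists_hasClass_of_isConstructible (projVariety k σ) (Y := Y) hY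

theorem isConstructible_of_isOpen {X : Type*} [TopologicalSpace X]
    [TopologicalSpace.NoetherianSpace X] {U : Set X} (hU : IsOpen U) :
    Topology.IsConstructible U :=
  IsRetrocompact.isConstructible hU fun _ _ _ => TopologicalSpace.NoetherianSpace.isCompact _

/-- The preimage of a set under the linear projection between projective spaces that is given by the
inclusion `e` of the coordinates. -/
def projLift (e : σ → τ) (Y : Set (projSpace k σ).left) : Set (projSpace k τ).left :=
  {x | ∃ (K : Type u) (_ : Field K) (_ : Algebra k K) (w : τ → K) (hw : w ≠ 0) (h : w ∘ e ≠ 0),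
    x = projPoint w hw ∧ projPoint (w ∘ e) h ∈ Y}

/-- The two coordinate vectors may live over different fields; they share the forms over `k` that
vanish at them, and forms in fewer variables are among these. -/
theorem projPoint_comp_eq (e : σ → τ) {K L : Type u} [Field K] [Algebra k K] [Field L] [Algebra k L]
    {v : τ → K} {w : τ → L} (hv : v ≠ 0) (hw : w ≠ 0) (hv' : v ∘ e ≠ 0) (hw' : w ∘ e ≠ 0)
    (h : projPoint (k := k) v hv = projPoint w hw) :
    projPoint (k := k) (v ∘ e) hv' = projPoint (w ∘ e) hw' := by
  refine projSpace_ext fun n _ f hf => ?_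
  have hf' := MvPolynomial.IsHomogeneous.rename_isHomogeneous (f := e) hf
  rw [vanishesAt_projPoint _ hf, vanishesAt_projPoint _ hf, ← MvPolynomial.aeval_rename,
    ← MvPolynomial.aeval_rename, ← vanishesAt_projPoint hv hf', ← vanishesAt_projPoint hw hf', h]

theorem projLift_union (e : σ → τ) (Y Y' : Set (projSpace k σ).left) :
    projLift e (Y ∪ Y') = projLift e Y ∪ projLift e Y' := by
  ext x
  constructor
  · rintro ⟨K, _, _, w, hw, h, rfl, hY | hY⟩
    · exact .inl ⟨K, _, _, w, hw, h, rfl, hY⟩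
    · exact .inr ⟨K, _, _, w, hw, h, rfl, hY⟩
  · rintro (⟨K, _, _, w, hw, h, rfl, hY⟩ | ⟨K, _, _, w, hw, h, rfl, hY⟩)
    · exact ⟨K, _, _, w, hw, h, rfl, .inl hY⟩
    · exact ⟨K, _, _, w, hw, h, rfl, .inr hY⟩

theorem disjoint_projLift (e : σ → τ) {Y Y' : Set (projSpace k σ).left} (h : Disjoint Y Y') :
    Disjoint (projLift e Y) (projLift e Y') := by
  rw [Set.disjoint_left] at h ⊢
  rintro _ ⟨K, _, _, w, hw, h1, rfl, hY⟩ ⟨L, _, _, v, hv, h2, e1, hY'⟩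
  exact h hY (projPoint_comp_eq e hw hv h1 h2 e1 ▸ hY')

open Classical in
/-- The coordinates in an affine chart of the source of a linear projection. -/
def chartEquiv (e : σ → τ) (he : Function.Injective e) (p : σ) :
    {t : τ // t ∉ Set.range e} ⊕ {s : σ // s ≠ p} ≃ {t : τ // t ≠ e p} :=
  Equiv.ofBijective
    (Sum.elim (fun t => ⟨t.1, fun h => t.2 ⟨p, h.symm⟩⟩) fun s => ⟨e s.1, he.ne s.2⟩) (by
      constructor
      · rintro (⟨t, ht⟩ | s) (⟨t', ht'⟩ | s') h
        · simpa using h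
        · exact (ht ⟨s'.1, by simpa using h.symm⟩).elim
        · exact (ht' ⟨s.1, by simpa using h⟩).elim
        · simpa [he.eq_iff, Subtype.ext_iff] using h
      · rintro ⟨t, ht⟩
        by_cases h : t ∈ Set.range e
        · obtain ⟨s, rfl⟩ := h
          exact ⟨.inr ⟨s, fun h => ht (congrArg e h)⟩, rfl⟩
        · exact ⟨.inl ⟨t, h⟩, rfl⟩)

variable (k) in
/-- The coordinate ring of an affine chart of the source of a linear projection as a polynomial ring
over the coordinate ring of a chart of the target. -/
def chartAlgEquiv (e : σ → τ) (he : Function.Injective e) (p : σ) :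
    MvPolynomial {t : τ // t ≠ e p} k ≃ₐ[k]
      MvPolynomial {t : τ // t ∉ Set.range e} (MvPolynomial {s : σ // s ≠ p} k) :=
  (MvPolynomial.renameEquiv k (chartEquiv e he p).symm).trans (MvPolynomial.sumAlgEquiv k _ _)

theorem chartAlgEquiv_X (e : σ → τ) (he : Function.Injective e) (p : σ) (s : {s : σ // s ≠ p}) :
    chartAlgEquiv k e he p (MvPolynomial.X ⟨e s.1, he.ne s.2⟩) =
      MvPolynomial.C (MvPolynomial.X s) := by
  have : (chartEquiv e he p).symm ⟨e s.1, he.ne s.2⟩ = .inr s := by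
    rw [Equiv.symm_apply_eq]; rfl
  simp [chartAlgEquiv, this]

theorem exists_not_vanishesAt_X (x : (projSpace k σ).left) :
    ∃ p : σ, ¬ VanishesAt (MvPolynomial.X p) x := by
  obtain ⟨K, _, _, w, hw, rfl⟩ := exists_eq_projPoint x
  obtain ⟨p, hp⟩ := Function.ne_iff.1 hw
  exact ⟨p, by rwa [vanishesAt_projPoint _ (MvPolynomial.isHomogeneous_X k p),
    MvPolynomial.aeval_X]⟩

/-- Where the coordinate `p` is nonzero it can be scaled to `1`; the linear projection then forgets
coordinates of an affine space, so the preimage is a cylinder. -/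
theorem projLift_eq_image (e : σ → τ) (he : Function.Injective e) (p : σ)
    {Y : Set (projSpace k σ).left} (hY : Y ⊆ Set.range (projChart k p).left) :
    projLift e Y = (specMap (chartAlgEquiv k e he p).toAlgHom ≫ projChart k (e p)).left ''
      ((affineProj k (MvPolynomial {s : σ // s ≠ p} k) {t : τ // t ∉ Set.range e}).left ⁻¹'
        ((projChart k p).left ⁻¹' Y)) := by
  classical
  have key1 {K : Type u} [Field K] [Algebra k K] (χ : MvPolynomial {t : τ // t ∉ Set.range e}
      (MvPolynomial {s : σ // s ≠ p} k) →ₐ[k] K) {w : τ → K} (hw : w ≠ 0) (hp : w (e p) = 1)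
      (hχ : ∀ t : {t : τ // t ≠ e p},
        χ (chartAlgEquiv k e he p (MvPolynomial.X t)) = w t) :
      (specMap (chartAlgEquiv k e he p).toAlgHom ≫ projChart k (e p)).left (specPoint χ) =
        projPoint w hw :=
    projChart_specPoint (e p) (χ.comp (chartAlgEquiv k e he p).toAlgHom) hw hp hχ
  have key2 {K : Type u} [Field K] [Algebra k K] (χ : MvPolynomial {t : τ // t ∉ Set.range e}
      (MvPolynomial {s : σ // s ≠ p} k) →ₐ[k] K) {w : τ → K} (hp : w (e p) = 1)
      (hw' : w ∘ e ≠ 0)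
      (hχ : ∀ t : {t : τ // t ≠ e p},
        χ (chartAlgEquiv k e he p (MvPolynomial.X t)) = w t) :
      (projChart k p).left ((affineProj k (MvPolynomial {s : σ // s ≠ p} k)
        {t : τ // t ∉ Set.range e}).left (specPoint χ)) = projPoint (w ∘ e) hw' := by
    refine projChart_specPoint p (χ.comp (IsScalarTower.toAlgHom k _ _)) hw' hp fun s => ?_
    rw [Function.comp_apply, ← hχ ⟨e s.1, he.ne s.2⟩, chartAlgEquiv_X]
    rfl
  ext x
  constructor
  · rintro ⟨K, _, _, w, hw, h, rfl, hwY⟩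
    have hp := (mem_range_projChart p).1 (hY hwY)
    rw [vanishesAt_projPoint _ (MvPolynomial.isHomogeneous_X k p), MvPolynomial.aeval_X] at hp
    let v : τ → K := (w (e p))⁻¹ • w
    have hvp : v (e p) = 1 := inv_mul_cancel₀ hp
    have hv : v ≠ 0 := fun h => by simp [h] at hvp
    have hv' : v ∘ e ≠ 0 := fun h => by simpa [hvp] using congrFun h p
    have e1 : projPoint (k := k) v hv = projPoint w hw := projPoint_smul hw (inv_ne_zero hp) hv
    rw [← projPoint_comp_eq e hv hw hv' h e1] at hwY
    rw [← e1]
    let χ : MvPolynomial {t : τ // t ∉ Set.range e} (MvPolynomial {s : σ // s ≠ p} k) →ₐ[k] K :=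
      (MvPolynomial.aeval fun t : {t : τ // t ≠ e p} => v t).comp
        (chartAlgEquiv k e he p).symm.toAlgHom
    have hχ (t : {t : τ // t ≠ e p}) : χ (chartAlgEquiv k e he p (MvPolynomial.X t)) = v t :=
      (congrArg (MvPolynomial.aeval fun t : {t : τ // t ≠ e p} => v t)
        ((chartAlgEquiv k e he p).symm_apply_apply _)).trans (MvPolynomial.aeval_X _ _)
    refine ⟨specPoint χ, ?_, key1 χ hv hvp hχ⟩
    rw [Set.mem_preimage, Set.mem_preimage, key2 χ hvp hv' hχ]
    exact hwY
  · rintro ⟨y, hy, rfl⟩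
    obtain ⟨K, _, _, χ, rfl⟩ := exists_eq_specPoint y
    let w : τ → K := fun t => if h : t = e p then 1 else
      χ (chartAlgEquiv k e he p (MvPolynomial.X ⟨t, h⟩))
    have hwp : w (e p) = 1 := by simp [w]
    have hw : w ≠ 0 := fun h => by simp [h] at hwp
    have hw' : w ∘ e ≠ 0 := fun h => by simpa [hwp] using congrFun h p
    have hχ (t : {t : τ // t ≠ e p}) : χ (chartAlgEquiv k e he p (MvPolynomial.X t)) = w t := by
      simp [w, t.2]
    rw [Set.mem_preimage, Set.mem_preimage, key2 χ hwp hw' hχ] at hy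
    exact ⟨K, _, _, w, hw, hw', key1 χ hw hwp hχ, hy⟩

/-- On one chart this is `HasClass.cylinder`. Induction over the charts peels off the part of `Y` in
one of them; constructibility ensures that both parts have classes. -/
theorem HasClass.projLift [Finite σ] [Finite τ] (e : σ → τ) (he : Function.Injective e)
    {Y : Set (projSpace k σ).left} (hYc : Topology.IsConstructible Y) {x : K0 k}
    (hx : HasClass (projSpace k σ) Y x) :
    HasClass (projSpace k τ) (projLift e Y) (x * K0.line k ^ Nat.card {t : τ // t ∉ Set.range e}) := by
  classical
  have := Fintype.ofFinite σ
  suffices H : ∀ (T : Finset σ) (Y : Set (projSpace k σ).left), Topology.IsConstructible Y →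
      (Y ⊆ ⋃ p ∈ T, Set.range (projChart k p).left) → ∀ x, HasClass (projSpace k σ) Y x →
      HasClass (projSpace k τ) (CurveZeta.projLift e Y)
        (x * K0.line k ^ Nat.card {t : τ // t ∉ Set.range e}) by
    refine H Finset.univ Y hYc (fun y _ => ?_) x hx
    obtain ⟨p, hp⟩ := exists_not_vanishesAt_X y
    exact Set.mem_iUnion₂.2 ⟨p, Finset.mem_univ _, (mem_range_projChart p).2 hp⟩
  intro T
  induction T using Finset.induction_on with
  | empty =>
    intro Y _ hY x hx
    obtain rfl : Y = ∅ := Set.subset_empty_iff.1 (by simpa using hY)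
    rw [hx.unique (HasClass.empty _), zero_mul]
    convert HasClass.empty _
    exact Set.eq_empty_of_forall_notMem fun x ⟨_, _, _, _, _, _, _, h⟩ => h
  | insert p T _ ih =>
    intro Y hYc hY x hx
    have hU : Topology.IsConstructible (Set.range (projChart k p).left) :=
      isConstructible_of_isOpen (projChart k p).left.isOpenEmbedding.isOpen_range
    obtain ⟨x₁, hx₁⟩ := exists_hasClass_projSpace (hYc.inter hU)
    obtain ⟨x₂, hx₂⟩ := exists_hasClass_projSpace (hYc.sdiff hU)
    have hd : Disjoint (Y ∩ Set.range (projChart k p).left) (Y \ Set.range (projChart k p).left) :=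
      Set.disjoint_sdiff_inter.symm
    have hu := Set.inter_union_sdiff Y (Set.range (projChart k p).left)
    have h12 := hx₁.union hx₂ hd
    rw [hx.unique (by simpa only [hu] using h12), ← hu, projLift_union, add_mul]
    refine HasClass.union ?_ (ih _ (hYc.sdiff hU) ?_ _ hx₂) (disjoint_projLift e hd)
    · rw [projLift_eq_image e he p Set.inter_subset_right]
      have h1 : IsImmersion (specMap (chartAlgEquiv k e he p).toAlgHom ≫
          projChart k (e p)).left := by
        have : IsIso (specMap (chartAlgEquiv k e he p).toAlgHom).left :=
          inferInstanceAs (IsIso ((Over.forget _).map (specIso (chartAlgEquiv k e he p)).hom))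
        rw [Over.comp_left]
        exact IsImmersion.comp _ _
      exact hx₁.cylinder _ _ Set.inter_subset_right
    · rintro y ⟨hy, hy'⟩
      have := hY hy
      rw [Finset.set_biUnion_insert] at this
      exact this.resolve_left hy'

end LinearProjection

/-! ### Jets and the generalized Euler characteristic -/

section Jets

variable {k : Type u} [Field k] {d : ℕ}

instance (n : Fin d →₀ ℕ) : Finite (JetIndex n) :=
  Finite.of_injective (β := (i : Fin d) × Fin (n i + 1))
    (fun p => ⟨p.1.1, p.1.2, Nat.lt_succ_of_le p.2⟩) (by
      rintro ⟨⟨i, j⟩, h⟩ ⟨⟨i', j'⟩, h'⟩ e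
      simp only [Sigma.mk.injEq] at e
      obtain ⟨rfl, e⟩ := e
      simpa using e)

theorem card_jetIndex (n : Fin d →₀ ℕ) : Nat.card (JetIndex n) = nrmSucc n := by
  let e : JetIndex n ≃ (i : Fin d) × Fin (n i + 1) :=
    { toFun := fun p => ⟨p.1.1, p.1.2, Nat.lt_succ_of_le p.2⟩
      invFun := fun q => ⟨(q.1, q.2), Nat.le_of_lt_succ q.2.2⟩
      left_inv := fun _ => rfl
      right_inv := fun _ => rfl }
  rw [Nat.card_congr e, Nat.card_eq_fintype_card, Fintype.card_sigma]
  simp [nrmSucc]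

/-- The `n`-jet of a tuple of power series. -/
def jet {K : Type*} [Field K] (n : Fin d →₀ ℕ) (z : Fin d → PowerSeries K) : JetIndex n → K :=
  fun p => PowerSeries.coeff p.1.2 (z p.1.1)

theorem jet_smul {K : Type*} [Field K] (n : Fin d →₀ ℕ) (c : K) (z : Fin d → PowerSeries K) :
    jet n (c • z) = c • jet n z := by
  funext p
  simp [jet]

theorem mem_preimage_jetMap {n : Fin d →₀ ℕ} {Y : Set (projSpace k (JetIndex n)).left}
    {z : PPoint k d} :
    z ∈ jetMap n ⁻¹' (some '' Y) ↔ ∃ h : jet n z.pt.rep ≠ 0, projPoint (jet n z.pt.rep) h ∈ Y := by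
  change jetMap n z ∈ some '' Y ↔ _
  unfold jetMap
  split_ifs with h
  · exact ⟨fun ⟨y, hy, e⟩ => ⟨h, (Option.some.inj e) ▸ hy⟩, fun ⟨_, hy⟩ => ⟨_, hy, rfl⟩⟩
  · exact ⟨fun ⟨y, hy, e⟩ => by simp at e, fun ⟨h', _⟩ => (h h').elim⟩

/-- The chosen representative of a point is a nonzero multiple of `v`, which changes neither the
vanishing of the jet nor its projective point. -/
theorem mem_preimage_jetMap_mk {n : Fin d →₀ ℕ} {Y : Set (projSpace k (JetIndex n)).left}
    {K : Type u} [Field K] [Algebra k K] {v : Fin d → PowerSeries K} (hv : v ≠ 0) :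
    (⟨K, Projectivization.mk K v hv⟩ : PPoint k d) ∈ jetMap n ⁻¹' (some '' Y) ↔
      ∃ h : jet n v ≠ 0, projPoint (jet n v) h ∈ Y := by
  rw [mem_preimage_jetMap]
  obtain ⟨a, ha⟩ := Projectivization.exists_smul_eq_mk_rep K v hv
  change (∃ h : jet n (Projectivization.mk K v hv).rep ≠ 0, projPoint _ h ∈ Y) ↔ _
  have ha' : jet n (Projectivization.mk K v hv).rep = (a : K) • jet n v := by
    rw [← jet_smul, ← ha]
    rfl
  simp only [ha']
  constructor
  · rintro ⟨h, hY⟩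
    have h' : jet n v ≠ 0 := fun e => h (by rw [e, smul_zero])
    exact ⟨h', by rwa [projPoint_smul h' a.ne_zero] at hY⟩
  · rintro ⟨h, hY⟩
    have h' : (a : K) • jet n v ≠ 0 := smul_ne_zero a.ne_zero h
    exact ⟨h', by rwa [projPoint_smul h a.ne_zero]⟩

/-- The restriction of jets to smaller order. -/
def jetInclusion {n m : Fin d →₀ ℕ} (h : n ≤ m) (p : JetIndex n) : JetIndex m :=
  ⟨p.1, p.2.trans (h _)⟩

theorem jetInclusion_injective {n m : Fin d →₀ ℕ} (h : n ≤ m) :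
    Function.Injective (jetInclusion h) :=
  fun p q e => by
    simpa [jetInclusion, Subtype.ext_iff] using e

theorem card_compl_range_jetInclusion {n m : Fin d →₀ ℕ} (h : n ≤ m) :
    nrmSucc n + Nat.card {t // t ∉ Set.range (jetInclusion h)} = nrmSucc m := by
  classical
  rw [← card_jetIndex, ← card_jetIndex, ← Nat.card_range_of_injective (jetInclusion_injective h)]
  have := Nat.card_congr (Equiv.sumCompl (· ∈ Set.range (jetInclusion h)))
  rw [← this, Nat.card_sum]

open Classical in
theorem exists_jet_eq {K : Type*} [Field K] (n : Fin d →₀ ℕ) (w : JetIndex n → K) :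
    ∃ z : Fin d → PowerSeries K, jet n z = w := by
  refine ⟨fun i => PowerSeries.mk fun j => if h : j ≤ n i then w ⟨(i, j), h⟩ else 0, ?_⟩
  funext p
  simp [jet, p.2]

/-- The right side mentions only the cylinder over `Y`. Hence two presentations of one cylinder have
the same lift to a common jet order. -/
theorem mem_projLift_jetInclusion {n m : Fin d →₀ ℕ} (h : n ≤ m)
    {Y : Set (projSpace k (JetIndex n)).left} {x : (projSpace k (JetIndex m)).left} :
    x ∈ projLift (jetInclusion h) Y ↔ ∃ (K : Type u) (_ : Field K) (_ : Algebra k K)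
      (v : Fin d → PowerSeries K) (hv : v ≠ 0) (hv' : jet m v ≠ 0), x = projPoint (jet m v) hv' ∧
      (⟨K, Projectivization.mk K v hv⟩ : PPoint k d) ∈ jetMap n ⁻¹' (some '' Y) := by
  constructor
  · rintro ⟨K, _, _, w, hw, h', rfl, hY⟩
    obtain ⟨v, rfl⟩ := exists_jet_eq m w
    have hv : v ≠ 0 := fun hv => hw (by rw [hv]; funext p; simp [jet])
    exact ⟨K, _, _, v, hv, hw, rfl, (mem_preimage_jetMap_mk hv).2 ⟨h', hY⟩⟩
  · rintro ⟨K, _, _, v, hv, hw, rfl, hY⟩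
    obtain ⟨h', hY⟩ := (mem_preimage_jetMap_mk hv).1 hY
    exact ⟨K, _, _, _, hw, h', rfl, hY⟩

theorem Mot.L_mul_Linv : Mot.L k * Mot.Linv k = 1 :=
  IsLocalization.Away.mul_invSelf _

theorem Mot.L_pow_mul_Linv_pow (a b : ℕ) :
    Mot.L k ^ a * Mot.Linv k ^ (b + a) = Mot.Linv k ^ b := by
  rw [pow_add, mul_left_comm, ← mul_pow, Mot.L_mul_Linv, one_pow, mul_one]

/-- Each added jet coordinate contributes a factor `𝕃` to the class, cancelled by the larger power
of `𝕃⁻¹`. -/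
theorem IsCylinderOver.class_eq_projLift {X : Set (PPoint k d)} {n m : Fin d →₀ ℕ}
    {Y : Set (projSpace k (JetIndex n)).left} (hX : IsCylinderOver X n Y) (h : n ≤ m) :
    algebraMap (K0 k) (Mot k) (setClass (projSpace k (JetIndex n)) Y) * Mot.Linv k ^ nrmSucc n =
      algebraMap (K0 k) (Mot k) (setClass (projSpace k (JetIndex m)) (projLift (jetInclusion h) Y)) *
        Mot.Linv k ^ nrmSucc m := by
  obtain ⟨x, hx⟩ := exists_hasClass_projSpace hX.1
  rw [setClass_eq hx, setClass_eq (hx.projLift _ (jetInclusion_injective h) hX.1), map_mul, map_pow,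
    ← card_compl_range_jetInclusion h, mul_assoc]
  congr 1
  exact (Mot.L_pow_mul_Linv_pow _ _).symm

/-- The presentation chosen by `eulerChar` and the given one are compared at the supremum of their
jet orders, where their bases coincide. -/
theorem IsCylinderOver.eulerChar_eq {X : Set (PPoint k d)} {n : Fin d →₀ ℕ}
    {Y : Set (projSpace k (JetIndex n)).left} (hX : IsCylinderOver X n Y) :
    eulerChar X = algebraMap (K0 k) (Mot k) (setClass (projSpace k (JetIndex n)) Y) *
      Mot.Linv k ^ nrmSucc n := by
  have hc : IsCylindric X := ⟨n, Y, hX⟩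
  rw [eulerChar, dif_pos hc]
  have hX' := hc.choose_spec.choose_spec
  rw [hX'.class_eq_projLift (le_sup_left : _ ≤ hc.choose ⊔ n),
    hX.class_eq_projLift (le_sup_right : n ≤ hc.choose ⊔ n)]
  congr 3
  ext x
  rw [mem_projLift_jetInclusion, mem_projLift_jetInclusion, ← hX.2, ← hX'.2]

end Jets

/-! ### Linear algebra -/

section LinearAlgebra

/-- A vector space over `k` is not a union of at most `|k|` proper subspaces. -/
theorem exists_forall_notMem_of_card_le {k : Type u} {V ι : Type*} [Field k] [AddCommGroup V] [Module k V]
    (W : ι → Submodule k V) (hW : ∀ i, W i ≠ ⊤) (s : Finset ι)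
    (hs : (s.card : Cardinal) ≤ Cardinal.mk k) : ∃ v, ∀ i ∈ s, v ∉ W i := by
  classical
  induction s using Finset.induction_on with
  | empty => exact ⟨0, by simp⟩
  | insert a s ha ih =>
    rw [Finset.card_insert_of_notMem ha] at hs
    obtain ⟨v, hv⟩ := ih ((Nat.cast_le.2 (Nat.le_succ _)).trans hs)
    by_cases hva : v ∈ W a
    swap
    · exact ⟨v, by simpa using ⟨hva, hv⟩⟩
    obtain ⟨w, hw⟩ : ∃ w, w ∉ W a := by
      by_contra! h
      exact hW a (Submodule.eq_top_iff'.2 h)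
    -- Pigeonhole: otherwise each `c` gets some `i ∈ s` with `w + c • v ∈ W i`. Two scalars with the
    -- same `i` would put `v` in `W i`, so `|k| ≤ |s|`, while `|s| + 1 ≤ |k|`.
    have hc : ∃ c : k, ∀ i ∈ s, w + c • v ∉ W i := by
      by_contra! h
      choose f hf hf' using h
      have hinj : Function.Injective fun c => (⟨f c, hf c⟩ : s) := by
        intro c c' e
        by_contra hne
        have e' : f c = f c' := congrArg Subtype.val e
        have h1 := (W (f c)).sub_mem (hf' c) (e' ▸ hf' c')
        rw [add_sub_add_left_eq_sub, ← sub_smul] at h1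
        exact hv _ (hf c) (((W (f c)).smul_mem_iff (sub_ne_zero.2 hne)).1 h1)
      have h2 := Cardinal.lift_mk_le_lift_mk_of_injective hinj
      rw [Cardinal.mk_coe_finset, Cardinal.lift_natCast] at h2
      have h3 := (Cardinal.lift_le.2 hs).trans h2
      rw [Cardinal.lift_natCast, Nat.cast_le] at h3
      omega
    obtain ⟨c, hc⟩ := hc
    refine ⟨w + c • v, fun i hi => ?_⟩
    rcases Finset.mem_insert.1 hi with rfl | hi
    · exact fun h => hw (((W i).add_mem_iff_left ((W i).smul_mem c hva)).1 h)
    · exact hc i hi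

/-! ### Gaussian elimination for an ordered family. -/

section Greedy

variable {k W ι : Type*} [Field k] [AddCommGroup W] [Module k W] (f : ι → W) (key : ι → ℕ)

/-- The indices of the members of a family of vectors that are not linear combinations of the
preceding ones. -/
def pivots : Set ι := {s | f s ∉ Submodule.span k (f '' {s' | key s' < key s})}

theorem mem_span_pivots (s : ι) :
    f s ∈ Submodule.span k (f '' {e | e ∈ pivots (k := k) f key ∧ key e ≤ key s}) := by
  induction hn : key s using Nat.strong_induction_on generalizing s with
  | _ n ih =>
    subst hn
    by_cases hs : s ∈ pivots (k := k) f key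
    · exact Submodule.subset_span ⟨s, ⟨hs, le_rfl⟩, rfl⟩
    · have hs' : f s ∈ Submodule.span k (f '' {s' | key s' < key s}) := not_not.1 hs
      refine Submodule.span_le.2 ?_ hs'
      rintro _ ⟨s', hs', rfl⟩
      refine Submodule.span_mono (Set.image_mono ?_) (ih _ hs' s' rfl)
      exact fun e he => ⟨he.1, he.2.trans hs'.le⟩

/-- In a nontrivial relation the member with the largest key would be a combination of preceding
ones. -/
theorem linearIndependent_pivots (hkey : Function.Injective key) :
    LinearIndependent k fun e : pivots (k := k) f key => f e := by
  classical
  rw [linearIndependent_iff']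
  intro s c hc
  by_contra! hne
  obtain ⟨e, he, hmax⟩ := (s.filter fun e => c e ≠ 0).exists_max_image (fun e => key e)
    (by obtain ⟨e, he⟩ := hne; exact ⟨e, by simpa using he⟩)
  rw [Finset.mem_filter] at he
  apply e.2
  rw [← Finset.add_sum_erase _ _ he.1] at hc
  rw [← (Submodule.span k _).smul_mem_iff he.2, eq_neg_of_add_eq_zero_left hc]
  refine Submodule.neg_mem _ (Submodule.sum_mem _ fun e' he' => ?_)
  rw [Finset.mem_erase] at he'
  by_cases h0 : c e' = 0
  · rw [h0, zero_smul]
    exact zero_mem _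
  · refine Submodule.smul_mem _ _ (Submodule.subset_span ⟨e', ?_, rfl⟩)
    refine lt_of_le_of_ne (hmax e' (by simpa using ⟨he'.2, h0⟩)) fun h => he'.1 ?_
    exact Subtype.ext (hkey h)

end Greedy

/-- If the joint evaluation were not onto, a nonzero functional vanishing on its range would be a
linear relation among the `f i`. -/
theorem exists_eval_eq_of_linearIndependent {k V ι : Type*} [Field k] [AddCommGroup V] [Module k V]
    [Finite ι] {f : ι → Module.Dual k V} (hf : LinearIndependent k f) (c : ι → k) :
    ∃ v, ∀ i, f i v = c i := by
  classical
  have := Fintype.ofFinite ι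
  suffices h : LinearMap.range (LinearMap.pi f) = ⊤ by
    obtain ⟨v, hv⟩ := LinearMap.range_eq_top.1 h c
    exact ⟨v, fun i => congrFun hv i⟩
  by_contra hne
  obtain ⟨φ, φ0, hφ⟩ := Submodule.exists_le_ker_of_lt_top _ (lt_top_iff_ne_top.2 hne)
  apply φ0
  have h1 : ∑ i, φ (Pi.single i 1) • f i = 0 := by
    ext v
    have := hφ ⟨v, rfl⟩
    rw [LinearMap.mem_ker, LinearMap.pi_apply_eq_sum_univ] at this
    have hs : ∀ i : ι, (fun j => if i = j then (1 : k) else 0) = Pi.single i 1 := fun i => by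
      ext j
      simp [Pi.single_apply, eq_comm]
    simpa [mul_comm, hs] using this
  have h2 := Fintype.linearIndependent_iff.1 hf _ h1
  ext i
  simpa using h2 i

end LinearAlgebra

/-! ### The conductor -/

section Conductor

variable {k : Type u} [Field k] {d : ℕ} (O : Subalgebra k (Fin d → PowerSeries k))

/-- The polynomials form an infinite-dimensional space, so one of them is killed by finitely many
conditions with values in the finite-dimensional quotient: that `p` placed in branch `i`, and its
products with generators of the normalization modulo `O`, lie in `O`. -/
theorem exists_polynomial_single_mul_mem
    [Module.Finite k ((Fin d → PowerSeries k) ⧸ Subalgebra.toSubmodule O)] (i : Fin d) :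
    ∃ p : Polynomial k, p ≠ 0 ∧ ∀ y, (Pi.single i (p : PowerSeries k) : Fin d → PowerSeries k) * y ∈ O := by
  obtain ⟨n, q, hq⟩ := Module.Finite.exists_fin (R := k)
    (M := (Fin d → PowerSeries k) ⧸ Subalgebra.toSubmodule O)
  choose y hy using fun j => Submodule.Quotient.mk_surjective _ (q j)
  let Q := Subalgebra.toSubmodule O
  let s : Polynomial k →ₗ[k] (Fin d → PowerSeries k) :=
    LinearMap.single k (fun _ => PowerSeries k) i ∘ₗ
      (Polynomial.coeToPowerSeries.algHom (R := k) k).toLinearMap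
  have hs : ∀ p : Polynomial k, s p = Pi.single i (p : PowerSeries k) := fun p => by
    simp [s, Polynomial.coeToPowerSeries.algHom_apply]
  let Φ : Polynomial k →ₗ[k] ((Fin d → PowerSeries k) ⧸ Q) × (Fin n → (Fin d → PowerSeries k) ⧸ Q) :=
    (Q.mkQ ∘ₗ s).prod (LinearMap.pi fun j => Q.mkQ ∘ₗ LinearMap.mulRight k (y j) ∘ₗ s)
  have hΦ : ¬ Function.Injective Φ := fun h =>
    Polynomial.not_finite (R := k) (Module.Finite.of_injective Φ h)
  rw [← LinearMap.ker_eq_bot, Submodule.eq_bot_iff] at hΦ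
  push Not at hΦ
  obtain ⟨p, hp, p0⟩ := hΦ
  refine ⟨p, p0, fun z => ?_⟩
  rw [← hs]
  have h1 : s p ∈ Q := by
    rw [← Submodule.Quotient.mk_eq_zero]
    exact congrArg Prod.fst hp
  have h2 : ∀ j, s p * y j ∈ Q := fun j => by
    rw [← Submodule.Quotient.mk_eq_zero]
    exact congrFun (congrArg Prod.snd hp) j
  -- `N` contains `O` because `s p ∈ O`, and it contains the generators `y j` of the quotient.
  let N : Submodule k (Fin d → PowerSeries k) := Q.comap (LinearMap.mulLeft k (s p))
  have hQN : Q ≤ N := fun x hx => O.mul_mem h1 hx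
  have hN : N = ⊤ := by
    rw [← sup_eq_right.2 hQN, ← Submodule.comap_map_mkQ, eq_top_iff, ← Submodule.map_le_iff_le_comap]
    refine le_trans le_top ?_
    rw [← hq, Submodule.span_le]
    rintro _ ⟨j, rfl⟩
    exact ⟨y j, h2 j, hy j⟩
  exact (hN ▸ Submodule.mem_top : z ∈ N)

/-- A nonzero `p i` divides the power of `t` given by its order, so tuples of high order are
combinations of multiples of the `p i`. -/
theorem exists_forall_mem_of_coeff_eq_zero
    [Module.Finite k ((Fin d → PowerSeries k) ⧸ Subalgebra.toSubmodule O)] :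
    ∃ M : ℕ, 0 < M ∧ ∀ z : Fin d → PowerSeries k,
      (∀ i, ∀ j < M, PowerSeries.coeff j (z i) = 0) → z ∈ O := by
  choose p p0 hp using exists_polynomial_single_mul_mem O
  -- The sum bounds all the orders at once; adding `1` keeps `M` positive.
  refine ⟨∑ i, (p i : PowerSeries k).order.toNat + 1, Nat.succ_pos _, fun z hz => ?_⟩
  have hd : ∀ i, (p i : PowerSeries k) ∣ z i := fun i => by
    have h0 : (p i : PowerSeries k) ≠ 0 := by simpa using p0 i
    have h1 : (p i : PowerSeries k) ∣ PowerSeries.X ^ (p i : PowerSeries k).order.toNat :=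
      ⟨PowerSeries.Inv_divided_by_X_pow_order h0, by
        conv_rhs => enter [1]; rw [← PowerSeries.X_pow_order_mul_divXPowOrder (f := (p i : PowerSeries k))]
        rw [mul_assoc, PowerSeries.Inv_divided_by_X_pow_order_rightInv, mul_one]⟩
    refine h1.trans ?_
    refine PowerSeries.X_pow_dvd_iff.2 fun j hj => hz i j (hj.trans (Nat.lt_succ_of_le ?_))
    exact Finset.single_le_sum (f := fun i => (p i : PowerSeries k).order.toNat)
      (fun _ _ => Nat.zero_le _) (Finset.mem_univ i)
  choose y hy using hd
  have hz' : z = ∑ i, (Pi.single i (p i : PowerSeries k) : Fin d → PowerSeries k) * y := by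
    rw [← Finset.sum_mul, Finset.univ_sum_single]
    funext i
    exact hy i
  rw [hz']
  exact O.sum_mem fun i _ => hp i y

/-- Subtracting from `z` its constant coefficient in any one branch gives a nonunit. For two
branches with different constants these nonunits would differ by a nonzero scalar, impossible in a
local ring. -/
theorem constantCoeff_eq_of_mem [IsLocalRing O] {z : Fin d → PowerSeries k} (hz : z ∈ O)
    (i j : Fin d) : PowerSeries.constantCoeff (z i) = PowerSeries.constantCoeff (z j) := by
  by_contra hne
  have h : ∀ i, (⟨z, hz⟩ - algebraMap k O (PowerSeries.constantCoeff (z i)) : O) ∈ nonunits O := by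
    intro i hu
    have h1 := PowerSeries.isUnit_iff_constantCoeff.1 (Pi.isUnit_iff.1 (hu.map O.val) i)
    simp at h1
  have h2 : IsUnit (algebraMap k O (PowerSeries.constantCoeff (z j) -
      PowerSeries.constantCoeff (z i))) := by
    refine (IsUnit.mk0 _ (sub_ne_zero.2 (Ne.symm hne))).map _
  have h3 : algebraMap k O (PowerSeries.constantCoeff (z j) - PowerSeries.constantCoeff (z i)) =
      (⟨z, hz⟩ - algebraMap k O (PowerSeries.constantCoeff (z i))) +
        -(⟨z, hz⟩ - algebraMap k O (PowerSeries.constantCoeff (z j))) := by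
    rw [map_sub]
    abel
  rw [h3] at h2
  rcases IsLocalRing.isUnit_or_isUnit_of_isUnit_add h2 with h4 | h4
  · exact h i h4
  · exact h j ((IsUnit.neg_iff _).1 h4)

end Conductor

/-! ### Equations for the local ring -/

/-- The coefficient of `t_i ^ j` in a tuple of power series, for `s = (i, j)`. -/
def tupleCoeff {R : Type*} [CommSemiring R] {d : ℕ} (s : Fin d × ℕ) :
    (Fin d → PowerSeries R) →ₗ[R] R :=
  PowerSeries.coeff s.2 ∘ₗ LinearMap.proj s.1

theorem tupleCoeff_apply {R : Type*} [CommSemiring R] {d : ℕ} (s : Fin d × ℕ)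
    (z : Fin d → PowerSeries R) : tupleCoeff s z = PowerSeries.coeff s.2 (z s.1) := rfl

theorem tuple_ext {R : Type*} [CommSemiring R] {d : ℕ} {y z : Fin d → PowerSeries R}
    (h : ∀ s, tupleCoeff s y = tupleCoeff s z) : y = z :=
  funext fun i => PowerSeries.ext fun j => h (i, j)

/-- The tuple of power series with given coefficients. -/
def tupleMk {R : Type*} [CommSemiring R] {d : ℕ} (f : Fin d × ℕ → R) : Fin d → PowerSeries R :=
  fun i => PowerSeries.mk fun j => f (i, j)

@[simp]
theorem tupleCoeff_tupleMk {R : Type*} [CommSemiring R] {d : ℕ} (f : Fin d × ℕ → R)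
    (s : Fin d × ℕ) : tupleCoeff s (tupleMk f) = f s := by
  simp [tupleCoeff_apply, tupleMk]

/-- The order of the coefficients: first by exponent, then by branch. -/
def coeffKey {d : ℕ} (s : Fin d × ℕ) : ℕ := s.2 * d + s.1

theorem coeffKey_injective (d : ℕ) : Function.Injective (coeffKey (d := d)) := by
  rintro ⟨i, j⟩ ⟨i', j'⟩ h
  have hd : 0 < d := i.pos
  have h1 : (i : ℕ) = i' := by
    simpa [coeffKey, Nat.mul_add_mod', Nat.mod_eq_of_lt] using congrArg (· % d) h
  have h2 : j * d = j' * d := by simp only [coeffKey] at h; omega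
  exact Prod.ext (Fin.ext h1) (Nat.eq_of_mul_eq_mul_right hd h2)

/-- Equations for `O`: an order `M` from which on the coefficients of the elements of `O` are
arbitrary, a set `E` of coefficients that are free parameters for the elements of `O` modulo
`t ^ M`, and the elements of `O` that form the basis dual to these coefficients. -/
structure Frame {k : Type u} [Field k] {d : ℕ} (O : Subalgebra k (Fin d → PowerSeries k)) where
  M : ℕ
  E : Finset (Fin d × ℕ)
  basis : E → Fin d → PowerSeries k
  e₀ : E
  snd_lt : ∀ e : E, e.1.2 < M
  snd_e₀ : e₀.1.2 = 0
  mem_of_tupleCoeff_eq_zero : ∀ z : Fin d → PowerSeries k,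
    (∀ s : Fin d × ℕ, s.2 < M → tupleCoeff s z = 0) → z ∈ O
  basis_mem : ∀ e, basis e ∈ O
  tupleCoeff_basis : ∀ e e' : E, tupleCoeff e'.1 (basis e) = if e' = e then 1 else 0
  key_le : ∀ (e : E) (s : Fin d × ℕ), tupleCoeff s (basis e) ≠ 0 → coeffKey e.1 ≤ coeffKey s
  tupleCoeff_eq : ∀ z ∈ O, ∀ s : Fin d × ℕ, s.2 < M →
    tupleCoeff s z = ∑ e : E, tupleCoeff s (basis e) * tupleCoeff e.1 z
  tupleCoeff_basis_zero : ∀ (e : E) (i : Fin d),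
    tupleCoeff (i, 0) (basis e) = if e = e₀ then 1 else 0

/-- `E` consists of the pivots, below exponent `M`, among the coefficient functionals on `O`. -/
theorem exists_frame {k : Type u} [Field k] {d : ℕ} (O : Subalgebra k (Fin d → PowerSeries k))
    [IsLocalRing O] [Module.Finite k ((Fin d → PowerSeries k) ⧸ Subalgebra.toSubmodule O)] :
    Nonempty (Frame O) := by
  classical
  have hd : 0 < d := by
    rcases Nat.eq_zero_or_pos d with rfl | h
    · exact (one_ne_zero (α := O) (Subsingleton.elim _ _)).elim
    · exact h
  obtain ⟨M, hM, hO⟩ := exists_forall_mem_of_coeff_eq_zero O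
  have hO' : ∀ z : Fin d → PowerSeries k,
      (∀ s : Fin d × ℕ, s.2 < M → tupleCoeff s z = 0) → z ∈ O :=
    fun z hz => hO z fun i j hj => hz (i, j) hj
  let f : Fin d × ℕ → Module.Dual k (Subalgebra.toSubmodule O) :=
    fun s => tupleCoeff s ∘ₗ (Subalgebra.toSubmodule O).subtype
  let E : Finset (Fin d × ℕ) :=
    (Finset.univ ×ˢ Finset.range M).filter (· ∈ pivots (k := k) f coeffKey)
  have hE : ∀ s, s ∈ E ↔ s.2 < M ∧ s ∈ pivots (k := k) f coeffKey := fun s => by simp [E]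
  have hlin : LinearIndependent k fun e : E => f e :=
    (linearIndependent_pivots f coeffKey (coeffKey_injective d)).comp
      (fun e : E => ⟨e.1, ((hE e).1 e.2).2⟩)
      (fun e e' h => Subtype.ext (Subtype.mk.inj h))
  have hex : ∀ e : E, ∃ y ∈ O, (∀ e' : E, tupleCoeff e'.1 y = if e' = e then 1 else 0) ∧
      ∀ s : Fin d × ℕ, M ≤ s.2 → tupleCoeff s y = 0 := fun e => by
    obtain ⟨v, hv⟩ := exists_eval_eq_of_linearIndependent hlin fun e' => if e' = e then 1 else 0
    -- The element with the prescribed free coefficients is cut off at `t^M`; the removed tail lies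
    -- in `O`.
    let y : Fin d → PowerSeries k := tupleMk fun s => if s.2 < M then tupleCoeff s v.1 else 0
    refine ⟨y, ?_, fun e' => ?_, fun s hs => by simp [y, hs]⟩
    · have h1 : y - v.1 ∈ O := hO' _ fun s hs => by simp [y, hs]
      simpa using O.add_mem h1 v.2
    · rw [← hv e']
      simp [y, f, ((hE e').1 e'.2).1]
  choose y hyO hyE hyM using hex
  have hspan : ∀ s : Fin d × ℕ, s.2 < M → ∃ b : E → k,
      (∀ e, b e ≠ 0 → coeffKey e.1 ≤ coeffKey s) ∧
      ∀ z ∈ O, tupleCoeff s z = ∑ e, b e * tupleCoeff e.1 z := fun s hs => by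
    have h1 := mem_span_pivots (k := k) f coeffKey s
    have h2 : f '' {e | e ∈ pivots (k := k) f coeffKey ∧ coeffKey e ≤ coeffKey s} ⊆
        (fun e : E => f e) '' {e | coeffKey e.1 ≤ coeffKey s} := by
      rintro _ ⟨e, ⟨he, hes⟩, rfl⟩
      refine ⟨⟨e, (hE e).2 ⟨?_, he⟩⟩, hes, rfl⟩
      -- A pivot with exponent at least `M` would have a larger key than `s`, since the exponent
      -- dominates the branch in `coeffKey`.
      by_contra! hlt
      have h3 : M * d + e.1 ≤ s.2 * d + s.1 :=
        (Nat.add_le_add_right (Nat.mul_le_mul_right d hlt) _).trans hes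
      have h4 : (s.2 + 1) * d ≤ M * d := Nat.mul_le_mul_right d hs
      have := s.1.2
      rw [Nat.add_mul] at h4
      omega
    obtain ⟨b, hb, hb'⟩ := (Finsupp.mem_span_image_iff_linearCombination k).1
      (Submodule.span_mono h2 h1)
    refine ⟨b, fun e he => ?_, fun z hz => ?_⟩
    · exact (Finsupp.mem_supported _ _).1 hb (Finsupp.mem_support_iff.2 he)
    · have h5 := LinearMap.congr_fun hb' ⟨z, hz⟩
      rw [Finsupp.linearCombination_apply, Finsupp.sum_fintype _ _ (by simp)] at h5
      simpa [f] using h5.symm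
  -- The coefficients of the relation are found by applying it to the dual basis.
  have hb : ∀ (s : Fin d × ℕ) (hs : s.2 < M) (b : E → k),
      (∀ z ∈ O, tupleCoeff s z = ∑ e, b e * tupleCoeff e.1 z) → ∀ e, b e = tupleCoeff s (y e) := by
    intro s hs b hb e
    rw [hb _ (hyO e)]
    simp [hyE]
  -- This index has the least key, so it is a pivot as soon as its functional is nonzero, which `1 ∈
  -- O` shows.
  have he₀ : ((⟨0, hd⟩, 0) : Fin d × ℕ) ∈ E := by
    refine (hE _).2 ⟨hM, fun h => ?_⟩
    have : {s' : Fin d × ℕ | coeffKey s' < coeffKey ((⟨0, hd⟩, 0) : Fin d × ℕ)} = ∅ := by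
      simp [coeffKey]
    rw [this, Set.image_empty, Submodule.span_empty, Submodule.mem_bot] at h
    have := LinearMap.congr_fun h ⟨1, O.one_mem⟩
    simp [f, tupleCoeff_apply] at this
  refine ⟨⟨M, E, y, ⟨_, he₀⟩, fun e => ((hE e).1 e.2).1, rfl, hO', hyO, hyE, ?_, ?_, ?_⟩⟩
  · intro e s h
    have hs : s.2 < M := by
      by_contra! hs
      exact h (hyM e s hs)
    obtain ⟨b, hb1, hb2⟩ := hspan s hs
    exact hb1 e (by rwa [hb s hs b hb2])
  · intro z hz s hs
    obtain ⟨b, hb1, hb2⟩ := hspan s hs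
    rw [hb2 z hz]
    exact Finset.sum_congr rfl fun e _ => by rw [hb s hs b hb2]
  · intro e i
    have h1 := constantCoeff_eq_of_mem O (hyO e) i ⟨0, hd⟩
    rw [← PowerSeries.coeff_zero_eq_constantCoeff_apply,
      ← PowerSeries.coeff_zero_eq_constantCoeff_apply] at h1
    rw [tupleCoeff_apply, h1, ← tupleCoeff_apply (⟨0, hd⟩, 0), hyE e ⟨_, he₀⟩]
    simp only [eq_comm]

namespace Frame

variable {k : Type u} [Field k] {d : ℕ} {O : Subalgebra k (Fin d → PowerSeries k)} (F : Frame O)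

theorem mem_iff (z : Fin d → PowerSeries k) : z ∈ O ↔ ∀ s : Fin d × ℕ, s.2 < F.M →
    tupleCoeff s z = ∑ e : F.E, tupleCoeff s (F.basis e) * tupleCoeff e.1 z := by
  refine ⟨F.tupleCoeff_eq z, fun h => ?_⟩
  have h1 : ∑ e : F.E, tupleCoeff e.1 z • F.basis e ∈ O :=
    O.sum_mem fun e _ => O.smul_mem (F.basis_mem e) _
  have h2 : z - ∑ e : F.E, tupleCoeff e.1 z • F.basis e ∈ O :=
    F.mem_of_tupleCoeff_eq_zero _ fun s hs => by
      rw [map_sub, h s hs, map_sum, ← Finset.sum_sub_distrib]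
      exact Finset.sum_eq_zero fun e _ => by simp [mul_comm]
  simpa using O.add_mem h2 h1

/-- `O` is cut out by one equation for each non-free index below `M`. These equations are
independent, as seen on tuples supported at the non-free indices. -/
theorem sdelta_add_card : sdelta O + F.E.card = d * F.M := by
  classical
  let S : Finset (Fin d × ℕ) := Finset.univ ×ˢ Finset.range F.M
  have hS : ∀ s, s ∈ S ↔ s.2 < F.M := fun s => by simp [S]
  have hES : F.E ⊆ S := fun e he => (hS e).2 (F.snd_lt ⟨e, he⟩)
  let Φ : (Fin d → PowerSeries k) →ₗ[k] (↥(S \ F.E) → k) := LinearMap.pi fun s =>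
    tupleCoeff s.1 - ∑ e : F.E, tupleCoeff s.1 (F.basis e) • tupleCoeff e.1
  have hΦ : ∀ z (s : ↥(S \ F.E)), Φ z s =
      tupleCoeff s.1 z - ∑ e : F.E, tupleCoeff s.1 (F.basis e) * tupleCoeff e.1 z := fun z s => by
    simp [Φ]
  have hker : LinearMap.ker Φ = Subalgebra.toSubmodule O := by
    ext z
    rw [LinearMap.mem_ker, Subalgebra.mem_toSubmodule, F.mem_iff]
    constructor
    · intro h s hs
      by_cases hsE : s ∈ F.E
      · have h1 : ∀ e : F.E, tupleCoeff s (F.basis e) = if (⟨s, hsE⟩ : F.E) = e then 1 else 0 :=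
          fun e => F.tupleCoeff_basis e ⟨s, hsE⟩
        simp [h1]
      · have := congrFun h ⟨s, by simp [hS, hs, hsE]⟩
        rw [hΦ] at this
        exact sub_eq_zero.1 this
    · intro h
      funext s
      rw [hΦ, h s.1 ((hS _).1 (Finset.mem_sdiff.1 s.2).1)]
      simp
  have hsurj : LinearMap.range Φ = ⊤ := by
    rw [LinearMap.range_eq_top]
    intro c
    refine ⟨tupleMk fun s => if h : s ∈ S \ F.E then c ⟨s, h⟩ else 0, ?_⟩
    funext s
    rw [hΦ, tupleCoeff_tupleMk, dif_pos s.2, Finset.sum_eq_zero, sub_zero]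
    intro e _
    rw [tupleCoeff_tupleMk, dif_neg (fun h => (Finset.mem_sdiff.1 h).2 e.2), mul_zero]
  have h1 : sdelta O = (S \ F.E).card := by
    rw [sdelta, ← hker, LinearEquiv.finrank_eq Φ.quotKerEquivRange, hsurj]
    simp
  rw [h1, Finset.card_sdiff_add_card_eq_card hES]
  simp [S]

end Frame

/-! ### Tuples of power series over an arbitrary ring -/

section Tuples

variable {R S : Type*} [CommRing R] [CommRing S] {d : ℕ}

/-- The map on tuples of power series induced by a ring homomorphism. -/
def tupleMap (φ : R →+* S) : (Fin d → PowerSeries R) →+* (Fin d → PowerSeries S) :=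
  (PowerSeries.map φ).compLeft (Fin d)

@[simp]
theorem tupleCoeff_tupleMap (φ : R →+* S) (s : Fin d × ℕ) (z : Fin d → PowerSeries R) :
    tupleCoeff s (tupleMap φ z) = φ (tupleCoeff s z) :=
  PowerSeries.coeff_map _ _ _

theorem tupleCoeff_mul (s : Fin d × ℕ) (y z : Fin d → PowerSeries R) :
    tupleCoeff s (y * z) = ∑ p ∈ Finset.HasAntidiagonal.antidiagonal s.2,
      tupleCoeff (s.1, p.1) y * tupleCoeff (s.1, p.2) z :=
  PowerSeries.coeff_mul _ _ _

theorem tupleCoeff_zero_mul (i : Fin d) (y z : Fin d → PowerSeries R) :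
    tupleCoeff (i, 0) (y * z) = tupleCoeff (i, 0) y * tupleCoeff (i, 0) z := by
  rw [tupleCoeff_mul]
  simp

theorem tupleCoeff_zero_one (i : Fin d) :
    tupleCoeff (i, 0) (1 : Fin d → PowerSeries R) = 1 := by
  simp [tupleCoeff_apply]

/-- Congruence of tuples of power series modulo `t ^ M`. -/
def TruncEq (M : ℕ) (y z : Fin d → PowerSeries R) : Prop :=
  ∀ s : Fin d × ℕ, s.2 < M → tupleCoeff s y = tupleCoeff s z

theorem TruncEq.mul {M : ℕ} {y y' z z' : Fin d → PowerSeries R} (h : TruncEq M y y')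
    (h' : TruncEq M z z') : TruncEq M (y * z) (y' * z') := by
  intro s hs
  rw [tupleCoeff_mul, tupleCoeff_mul]
  refine Finset.sum_congr rfl fun p hp => ?_
  rw [Finset.HasAntidiagonal.mem_antidiagonal] at hp
  rw [h (s.1, p.1) (by simp only; omega), h' (s.1, p.2) (by simp only; omega)]

theorem TruncEq.refl (M : ℕ) (z : Fin d → PowerSeries R) : TruncEq M z z := fun _ _ => rfl

theorem TruncEq.symm {M : ℕ} {y z : Fin d → PowerSeries R} (h : TruncEq M y z) : TruncEq M z y :=
  fun s hs => (h s hs).symm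

theorem TruncEq.trans {M : ℕ} {x y z : Fin d → PowerSeries R} (h : TruncEq M x y)
    (h' : TruncEq M y z) : TruncEq M x z :=
  fun s hs => (h s hs).trans (h' s hs)

/-- The truncation of a tuple of power series modulo `t ^ M`. -/
def tupleTrunc (M : ℕ) (z : Fin d → PowerSeries R) : Fin d → PowerSeries R :=
  tupleMk fun s => if s.2 < M then tupleCoeff s z else 0

theorem truncEq_tupleTrunc (M : ℕ) (z : Fin d → PowerSeries R) : TruncEq M (tupleTrunc M z) z :=
  fun s hs => by simp [tupleTrunc, hs]

theorem TruncEq.tupleTrunc_eq {M : ℕ} {y z : Fin d → PowerSeries R} (h : TruncEq M y z) :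
    tupleTrunc M y = tupleTrunc M z :=
  tuple_ext fun s => by
    by_cases hs : s.2 < M
    · simp [tupleTrunc, hs, h s hs]
    · simp [tupleTrunc, hs]

theorem tupleMap_tupleTrunc (φ : R →+* S) (M : ℕ) (z : Fin d → PowerSeries R) :
    tupleMap φ (tupleTrunc M z) = tupleTrunc M (tupleMap φ z) :=
  tuple_ext fun s => by
    by_cases hs : s.2 < M
    · simp [tupleTrunc, hs]
    · simp [tupleTrunc, hs]

theorem isUnit_tuple_iff {z : Fin d → PowerSeries R} :
    IsUnit z ↔ ∀ i, IsUnit (tupleCoeff (i, 0) z) := by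
  rw [Pi.isUnit_iff]
  exact forall_congr' fun i => by
    rw [PowerSeries.isUnit_iff_constantCoeff, tupleCoeff_apply,
      PowerSeries.coeff_zero_eq_constantCoeff_apply]

theorem truncEq_pow_of_tupleCoeff_eq_zero {z : Fin d → PowerSeries R}
    (hz : ∀ i, tupleCoeff (i, 0) z = 0) (M : ℕ) : TruncEq M (z ^ M) 0 := by
  intro s hs
  have h : PowerSeries.X ∣ z s.1 := PowerSeries.X_dvd_iff.2 (by
    rw [← PowerSeries.coeff_zero_eq_constantCoeff_apply]
    exact hz s.1)
  rw [map_zero]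
  exact PowerSeries.X_pow_dvd_iff.1 (pow_dvd_pow_of_dvd h M) s.2 hs

end Tuples

theorem det_eq_prod_of_injective_key {ι R : Type*} [Fintype ι] [DecidableEq ι] [CommRing R]
    {key : ι → ℕ} (A : Matrix ι ι R) (hkey : Function.Injective key)
    (hA : ∀ i j, key i < key j → A i j = 0) : A.det = ∏ i, A i i := by
  let _ : LinearOrder ι := LinearOrder.lift' key hkey
  convert Matrix.det_of_isLowerTriangular A fun i j hij => hA i j hij

/-! ### The equations of the local ring over an arbitrary algebra. -/

namespace Frame

variable {k : Type u} [Field k] {d : ℕ} {O : Subalgebra k (Fin d → PowerSeries k)} (F : Frame O)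

theorem tupleCoeff_e₀ {R : Type*} [CommRing R] (z : Fin d → PowerSeries R) : tupleCoeff F.e₀.1 z =
    tupleCoeff (F.e₀.1.1, 0) z := by
  conv_lhs => rw [← Prod.mk.eta (p := F.e₀.1), F.snd_e₀]

section Ring

variable {R S : Type*} [CommRing R] [Algebra k R] [CommRing S] [Algebra k S]

/-- The combination of the basis elements with given coefficients. -/
def lift (c : F.E → R) : Fin d → PowerSeries R :=
  tupleMk fun s => ∑ e, algebraMap k R (tupleCoeff s (F.basis e)) * c e

theorem tupleCoeff_lift (c : F.E → R) (s : Fin d × ℕ) :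
    tupleCoeff s (F.lift c) = ∑ e, algebraMap k R (tupleCoeff s (F.basis e)) * c e := by
  simp [lift]

theorem tupleCoeff_lift_zero (c : F.E → R) (i : Fin d) :
    tupleCoeff (i, 0) (F.lift c) = c F.e₀ := by
  classical
  simp [tupleCoeff_lift, F.tupleCoeff_basis_zero]

theorem M_pos : 0 < F.M := (Nat.zero_le _).trans_lt (F.snd_lt F.e₀)

theorem tupleMap_lift (φ : R →ₐ[k] S) (c : F.E → R) :
    tupleMap (φ : R →+* S) (F.lift c) = F.lift (φ ∘ c) :=
  tuple_ext fun s => by simp [tupleCoeff_lift]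

theorem lift_eq_sum (c : F.E → R) :
    F.lift c = ∑ e, c e • tupleMap (algebraMap k R) (F.basis e) :=
  tuple_ext fun s => by
    rw [tupleCoeff_lift, map_sum]
    exact Finset.sum_congr rfl fun e _ => by
      rw [map_smul, tupleCoeff_tupleMap, smul_eq_mul, mul_comm]

variable (R) in
/-- The submodule of tuples of power series over `R` given by the equations for `O`. -/
def submodule : Submodule R (Fin d → PowerSeries R) where
  carrier := {z | TruncEq F.M z (F.lift fun e => tupleCoeff e.1 z)}
  add_mem' := fun hy hz s hs => by
    rw [map_add, hy s hs, hz s hs]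
    simp [tupleCoeff_lift, mul_add, Finset.sum_add_distrib]
  zero_mem' := fun s hs => by simp [tupleCoeff_lift]
  smul_mem' := fun c z hz s hs => by
    rw [map_smul, hz s hs]
    simp [tupleCoeff_lift, Finset.mul_sum, mul_left_comm]

theorem mem_submodule {z : Fin d → PowerSeries R} :
    z ∈ F.submodule R ↔ TruncEq F.M z (F.lift fun e => tupleCoeff e.1 z) := Iff.rfl

theorem mem_submodule_of_truncEq {y z : Fin d → PowerSeries R} (h : TruncEq F.M y z)
    (hz : z ∈ F.submodule R) : y ∈ F.submodule R := by
  rw [mem_submodule] at *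
  have : (fun e : F.E => tupleCoeff e.1 y) = fun e => tupleCoeff e.1 z :=
    funext fun e => h e.1 (F.snd_lt e)
  rw [this]
  exact h.trans hz

theorem tupleMap_mem_submodule {y : Fin d → PowerSeries k} (hy : y ∈ O) :
    tupleMap (algebraMap k R) y ∈ F.submodule R := fun s hs => by
  rw [tupleCoeff_lift, tupleCoeff_tupleMap, F.tupleCoeff_eq y hy s hs]
  simp

theorem lift_mem (c : F.E → R) : F.lift c ∈ F.submodule R := by
  rw [lift_eq_sum]
  exact Submodule.sum_mem _ fun e _ =>
    Submodule.smul_mem _ _ (F.tupleMap_mem_submodule (F.basis_mem e))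

/-- Modulo `t^M` both factors are `R`-combinations of the basis elements, whose products lie in `O`.
-/
theorem mul_mem_submodule {y z : Fin d → PowerSeries R} (hy : y ∈ F.submodule R)
    (hz : z ∈ F.submodule R) : y * z ∈ F.submodule R := by
  refine F.mem_submodule_of_truncEq (TruncEq.mul hy hz) ?_
  rw [lift_eq_sum, lift_eq_sum, Finset.sum_mul_sum]
  refine Submodule.sum_mem _ fun e _ => Submodule.sum_mem _ fun e' _ => ?_
  rw [smul_mul_smul_comm, ← map_mul]
  exact Submodule.smul_mem _ _
    (F.tupleMap_mem_submodule (O.mul_mem (F.basis_mem e) (F.basis_mem e')))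

theorem one_mem_submodule : (1 : Fin d → PowerSeries R) ∈ F.submodule R := by
  rw [← map_one (tupleMap (algebraMap k R))]
  exact F.tupleMap_mem_submodule O.one_mem

theorem pow_mem_submodule {z : Fin d → PowerSeries R} (hz : z ∈ F.submodule R) (n : ℕ) :
    z ^ n ∈ F.submodule R := by
  induction n with
  | zero => exact pow_zero z ▸ F.one_mem_submodule
  | succ n ih => exact pow_succ z n ▸ F.mul_mem_submodule ih hz

theorem mem_submodule_of_truncEq_zero {z : Fin d → PowerSeries R} (hz : TruncEq F.M z 0) :
    z ∈ F.submodule R :=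
  F.mem_submodule_of_truncEq hz (zero_mem _)

theorem tupleCoeff_zero_eq {z : Fin d → PowerSeries R} (hz : z ∈ F.submodule R) (i : Fin d) :
    tupleCoeff (i, 0) z = tupleCoeff F.e₀.1 z := by
  rw [F.mem_submodule.1 hz (i, 0) F.M_pos, tupleCoeff_lift_zero]

/-- All constant coefficients of `z` agree, so with `a` their inverse, `n = 1 - a z` has zero
constant terms and `n^M` vanishes modulo `t^M`. The geometric series writes `v` modulo `t^M` as a
polynomial in `z`. -/
theorem inv_mem_submodule {z v : Fin d → PowerSeries R} (hz : z ∈ F.submodule R)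
    (hv : z * v = 1) : v ∈ F.submodule R := by
  obtain ⟨⟨i₀, j₀⟩, h₀⟩ : ∃ s : Fin d × ℕ, s = F.e₀.1 := ⟨_, rfl⟩
  obtain rfl : j₀ = 0 := by rw [← F.snd_e₀, ← h₀]
  set a := tupleCoeff (i₀, 0) v with ha
  have h1 : tupleCoeff (i₀, 0) z * a = 1 := by
    rw [ha, ← tupleCoeff_zero_mul, hv, tupleCoeff_zero_one]
  set n := 1 - a • z with hn
  have hnF : n ∈ F.submodule R := Submodule.sub_mem _ F.one_mem_submodule
    (Submodule.smul_mem _ _ hz)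
  have hn0 : ∀ i, tupleCoeff (i, 0) n = 0 := fun i => by
    rw [hn, map_sub, tupleCoeff_zero_one, map_smul, F.tupleCoeff_zero_eq hz, ← h₀, smul_eq_mul,
      mul_comm, h1, sub_self]
  have h2 : v = a • ∑ j ∈ Finset.range F.M, n ^ j + n ^ F.M * v := by
    have h3 := mul_neg_geom_sum n F.M
    have h4 : (1 - n) * v = a • 1 := by
      rw [hn, sub_sub_cancel, smul_mul_assoc, hv]
    have h5 : v * ((1 - n) * ∑ j ∈ Finset.range F.M, n ^ j) =
        a • ∑ j ∈ Finset.range F.M, n ^ j := by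
      rw [← mul_assoc, mul_comm v, h4, smul_mul_assoc, one_mul]
    rw [← h5, h3]
    ring
  rw [h2]
  refine Submodule.add_mem _ (Submodule.smul_mem _ _ (Submodule.sum_mem _ fun j _ =>
    F.pow_mem_submodule hnF j)) (F.mem_submodule_of_truncEq_zero ?_)
  have := (truncEq_pow_of_tupleCoeff_eq_zero hn0 F.M).mul (TruncEq.refl F.M v)
  rwa [zero_mul] at this

/-! ### Normal forms -/

variable [DecidableEq F.E]

/-- The matrix of the map that sends the free coefficients of an element `w` of `O` to those
of `z * w`. -/
def matrix (z : Fin d → PowerSeries R) : Matrix F.E F.E R :=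
  Matrix.of fun e e' => tupleCoeff e.1 (z * F.lift (Pi.single e' 1))

theorem matrix_mulVec (z : Fin d → PowerSeries R) (c : F.E → R) (e : F.E) :
    (F.matrix z).mulVec c e = tupleCoeff e.1 (z * F.lift c) := by
  have h : F.lift c = ∑ e', c e' • F.lift (Pi.single e' (1 : R)) := tuple_ext fun s => by
    simp [tupleCoeff_lift, Pi.single_apply, mul_comm]
  rw [h, Finset.mul_sum, map_sum]
  exact Finset.sum_congr rfl fun e' _ => by
    rw [mul_smul_comm, map_smul, smul_eq_mul, mul_comm]
    rfl

theorem matrix_congr {y z : Fin d → PowerSeries R} (h : TruncEq F.M y z) :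
    F.matrix y = F.matrix z := by
  ext e e'
  exact h.mul (TruncEq.refl _ _) e.1 (F.snd_lt e)

/-- Multiplication by `z` never lowers exponents within a branch, and the basis element of `e'` has
no coefficient preceding `e'`. So the matrix is lower triangular, with the constant coefficients of
`z` on the diagonal. -/
theorem isUnit_det_matrix {z : Fin d → PowerSeries R} (hz : IsUnit z) :
    IsUnit (F.matrix z).det := by
  have hinj : Function.Injective fun e : F.E => coeffKey e.1 :=
    (coeffKey_injective d).comp Subtype.val_injective
  have hentry : ∀ e e' : F.E, F.matrix z e e' = ∑ p ∈ Finset.HasAntidiagonal.antidiagonal e.1.2,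
      tupleCoeff (e.1.1, p.1) z * algebraMap k R (tupleCoeff (e.1.1, p.2) (F.basis e')) := by
    intro e e'
    rw [matrix, Matrix.of_apply, tupleCoeff_mul]
    simp [tupleCoeff_lift, Pi.single_apply]
  have htri : ∀ e e' : F.E, coeffKey e.1 < coeffKey e'.1 → F.matrix z e e' = 0 := by
    intro e e' hlt
    rw [hentry]
    refine Finset.sum_eq_zero fun p hp => ?_
    rw [Finset.HasAntidiagonal.mem_antidiagonal] at hp
    by_contra hne
    have h1 : tupleCoeff (e.1.1, p.2) (F.basis e') ≠ 0 := fun h => hne (by rw [h, map_zero, mul_zero])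
    have h2 := F.key_le _ _ h1
    have h3 : coeffKey ((e.1.1, p.2) : Fin d × ℕ) ≤ coeffKey e.1 :=
      Nat.add_le_add_right (Nat.mul_le_mul_right d (by simp only; omega)) _
    omega
  rw [det_eq_prod_of_injective_key _ hinj htri]
  refine IsUnit.prod_univ_iff.2 fun e => ?_
  rw [hentry, Finset.sum_eq_single (0, e.1.2)]
  · have := F.tupleCoeff_basis e e
    simpa [this] using isUnit_tuple_iff.1 hz e.1.1
  · rintro ⟨p, q⟩ hp hne
    rw [Finset.HasAntidiagonal.mem_antidiagonal] at hp
    by_contra hne'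
    have h1 : tupleCoeff (e.1.1, q) (F.basis e) ≠ 0 := fun h => hne' (by rw [h, map_zero, mul_zero])
    have h2 := F.key_le _ _ h1
    simp only at hp
    have h3 : q < e.1.2 := by
      refine lt_of_le_of_ne (by omega) ?_
      rintro rfl
      exact hne (Prod.ext (by simp only; omega) rfl)
    have h4 : (q + 1) * d ≤ e.1.2 * d := Nat.mul_le_mul_right d h3
    have h5 := e.1.1.2
    simp only [coeffKey] at h2
    rw [Nat.add_mul] at h4
    omega
  · simp

/-- The free coefficients of the element `w` of `O` for which those of `z * w` are the free
coefficients of `1`. -/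
def sol (z : Fin d → PowerSeries R) : F.E → R :=
  (F.matrix z)⁻¹.mulVec (Pi.single F.e₀ 1)

theorem tupleCoeff_mul_lift_sol {z : Fin d → PowerSeries R} (hz : IsUnit z) (e : F.E) :
    tupleCoeff e.1 (z * F.lift (F.sol z)) = if e = F.e₀ then 1 else 0 := by
  rw [← matrix_mulVec, sol, Matrix.mulVec_mulVec, Matrix.mul_nonsing_inv _ (F.isUnit_det_matrix hz),
    Matrix.one_mulVec, Pi.single_apply]

theorem eq_sol {z : Fin d → PowerSeries R} (hz : IsUnit z) {c : F.E → R}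
    (hc : ∀ e : F.E, tupleCoeff e.1 (z * F.lift c) = if e = F.e₀ then 1 else 0) : c = F.sol z := by
  have h : (F.matrix z).mulVec c = Pi.single F.e₀ 1 := funext fun e => by
    rw [matrix_mulVec, hc, Pi.single_apply]
  rw [sol, ← h, Matrix.mulVec_mulVec, Matrix.nonsing_inv_mul _ (F.isUnit_det_matrix hz),
    Matrix.one_mulVec]

theorem sol_congr {y z : Fin d → PowerSeries R} (h : TruncEq F.M y z) : F.sol y = F.sol z := by
  rw [sol, sol, F.matrix_congr h]

/-- By uniqueness of the solution. Consequently the computation for the universal unit specializes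
to all points. -/
theorem sol_tupleMap (φ : R →ₐ[k] S) {z : Fin d → PowerSeries R} (hz : IsUnit z) :
    F.sol (tupleMap (φ : R →+* S) z) = φ ∘ F.sol z := by
  symm
  refine F.eq_sol (hz.map _) fun e => ?_
  rw [← tupleMap_lift, ← map_mul, tupleCoeff_tupleMap, F.tupleCoeff_mul_lift_sol hz]
  split_ifs <;> simp

theorem tupleCoeff_mul_sol {z : Fin d → PowerSeries R} (hz : IsUnit z) :
    tupleCoeff F.e₀.1 z * F.sol z F.e₀ = 1 := by
  have h := F.tupleCoeff_mul_lift_sol hz F.e₀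
  rwa [tupleCoeff_e₀, tupleCoeff_zero_mul, tupleCoeff_lift_zero, if_pos rfl, ← tupleCoeff_e₀] at h

theorem isUnit_lift_sol {z : Fin d → PowerSeries R} (hz : IsUnit z) :
    IsUnit (F.lift (F.sol z)) :=
  isUnit_tuple_iff.2 fun i => by
    rw [tupleCoeff_lift_zero]
    exact IsUnit.of_mul_eq_one_right _ (F.tupleCoeff_mul_sol hz)

/-- The normal form of a unit modulo the units of `O`. -/
def normalForm (z : Fin d → PowerSeries R) : Fin d → PowerSeries R :=
  tupleTrunc F.M (z * F.lift (F.sol z))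

theorem truncEq_normalForm (z : Fin d → PowerSeries R) :
    TruncEq F.M (F.normalForm z) (z * F.lift (F.sol z)) :=
  truncEq_tupleTrunc _ _

theorem normalForm_tupleMap (φ : R →ₐ[k] S) {z : Fin d → PowerSeries R} (hz : IsUnit z) :
    F.normalForm (tupleMap (φ : R →+* S) z) = tupleMap (φ : R →+* S) (F.normalForm z) := by
  rw [normalForm, normalForm, F.sol_tupleMap φ hz, tupleMap_tupleTrunc, map_mul, tupleMap_lift]

theorem tupleCoeff_normalForm {z : Fin d → PowerSeries R} (hz : IsUnit z) (e : F.E) :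
    tupleCoeff e.1 (F.normalForm z) = if e = F.e₀ then 1 else 0 := by
  rw [F.truncEq_normalForm z e.1 (F.snd_lt e), F.tupleCoeff_mul_lift_sol hz]

theorem isUnit_normalForm {z : Fin d → PowerSeries R} (hz : IsUnit z) :
    IsUnit (F.normalForm z) :=
  isUnit_tuple_iff.2 fun i => by
    rw [F.truncEq_normalForm z (i, 0) F.M_pos]
    exact isUnit_tuple_iff.1 (hz.mul (F.isUnit_lift_sol hz)) i

/-- A unit is determined modulo the units of `O` by its normal form. -/
theorem normalForm_eq {z w y : Fin d → PowerSeries R} (hz : IsUnit z) (hw : w ∈ F.submodule R)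
    (hy : TruncEq F.M y (z * w))
    (hy' : ∀ e : F.E, tupleCoeff e.1 y = if e = F.e₀ then 1 else 0) :
    TruncEq F.M w (F.lift (F.sol z)) ∧ F.normalForm z = tupleTrunc F.M y := by
  have h1 : (fun e : F.E => tupleCoeff e.1 w) = F.sol z := F.eq_sol hz fun e => by
    rw [← hy' e, hy e.1 (F.snd_lt e)]
    exact ((TruncEq.refl _ z).mul hw).symm e.1 (F.snd_lt e)
  have h2 : TruncEq F.M w (F.lift (F.sol z)) := h1 ▸ hw
  exact ⟨h2, ((hy.trans ((TruncEq.refl _ z).mul h2)).tupleTrunc_eq).symm⟩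

/-- If `v` normalizes `z * w`, then `w * v` satisfies the equations of `O` and normalizes `z`; such
a factor is unique modulo `t^M`. -/
theorem normalForm_mul {z w : Fin d → PowerSeries R} (hz : IsUnit z) (hw : IsUnit w)
    (hw' : w ∈ F.submodule R) : F.normalForm (z * w) = F.normalForm z := by
  have h := F.truncEq_normalForm (z * w)
  rw [mul_assoc] at h
  rw [(F.normalForm_eq hz (F.mul_mem_submodule hw' (F.lift_mem _)) h
    (F.tupleCoeff_normalForm (hz.mul hw))).2]
  exact (tuple_ext fun s => by
    by_cases hs : s.2 < F.M <;> simp [normalForm, tupleTrunc, hs])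

end Ring

/-- The frame equations are among those defining `points`. Conversely, a linear relation holding on
`O` involves only exponents below `M` and vanishes on the basis, hence on every combination of it.
-/
theorem mem_points_iff {K : Type u} [Field K] [Algebra k K] {z : Fin d → PowerSeries K} :
    z ∈ points O K ↔ z ∈ F.submodule K := by
  classical
  constructor
  · intro h s hs
    have h1 := h (Finsupp.single s 1 - ∑ e : F.E, Finsupp.single e.1 (tupleCoeff s (F.basis e)))
    have h2 : ∀ (A : Type u) [Field A] [Algebra k A] (y : Fin d → PowerSeries A),
        ((Finsupp.single s 1 - ∑ e : F.E, Finsupp.single e.1 (tupleCoeff s (F.basis e))).sum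
          fun p c => algebraMap k A c * PowerSeries.coeff p.2 (y p.1)) =
        tupleCoeff s y - ∑ e : F.E, algebraMap k A (tupleCoeff s (F.basis e)) *
          tupleCoeff e.1 y := by
      intro A _ _ y
      rw [Finsupp.sum_sub_index (fun p a b => by rw [map_sub, sub_mul]),
        ← Finsupp.sum_finsetSum_index (by simp) (by intros; rw [map_add, add_mul])]
      simp [tupleCoeff_apply, Finsupp.sum_single_index]
    rw [h2] at h1
    rw [tupleCoeff_lift]
    refine sub_eq_zero.1 (h1 fun y hy => ?_)
    have h3 := h2 k y
    simp only [Algebra.algebraMap_self, RingHom.id_apply] at h3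
    rw [h3, F.tupleCoeff_eq y hy s hs, sub_self]
  · intro hz l hl
    have h1 : ∀ s : Fin d × ℕ, F.M ≤ s.2 → l s = 0 := fun s hs => by
      -- The tuple with the single coefficient `1` at `s` lies in `O` since `M ≤ s.2`, so it detects
      -- `l s`.
      have h2 := hl (tupleMk (Pi.single s 1)) (F.mem_of_tupleCoeff_eq_zero _ fun s' hs' => by
        rw [tupleCoeff_tupleMk, Pi.single_eq_of_ne]
        rintro rfl
        omega)
      have h3 : ∀ p : Fin d × ℕ, PowerSeries.coeff p.2 ((tupleMk (Pi.single s (1 : k)) :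
          Fin d → PowerSeries k) p.1) = if p = s then 1 else 0 := fun p => by
        rw [← tupleCoeff_apply, tupleCoeff_tupleMk, Pi.single_apply]
      simp only [h3] at h2
      rw [Finsupp.sum, Finset.sum_congr rfl (fun p _ => mul_ite _ _ _ _)] at h2
      simpa using h2
    have h4 : ∀ s ∈ l.support, algebraMap k K (l s) * PowerSeries.coeff s.2 (z s.1) =
        ∑ e : F.E, algebraMap k K (l s * PowerSeries.coeff s.2 (F.basis e s.1)) *
          tupleCoeff e.1 z := fun s hs => by
      have hs' : s.2 < F.M := by
        by_contra! h
        exact (Finsupp.mem_support_iff.1 hs) (h1 s h)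
      have h5 := F.mem_submodule.1 hz s hs'
      rw [tupleCoeff_apply, tupleCoeff_lift] at h5
      rw [h5, Finset.mul_sum]
      exact Finset.sum_congr rfl fun e _ => by rw [map_mul, mul_assoc]; rfl
    rw [Finsupp.sum, Finset.sum_congr rfl h4, Finset.sum_comm]
    refine Finset.sum_eq_zero fun e _ => ?_
    rw [← Finset.sum_mul, ← map_sum]
    have h6 := hl _ (F.basis_mem e)
    rw [Finsupp.sum] at h6
    rw [h6, map_zero, zero_mul]

end Frame

/-! ### The universal unit of the normalization -/

section UnivUnit

variable {k : Type u} [Field k] {d : ℕ}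

variable (k d) in
/-- The universal unit of the normalization. -/
def univUnit : Fin d → PowerSeries (UnitRing k d) :=
  tupleMk fun s => algebraMap (MvPolynomial (Fin d × ℕ) k) (UnitRing k d) (MvPolynomial.X s)

theorem isUnit_univUnit : IsUnit (univUnit k d) := by
  have h : IsUnit (algebraMap (MvPolynomial (Fin d × ℕ) k) (UnitRing k d)
      (∏ i : Fin d, MvPolynomial.X (i, 0))) := IsLocalization.Away.algebraMap_isUnit _
  rw [map_prod, IsUnit.prod_univ_iff] at h
  exact isUnit_tuple_iff.2 fun i => by simpa [univUnit] using h i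

/-- A homomorphism from the ring of regular functions on the units of the normalization is
determined by the image of the universal unit. -/
theorem unitRing_algHom_ext {A : Type*} [CommRing A] [Algebra k A] {χ χ' : UnitRing k d →ₐ[k] A}
    (h : tupleMap (χ : UnitRing k d →+* A) (univUnit k d) =
      tupleMap (χ' : UnitRing k d →+* A) (univUnit k d)) : χ = χ' := by
  refine IsLocalization.algHom_ext (Submonoid.powers
    (∏ i : Fin d, (MvPolynomial.X (i, 0) : MvPolynomial (Fin d × ℕ) k))) ?_
  refine MvPolynomial.algHom_ext fun s => ?_
  have h1 := congrArg (tupleCoeff s) h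
  rw [tupleCoeff_tupleMap, tupleCoeff_tupleMap, univUnit, tupleCoeff_tupleMk] at h1
  exact h1

theorem tupleMap_evalUnit {K : Type u} [Field K] [Algebra k K] (μ : (Fin d → PowerSeries K)ˣ) :
    tupleMap (evalUnit (k := k) μ : UnitRing k d →+* K) (univUnit k d) = μ :=
  tuple_ext fun s => by
    rw [tupleCoeff_tupleMap, univUnit, tupleCoeff_tupleMk]
    change evalUnit μ _ = _
    rw [evalUnit, IsLocalization.liftAlgHom_apply, IsLocalization.lift_eq]
    simp [tupleCoeff_apply]

theorem exists_evalUnit_eq {K : Type u} [Field K] [Algebra k K] (χ : UnitRing k d →ₐ[k] K) :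
    ∃ μ : (Fin d → PowerSeries K)ˣ, evalUnit (k := k) μ = χ :=
  ⟨(isUnit_univUnit.map (tupleMap (χ : UnitRing k d →+* K))).unit,
    unitRing_algHom_ext (tupleMap_evalUnit _)⟩

instance : IsDomain (UnitRing k d) :=
  IsLocalization.isDomain_localization (powers_le_nonZeroDivisors_of_noZeroDivisors
    (Finset.prod_ne_zero_iff.2 fun _ _ => MvPolynomial.X_ne_zero _))

/-- The ring is a domain, and its embedding into the fraction field is itself evaluation at a unit,
the generic one. -/
theorem unitRing_ext {f g : UnitRing k d} (h : ∀ (K : Type u) [Field K] [Algebra k K]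
    (μ : (Fin d → PowerSeries K)ˣ), evalUnit (k := k) μ f = evalUnit (k := k) μ g) : f = g := by
  obtain ⟨μ, hμ⟩ := exists_evalUnit_eq
    (IsScalarTower.toAlgHom k (UnitRing k d) (FractionRing (UnitRing k d)))
  have := h _ μ
  rw [hμ] at this
  exact IsFractionRing.injective (UnitRing k d) (FractionRing (UnitRing k d)) this

end UnivUnit

namespace Frame

variable {k : Type u} [Field k] {d : ℕ} {O : Subalgebra k (Fin d → PowerSeries k)} (F : Frame O)

/-! ### The coordinate ring of the quotient group -/

theorem isUnitPoint_iff {K : Type u} [Field K] [Algebra k K] {w : (Fin d → PowerSeries K)ˣ} :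
    IsUnitPoint O w ↔ (w : Fin d → PowerSeries K) ∈ F.submodule K := by
  rw [IsUnitPoint, F.mem_points_iff, F.mem_points_iff]
  exact ⟨fun h => h.1, fun h => ⟨h, F.inv_mem_submodule h w.mul_inv⟩⟩

/-- The normal form of a unit, as a unit. -/
def normalUnit {K : Type u} [Field K] [Algebra k K] (μ : (Fin d → PowerSeries K)ˣ) :
    (Fin d → PowerSeries K)ˣ :=
  (F.isUnit_normalForm μ.isUnit).unit

/-- Modulo `t^M` this quotient is the factor from `O` that brings `μ` into normal form. -/
theorem isUnitPoint_inv_mul_normalUnit {K : Type u} [Field K] [Algebra k K]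
    (μ : (Fin d → PowerSeries K)ˣ) : IsUnitPoint O (μ⁻¹ * F.normalUnit μ) := by
  rw [F.isUnitPoint_iff]
  refine F.mem_submodule_of_truncEq ?_ (F.lift_mem (F.sol (μ : Fin d → PowerSeries K)))
  have h := (TruncEq.refl F.M ((μ⁻¹ : (Fin d → PowerSeries K)ˣ) : Fin d → PowerSeries K)).mul
    (F.truncEq_normalForm (μ : Fin d → PowerSeries K))
  rwa [← mul_assoc, Units.inv_mul, one_mul] at h

/-- The normal form of the universal unit. -/
def univNormalForm : Fin d → PowerSeries (jacRing O) :=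
  tupleMk fun s => ⟨tupleCoeff s (F.normalForm (univUnit k d)), fun K _ _ μ w hw => by
    have h : ∀ ν : (Fin d → PowerSeries K)ˣ, evalUnit (k := k) ν
        (tupleCoeff s (F.normalForm (univUnit k d))) =
          tupleCoeff s (F.normalForm (ν : Fin d → PowerSeries K)) := fun ν => by
      conv_rhs => rw [← tupleMap_evalUnit (k := k) ν, F.normalForm_tupleMap _ isUnit_univUnit,
        tupleCoeff_tupleMap]
      rfl
    rw [h, h, Units.val_mul, F.normalForm_mul μ.isUnit w.isUnit (F.isUnitPoint_iff.1 hw)]⟩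

theorem tupleMap_val_univNormalForm : tupleMap ((jacRing O).val : jacRing O →+* UnitRing k d)
    F.univNormalForm = F.normalForm (univUnit k d) :=
  tuple_ext fun s => by
    rw [tupleCoeff_tupleMap, univNormalForm, tupleCoeff_tupleMk]
    rfl

theorem tupleMap_univNormalForm {K : Type u} [Field K] [Algebra k K]
    (μ : (Fin d → PowerSeries K)ˣ) :
    tupleMap (((evalUnit (k := k) μ).comp (jacRing O).val : jacRing O →ₐ[k] K) : jacRing O →+* K)
      F.univNormalForm = F.normalForm (μ : Fin d → PowerSeries K) := by
  conv_rhs => rw [← tupleMap_evalUnit (k := k) μ, F.normalForm_tupleMap _ isUnit_univUnit,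
    ← F.tupleMap_val_univNormalForm]
  rfl

/-- The inverse of an invariant function is again invariant. -/
theorem _root_.CurveZeta.isUnit_of_isUnit_val {f : jacRing O} (hf : IsUnit (f : UnitRing k d)) :
    IsUnit f := by
  obtain ⟨g, hg⟩ := isUnit_iff_exists_inv.1 hf
  refine isUnit_iff_exists_inv.2 ⟨⟨g, fun K _ _ μ w hw => ?_⟩, Subtype.ext hg⟩
  have h1 := congrArg (evalUnit (k := k) (μ * w)) hg
  have h2 := congrArg (evalUnit (k := k) μ) hg
  rw [map_mul, map_one] at h1 h2
  rw [f.2 K μ w hw] at h1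
  exact mul_left_cancel₀ (left_ne_zero_of_mul_eq_one h1) (h1.trans h2.symm)

theorem isUnit_univNormalForm : IsUnit F.univNormalForm :=
  isUnit_tuple_iff.2 fun i => isUnit_of_isUnit_val (by
    have := isUnit_tuple_iff.1 (F.isUnit_normalForm (isUnit_univUnit (k := k) (d := d))) i
    rw [← F.tupleMap_val_univNormalForm, tupleCoeff_tupleMap] at this
    exact this)

/-- The retraction of the regular functions on the units of the normalization to those
invariant under the units of `O`. -/
def retraction : UnitRing k d →ₐ[k] jacRing O :=
  IsLocalization.liftAlgHom (M := Submonoid.powers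
      (∏ i : Fin d, (MvPolynomial.X (i, 0) : MvPolynomial (Fin d × ℕ) k)))
    (f := MvPolynomial.aeval (R := k) fun s : Fin d × ℕ => tupleCoeff s F.univNormalForm)
    (by
      rintro ⟨_, m, rfl⟩
      rw [map_pow, map_prod]
      refine IsUnit.pow m (IsUnit.prod_univ_iff.2 fun i => ?_)
      rw [MvPolynomial.aeval_X]
      exact isUnit_tuple_iff.1 F.isUnit_univNormalForm i)

theorem retraction_algebraMap (p : MvPolynomial (Fin d × ℕ) k) :
    F.retraction (algebraMap _ (UnitRing k d) p) =
      MvPolynomial.aeval (fun s : Fin d × ℕ => tupleCoeff s F.univNormalForm) p := by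
  rw [retraction, IsLocalization.liftAlgHom_apply, IsLocalization.lift_eq]
  rfl

theorem tupleMap_retraction : tupleMap (F.retraction : UnitRing k d →+* jacRing O)
    (univUnit k d) = F.univNormalForm :=
  tuple_ext fun s => by
    rw [tupleCoeff_tupleMap, univUnit, tupleCoeff_tupleMk]
    change F.retraction _ = _
    rw [retraction_algebraMap, MvPolynomial.aeval_X]

/-- Retracting and then evaluating at `μ` is evaluating at the normal form of `μ`. The latter
differs from `μ` by a unit of `O`, which invariant functions do not see. -/
theorem retraction_coe (f : jacRing O) : F.retraction (f : UnitRing k d) = f := by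
  refine Subtype.ext (unitRing_ext fun K _ _ μ => ?_)
  have h : ((evalUnit (k := k) μ).comp (jacRing O).val).comp F.retraction =
      evalUnit (k := k) (F.normalUnit μ) := by
    refine unitRing_algHom_ext ?_
    rw [tupleMap_evalUnit]
    change _ = F.normalForm (μ : Fin d → PowerSeries K)
    rw [← F.tupleMap_univNormalForm μ, ← F.tupleMap_retraction]
    rfl
  have h1 := AlgHom.congr_fun h (f : UnitRing k d)
  have h2 := f.2 K μ _ (F.isUnitPoint_inv_mul_normalUnit μ)
  rw [mul_inv_cancel_left] at h2
  exact h1.trans h2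

/-- The retraction is a section of the quotient map, so every point of `J` lifts to a unit without
extending the field. -/
theorem exists_evalUnit_comp_val_eq (F : Frame O) {K : Type u} [Field K] [Algebra k K]
    (χ : jacRing O →ₐ[k] K) :
    ∃ μ : (Fin d → PowerSeries K)ˣ, (evalUnit (k := k) μ).comp (jacRing O).val = χ := by
  obtain ⟨μ, hμ⟩ := exists_evalUnit_eq (χ.comp F.retraction)
  refine ⟨μ, AlgHom.ext fun f => ?_⟩
  rw [hμ]
  exact congrArg χ (F.retraction_coe f)

/-- The coordinate ring of the quotient group is generated by the coefficients of the normal form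
of the universal unit and the inverses of its constant coefficients. -/
theorem subalgebra_eq_top {A : Subalgebra k (jacRing O)}
    (h : ∀ s : Fin d × ℕ, s.2 < F.M → tupleCoeff s F.univNormalForm ∈ A)
    (h' : ∀ i, ∃ v ∈ A, tupleCoeff (i, 0) F.univNormalForm * v = 1) : A = ⊤ := by
  rw [eq_top_iff]
  rintro f -
  have hs : ∀ s : Fin d × ℕ, tupleCoeff s F.univNormalForm ∈ A := fun s => by
    by_cases hs : s.2 < F.M
    · exact h s hs
    · have : tupleCoeff s F.univNormalForm = 0 := Subtype.ext (by
        simp [univNormalForm, normalForm, tupleTrunc, hs])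
      rw [this]
      exact A.zero_mem
  choose v hv hv' using h'
  obtain ⟨⟨p, g, n, rfl⟩, hp⟩ := IsLocalization.surj (Submonoid.powers
    (∏ i : Fin d, (MvPolynomial.X (i, 0) : MvPolynomial (Fin d × ℕ) k))) (f : UnitRing k d)
  have hpA : F.retraction (algebraMap _ (UnitRing k d) p) ∈ A := by
    rw [retraction_algebraMap]
    have h1 : Algebra.adjoin k (Set.range fun s : Fin d × ℕ => tupleCoeff s F.univNormalForm) ≤ A :=
      Algebra.adjoin_le (by rintro _ ⟨s, rfl⟩; exact hs s)
    rw [Algebra.adjoin_range_eq_range_aeval] at h1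
    exact h1 ⟨p, rfl⟩
  have h1 := congrArg F.retraction hp
  rw [map_mul, retraction_coe, retraction_algebraMap] at h1
  simp only [map_pow, map_prod, MvPolynomial.aeval_X] at h1
  have h2 : f = F.retraction (algebraMap _ (UnitRing k d) p) * (∏ i, v i) ^ n := by
    rw [← h1, mul_assoc, ← mul_pow, ← Finset.prod_mul_distrib]
    simp [hv']
  rw [h2]
  exact A.mul_mem hpA (A.pow_mem (A.prod_mem fun i _ => hv i) n)

theorem finiteType_jacRing (F : Frame O) : Algebra.FiniteType k (jacRing O) := by
  choose v hv using fun i => isUnit_iff_exists_inv.1 (isUnit_tuple_iff.1 F.isUnit_univNormalForm i)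
  let s : Set (jacRing O) := (fun s => tupleCoeff s F.univNormalForm) ''
    (Set.univ ×ˢ Set.Iio F.M) ∪ Set.range v
  have hs : s.Finite :=
    ((Set.finite_univ.prod (Set.finite_Iio F.M)).image _).union (Set.finite_range v)
  refine ⟨⟨hs.toFinset, ?_⟩⟩
  rw [hs.coe_toFinset]
  exact F.subalgebra_eq_top
    (fun e he => Algebra.subset_adjoin (Or.inl ⟨e, ⟨trivial, he⟩, rfl⟩))
    (fun i => ⟨v i, Algebra.subset_adjoin (Or.inr ⟨i, rfl⟩), hv i⟩)

/-! ### The set of ideals with given value -/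

section Equation

variable {R S : Type*} [CommRing R] [Algebra k R] [CommRing S] [Algebra k S]

/-- The equation for `O` that expresses the coefficient with index `s` by the free ones. -/
def equation (z : Fin d → PowerSeries R) (s : Fin d × ℕ) : R :=
  tupleCoeff s z - ∑ e : F.E, algebraMap k R (tupleCoeff s (F.basis e)) * tupleCoeff e.1 z

theorem mem_submodule_iff {z : Fin d → PowerSeries R} :
    z ∈ F.submodule R ↔ ∀ s : Fin d × ℕ, s.2 < F.M → F.equation z s = 0 := by
  simp only [mem_submodule, TruncEq, tupleCoeff_lift, equation, sub_eq_zero]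

theorem equation_tupleMap (φ : R →ₐ[k] S) (z : Fin d → PowerSeries R) (s : Fin d × ℕ) :
    F.equation (tupleMap (φ : R →+* S) z) s = φ (F.equation z s) := by
  simp [equation]

variable (R) in
/-- The tuple `t ^ n` over a ring. -/
def _root_.CurveZeta.tupleXPow (n : Fin d →₀ ℕ) : Fin d → PowerSeries R :=
  fun i => PowerSeries.X ^ n i

theorem _root_.CurveZeta.tupleMap_tupleXPow (φ : R →+* S) (n : Fin d →₀ ℕ) :
    tupleMap φ (tupleXPow R n) = tupleXPow S n :=
  funext fun i => by simp [tupleMap, tupleXPow]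

end Equation

/-- An ideal with one generator in `O` lies in `O`, hence so does every other generator. -/
theorem principal_mem_idealSet {n : Fin d →₀ ℕ} {K : Type u} [Field K] [Algebra k K]
    (μ : (Fin d → PowerSeries K)ˣ) :
    principal O (tPow K n * (μ : Fin d → PowerSeries K)) ∈ idealSet O n K ↔
      tPow K n * (μ : Fin d → PowerSeries K) ∈ F.submodule K := by
  constructor
  · rintro ⟨z, hz, -, h⟩
    have h1 : tPow K n * (μ : Fin d → PowerSeries K) ∈
        principal O (tPow K n * (μ : Fin d → PowerSeries K)) :=
      ⟨1, F.mem_points_iff.2 F.one_mem_submodule, (mul_one _).symm⟩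
    rw [h] at h1
    obtain ⟨w, hw, hzw⟩ := h1
    rw [hzw]
    exact F.mul_mem_submodule (F.mem_points_iff.1 hz) (F.mem_points_iff.1 hw)
  · intro h
    refine ⟨_, F.mem_points_iff.2 h, fun i => ?_, rfl⟩
    rw [Pi.mul_apply, PowerSeries.order_mul, tPow, PowerSeries.order_X_pow,
      PowerSeries.order_zero_of_unit (Pi.isUnit_iff.1 μ.isUnit i), add_zero]

theorem mul_normalForm_mem_submodule {n : Fin d →₀ ℕ} {K : Type u} [Field K] [Algebra k K]
    (μ : (Fin d → PowerSeries K)ˣ) :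
    tPow K n * F.normalForm (μ : Fin d → PowerSeries K) ∈ F.submodule K ↔
      tPow K n * (μ : Fin d → PowerSeries K) ∈ F.submodule K := by
  have hw := F.isUnitPoint_inv_mul_normalUnit μ
  set w := μ⁻¹ * F.normalUnit μ with hw'
  have h1 : F.normalForm (μ : Fin d → PowerSeries K) = μ * (w : Fin d → PowerSeries K) := by
    rw [← Units.val_mul, hw', mul_inv_cancel_left]
    rfl
  have h2 : (w : Fin d → PowerSeries K) ∈ F.submodule K := F.isUnitPoint_iff.1 hw
  rw [h1, ← mul_assoc]
  refine ⟨fun h => ?_, fun h => F.mul_mem_submodule h h2⟩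
  have h3 := F.mul_mem_submodule h (F.inv_mem_submodule h2 w.mul_inv)
  rwa [mul_assoc, Units.mul_inv, mul_one] at h3

/-- The condition says that certain invariant functions belong to the prime of the point, so it is
independent of the field and of the unit chosen to represent that point. -/
theorem jacPoint_mem_sigmaIdeals {n : Fin d →₀ ℕ} {K : Type u} [Field K] [Algebra k K]
    (μ : (Fin d → PowerSeries K)ˣ) : jacPoint O μ ∈ sigmaIdeals O n ↔
      tPow K n * F.normalForm (μ : Fin d → PowerSeries K) ∈ F.submodule K := by
  have key : ∀ (L : Type u) [Field L] [Algebra k L] (ν : (Fin d → PowerSeries L)ˣ),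
      tPow L n * F.normalForm (ν : Fin d → PowerSeries L) ∈ F.submodule L ↔
      ∀ s : Fin d × ℕ, s.2 < F.M → F.equation (tupleXPow _ n * F.univNormalForm) s ∈
        PrimeSpectrum.asIdeal (jacPoint O ν : PrimeSpectrum (jacRing O)) := fun L _ _ ν => by
    rw [mem_submodule_iff]
    refine forall₂_congr fun s _ => ?_
    change _ ↔ ((evalUnit (k := k) ν).comp (jacRing O).val) _ = 0
    rw [← equation_tupleMap, map_mul, tupleMap_tupleXPow, F.tupleMap_univNormalForm ν]
    rfl
  rw [key]
  constructor
  · rintro ⟨L, _, _, ν, hν, h⟩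
    rw [h, ← key]
    exact (F.mul_normalForm_mem_submodule ν).2 ((F.principal_mem_idealSet ν).1 hν)
  · intro h
    rw [← key] at h
    exact ⟨K, _, _, μ, (F.principal_mem_idealSet μ).2 ((F.mul_normalForm_mem_submodule μ).1 h), rfl⟩

theorem exists_eq_jacPoint (F : Frame O) (x : (jac O).left) : ∃ (K : Type u) (_ : Field K) (_ : Algebra k K)
    (μ : (Fin d → PowerSeries K)ˣ), x = jacPoint O μ := by
  obtain ⟨K, _, _, χ, rfl⟩ := exists_eq_specPoint x
  obtain ⟨μ, rfl⟩ := F.exists_evalUnit_comp_val_eq χ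
  exact ⟨K, _, _, μ, rfl⟩

/-- It is the zero locus of the equations of `O` applied to `t^n` times the universal normal form.
-/
theorem isClosed_sigmaIdeals (F : Frame O) (n : Fin d →₀ ℕ) : IsClosed (sigmaIdeals O n) := by
  have : sigmaIdeals O n = (PrimeSpectrum.zeroLocus
      ((fun s => F.equation (tupleXPow _ n * F.univNormalForm) s) '' {s | s.2 < F.M}) :
      Set (PrimeSpectrum (jacRing O))) := by
    ext x
    obtain ⟨K, _, _, μ, rfl⟩ := F.exists_eq_jacPoint x
    rw [jacPoint_mem_sigmaIdeals, mem_submodule_iff]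
    constructor
    · rintro h _ ⟨s, hs, rfl⟩
      change ((evalUnit (k := k) μ).comp (jacRing O).val) _ = 0
      rw [← equation_tupleMap, map_mul, tupleMap_tupleXPow, F.tupleMap_univNormalForm μ]
      exact h s hs
    · intro h s hs
      have h1 : ((evalUnit (k := k) μ).comp (jacRing O).val) _ = 0 := h ⟨s, hs, rfl⟩
      rw [← equation_tupleMap, map_mul, tupleMap_tupleXPow, F.tupleMap_univNormalForm μ] at h1
      exact h1
  rw [this]
  exact PrimeSpectrum.isClosed_zeroLocus _

theorem exists_hasClass_sigmaIdeals (F : Frame O) (n : Fin d →₀ ℕ) : ∃ x, HasClass (jac O) (sigmaIdeals O n) x := by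
  have := F.finiteType_jacRing
  exact exists_hasClass_of_isClosed (Variety.spec k (jacRing O)) (F.isClosed_sigmaIdeals n)

end Frame

/-! ### Multiplication by `t^n`, and a criterion for immersions of spectra. -/

theorem tupleCoeff_tupleXPow_mul {R : Type*} [CommRing R] {d : ℕ} (n : Fin d →₀ ℕ)
    (z : Fin d → PowerSeries R) (s : Fin d × ℕ) : tupleCoeff s (tupleXPow R n * z) =
      if n s.1 ≤ s.2 then tupleCoeff (s.1, s.2 - n s.1) z else 0 :=
  PowerSeries.coeff_X_pow_mul' _ _ _

theorem isImmersion_spec_of_surjective {A B : CommRingCat.{u}} (f : A ⟶ B)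
    (hf : Function.Surjective f.hom) : IsImmersion (Spec.map f) :=
  have := IsClosedImmersion.spec_of_surjective f hf
  inferInstance

theorem jet_apply {K : Type*} [Field K] {d : ℕ} (n : Fin d →₀ ℕ) (z : Fin d → PowerSeries K)
    (q : JetIndex n) : jet n z q = tupleCoeff q.1 z := rfl

/-- The map of spectra induced by `f : A → B` is an immersion if `f` induces a surjection from a
localization of `A` away from one element. -/
theorem isImmersion_specMap {k A B : Type u} [Field k] [CommRing A] [CommRing B] [Algebra k A]
    [Algebra k B] (f : A →ₐ[k] B) (g : A) (hg : IsUnit (f g))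
    (h : ∀ b, ∃ a n, f a = b * f g ^ n) : IsImmersion (specMap f).left := by
  let φ : Localization.Away g →+* B := IsLocalization.Away.lift g (g := f.toRingHom) hg
  have hφ : Function.Surjective φ := fun b => by
    obtain ⟨a, n, hab⟩ := h b
    refine ⟨IsLocalization.mk' _ a (⟨g ^ n, n, rfl⟩ : Submonoid.powers g), ?_⟩
    refine (IsLocalization.lift_mk'_spec _ _ _ _).2 ?_
    change f a = f (g ^ n) * b
    rw [hab, map_pow, mul_comm]
  have h1 : (specMap f).left = Spec.map (CommRingCat.ofHom φ) ≫
      Spec.map (CommRingCat.ofHom (algebraMap A (Localization.Away g))) := by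
    rw [← Spec.map_comp, ← CommRingCat.ofHom_comp, IsLocalization.Away.lift_comp]
    rfl
  have h2 := isImmersion_spec_of_surjective (CommRingCat.ofHom φ) hφ
  rw [h1]
  have h3 : IsOpenImmersion (Spec.map (CommRingCat.ofHom (algebraMap A (Localization.Away g)))) :=
    inferInstance
  have h4 : IsImmersion (Spec.map (CommRingCat.ofHom (algebraMap A (Localization.Away g)))) :=
    inferInstance
  exact @IsImmersion.comp _ _ _ _ _ h2 h4

namespace Frame

variable {k : Type u} [Field k] {d : ℕ} {O : Subalgebra k (Fin d → PowerSeries k)} (F : Frame O)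

/-! ### The units of the normalization as an affine space bundle over the quotient group -/

/-- The free coefficients other than the constant one. -/
abbrev FibreIndex : Type := {e : F.E // e ≠ F.e₀}

theorem card_fibreIndex : Nat.card F.FibreIndex + 1 = F.E.card := by
  rw [Nat.card_eq_fintype_card, Fintype.card_subtype_compl, Fintype.card_subtype_eq,
    Fintype.card_coe]
  have : 0 < F.E.card := Finset.card_pos.2 ⟨_, F.e₀.2⟩
  omega

/-- The coordinate ring of the units of the normalization modulo `t ^ M` with leading
coefficient `1`. -/
def BundleRing : Type u := MvPolynomial F.FibreIndex (jacRing O)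

instance : CommRing F.BundleRing := inferInstanceAs (CommRing (MvPolynomial F.FibreIndex (jacRing O)))

instance : Algebra k F.BundleRing :=
  inferInstanceAs (Algebra k (MvPolynomial F.FibreIndex (jacRing O)))

instance : Algebra (jacRing O) F.BundleRing :=
  inferInstanceAs (Algebra (jacRing O) (MvPolynomial F.FibreIndex (jacRing O)))

instance : IsScalarTower k (jacRing O) F.BundleRing :=
  inferInstanceAs (IsScalarTower k (jacRing O) (MvPolynomial F.FibreIndex (jacRing O)))

/-- The coordinates on the fibres of the bundle. -/
def fibreX (e : F.FibreIndex) : F.BundleRing :=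
  (MvPolynomial.X e : MvPolynomial F.FibreIndex (jacRing O))

/-- The free coefficients of the universal element of `O` with constant coefficient `1`. -/
def fibreCoeff (e : F.E) : F.BundleRing :=
  if h : e = F.e₀ then 1 else F.fibreX ⟨e, h⟩

theorem isUnit_lift_fibreCoeff : IsUnit (F.lift F.fibreCoeff) :=
  isUnit_tuple_iff.2 fun i => by
    rw [tupleCoeff_lift_zero, fibreCoeff, dif_pos rfl]
    exact isUnit_one

/-- The normal form of the universal unit, over the bundle. -/
def bundleNormalForm : Fin d → PowerSeries F.BundleRing :=
  tupleMap (algebraMap (jacRing O) F.BundleRing) F.univNormalForm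

/-- The universal unit with leading coefficient `1`. -/
def bundleUnit : Fin d → PowerSeries F.BundleRing :=
  F.bundleNormalForm * (F.isUnit_lift_fibreCoeff.unit⁻¹ : (Fin d → PowerSeries F.BundleRing)ˣ)

theorem bundleUnit_mul : F.bundleUnit * F.lift F.fibreCoeff = F.bundleNormalForm := by
  rw [bundleUnit, mul_assoc, IsUnit.val_inv_mul, mul_one]

theorem isUnit_bundleUnit : IsUnit F.bundleUnit :=
  (F.isUnit_univNormalForm.map _).mul (Units.isUnit _)

theorem tupleCoeff_univNormalForm (e : F.E) :
    tupleCoeff e.1 F.univNormalForm = if e = F.e₀ then 1 else 0 := by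
  refine Subtype.ext ?_
  have h := F.tupleCoeff_normalForm (isUnit_univUnit (k := k) (d := d)) e
  rw [← F.tupleMap_val_univNormalForm, tupleCoeff_tupleMap] at h
  refine Eq.trans h ?_
  split_ifs <;> rfl

theorem tupleCoeff_bundleNormalForm (e : F.E) :
    tupleCoeff e.1 F.bundleNormalForm = if e = F.e₀ then 1 else 0 := by
  rw [bundleNormalForm, tupleCoeff_tupleMap, tupleCoeff_univNormalForm]
  split_ifs <;> simp

theorem tupleCoeff_zero_bundleUnit (i : Fin d) :
    tupleCoeff (i, 0) F.bundleUnit = tupleCoeff (i, 0) F.bundleNormalForm := by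
  rw [← F.bundleUnit_mul, tupleCoeff_zero_mul, tupleCoeff_lift_zero, fibreCoeff, dif_pos rfl,
    mul_one]

theorem tupleCoeff_e₀_bundleUnit : tupleCoeff (F.e₀.1.1, 0) F.bundleUnit = 1 := by
  rw [tupleCoeff_zero_bundleUnit, ← tupleCoeff_e₀, tupleCoeff_bundleNormalForm, if_pos rfl]

/-- The universal unit is the normal form divided by the universal element of `O` with constant
coefficient `1`, so that element normalizes it. Hence the fibre coordinates can be recovered from
the unit. -/
theorem sol_bundleUnit : F.sol F.bundleUnit = F.fibreCoeff :=
  (F.eq_sol F.isUnit_bundleUnit fun e => by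
    rw [bundleUnit_mul, tupleCoeff_bundleNormalForm]).symm

theorem truncEq_normalForm_bundleUnit :
    TruncEq F.M (F.normalForm F.bundleUnit) F.bundleNormalForm := by
  have := F.truncEq_normalForm F.bundleUnit
  rwa [sol_bundleUnit, bundleUnit_mul] at this

theorem normalForm_congr {R : Type*} [CommRing R] [Algebra k R] {y z : Fin d → PowerSeries R}
    (h : TruncEq F.M y z) : F.normalForm y = F.normalForm z := by
  rw [normalForm, normalForm, F.sol_congr h]
  exact (h.mul (TruncEq.refl _ _)).tupleTrunc_eq

/-- The coordinate ring of the bundle is generated by the coefficients of the universal unit and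
the inverses of the constant ones. -/
theorem bundle_subalgebra_eq_top {A : Subalgebra k F.BundleRing}
    (h : ∀ s : Fin d × ℕ, s.2 < F.M → tupleCoeff s F.bundleUnit ∈ A)
    (h' : ∀ i, ∃ v ∈ A, tupleCoeff (i, 0) F.bundleUnit * v = 1) : A = ⊤ := by
  let y : Fin d → PowerSeries A := tupleMk fun s =>
    if hs : s.2 < F.M then ⟨tupleCoeff s F.bundleUnit, h s hs⟩ else 0
  have hy : TruncEq F.M (tupleMap (A.val : A →+* F.BundleRing) y) F.bundleUnit := fun s hs => by
    rw [tupleCoeff_tupleMap, tupleCoeff_tupleMk, dif_pos hs]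
    rfl
  have hyu : IsUnit y := isUnit_tuple_iff.2 fun i => by
    obtain ⟨v, hv, hv'⟩ := h' i
    refine isUnit_iff_exists_inv.2 ⟨⟨v, hv⟩, Subtype.ext ?_⟩
    rw [tupleCoeff_tupleMk, dif_pos F.M_pos]
    exact hv'
  -- `y` is the universal unit modulo `t^M` with coefficients in `A`. Solving for its normal form
  -- over `A` shows that the fibre coordinates, and then the coefficients of the normal form, lie in
  -- `A`.
  have hc : ∀ e, F.fibreCoeff e ∈ A := fun e => by
    rw [← sol_bundleUnit, ← F.sol_congr hy, F.sol_tupleMap A.val hyu]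
    exact (F.sol y e).2
  have hs : ∀ s : Fin d × ℕ, s.2 < F.M → tupleCoeff s F.bundleNormalForm ∈ A := fun s hs => by
    rw [← F.truncEq_normalForm_bundleUnit s hs, ← F.normalForm_congr hy,
      F.normalForm_tupleMap A.val hyu, tupleCoeff_tupleMap]
    exact (tupleCoeff s (F.normalForm y)).2
  have hJ : A.comap (IsScalarTower.toAlgHom k (jacRing O) F.BundleRing) = ⊤ := by
    refine F.subalgebra_eq_top (fun s hs' => ?_) fun i => ?_
    · have := hs s hs'
      rwa [bundleNormalForm, tupleCoeff_tupleMap] at this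
    · obtain ⟨u, hu⟩ := isUnit_iff_exists_inv.1 (isUnit_tuple_iff.1 F.isUnit_univNormalForm i)
      obtain ⟨v, hv, hv'⟩ := h' i
      refine ⟨u, ?_, hu⟩
      have hu' := congrArg (algebraMap (jacRing O) F.BundleRing) hu
      rw [map_mul, map_one, ← tupleCoeff_tupleMap] at hu'
      change _ * _ = _ at hu'
      rw [tupleCoeff_zero_bundleUnit] at hv'
      have : algebraMap (jacRing O) F.BundleRing u = v :=
        (left_inv_eq_right_inv ((mul_comm _ _).trans hu') hv')
      change algebraMap (jacRing O) F.BundleRing u ∈ A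
      rwa [this]
  rw [eq_top_iff]
  rintro (f : MvPolynomial F.FibreIndex (jacRing O)) -
  change (f : F.BundleRing) ∈ A
  induction f using MvPolynomial.induction_on with
  | C a => exact (hJ ▸ Algebra.mem_top : a ∈ A.comap (IsScalarTower.toAlgHom k (jacRing O) F.BundleRing))
  | add p q hp hq => exact A.add_mem hp hq
  | mul_X p e hp =>
    refine A.mul_mem hp ?_
    have := hc e.1
    rwa [fibreCoeff, dif_neg e.2] at this

/-! ### The parametrization of the elements with given value -/

/-- The order up to which the coefficients of an element with value `n` are considered. -/
def jetOrder (n : Fin d →₀ ℕ) : Fin d →₀ ℕ :=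
  n + Finsupp.equivFunOnFinite.symm fun _ => F.M - 1

theorem jetOrder_apply (n : Fin d →₀ ℕ) (i : Fin d) : F.jetOrder n i = n i + (F.M - 1) := rfl

theorem nrmSucc_jetOrder (n : Fin d →₀ ℕ) : nrmSucc (F.jetOrder n) = nrm n + d * F.M := by
  have : ∀ i, F.jetOrder n i + 1 = n i + F.M := fun i => by
    have := F.M_pos
    rw [jetOrder_apply]
    omega
  simp [nrmSucc, nrm, this, Finset.sum_add_distrib]

/-- The index of the leading coefficient in branch `i`. -/
def leadIndex (n : Fin d →₀ ℕ) (i : Fin d) : JetIndex (F.jetOrder n) :=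
  ⟨(i, n i), Nat.le_add_right _ _⟩

/-- The index of the coefficient that is normalized to be `1`. -/
abbrev baseIndex (n : Fin d →₀ ℕ) : JetIndex (F.jetOrder n) := F.leadIndex n F.e₀.1.1

/-- The coordinates of the jet of the universal element with value `n`. -/
def chartHom (n : Fin d →₀ ℕ) :
    MvPolynomial {q : JetIndex (F.jetOrder n) // q ≠ F.baseIndex n} k →ₐ[k] F.BundleRing :=
  MvPolynomial.aeval fun q => tupleCoeff q.1.1 (tupleXPow _ n * F.bundleUnit)

open Classical in
/-- The coordinates on the chart. -/
def chartCoord (n : Fin d →₀ ℕ) (q : JetIndex (F.jetOrder n)) :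
    MvPolynomial {q : JetIndex (F.jetOrder n) // q ≠ F.baseIndex n} k :=
  if h : q = F.baseIndex n then 1 else MvPolynomial.X ⟨q, h⟩

theorem tupleCoeff_baseIndex (n : Fin d →₀ ℕ) :
    tupleCoeff (F.baseIndex n).1 (tupleXPow _ n * F.bundleUnit) = 1 := by
  rw [tupleCoeff_tupleXPow_mul]
  simp [leadIndex, tupleCoeff_e₀_bundleUnit]

theorem chartHom_chartCoord (n : Fin d →₀ ℕ) (q : JetIndex (F.jetOrder n)) :
    F.chartHom n (F.chartCoord n q) = tupleCoeff q.1 (tupleXPow _ n * F.bundleUnit) := by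
  rw [chartCoord]
  split_ifs with h
  · rw [h, map_one, tupleCoeff_baseIndex]
  · rw [chartHom, MvPolynomial.aeval_X]

theorem chartHom_leadIndex (n : Fin d →₀ ℕ) (i : Fin d) :
    F.chartHom n (F.chartCoord n (F.leadIndex n i)) = tupleCoeff (i, 0) F.bundleUnit := by
  rw [chartHom_chartCoord, tupleCoeff_tupleXPow_mul]
  simp [leadIndex]

/-- After inverting the product `g` of the leading coordinates, the image contains all coefficients
of the universal unit below `t^M` and the inverses of its constant ones, which generate the ring. -/
theorem isImmersion_chartHom (n : Fin d →₀ ℕ) : IsImmersion (specMap (F.chartHom n)).left := by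
  let g := ∏ i, F.chartCoord n (F.leadIndex n i)
  have hg : F.chartHom n g = ∏ i, tupleCoeff (i, 0) F.bundleUnit := by
    simp only [g, map_prod, chartHom_leadIndex]
  have hgu : IsUnit (F.chartHom n g) := by
    rw [hg, IsUnit.prod_univ_iff]
    exact isUnit_tuple_iff.1 F.isUnit_bundleUnit
  -- `A` is the image of the localization away from `g`.
  let A : Subalgebra k F.BundleRing :=
    { carrier := {b | ∃ a m, F.chartHom n a = b * F.chartHom n g ^ m}
      mul_mem' := by
        rintro b b' ⟨a, m, h⟩ ⟨a', m', h'⟩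
        exact ⟨a * a', m + m', by rw [map_mul, h, h']; ring⟩
      add_mem' := by
        rintro b b' ⟨a, m, h⟩ ⟨a', m', h'⟩
        exact ⟨a * g ^ m' + a' * g ^ m, m + m', by
          rw [map_add, map_mul, map_mul, map_pow, map_pow, h, h']; ring⟩
      algebraMap_mem' := fun c => ⟨algebraMap _ _ c, 0, by simp⟩ }
  have hA : ∀ a, F.chartHom n a ∈ A := fun a => ⟨a, 0, by simp⟩
  have htop : A = ⊤ := by
    refine F.bundle_subalgebra_eq_top (fun s hs => ?_) fun i => ?_
    · have := hA (F.chartCoord n ⟨(s.1, n s.1 + s.2), by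
        rw [jetOrder_apply]
        exact Nat.add_le_add_left (Nat.le_sub_one_of_lt hs) _⟩)
      rw [chartHom_chartCoord, tupleCoeff_tupleXPow_mul] at this
      simpa using this
    · obtain ⟨v, hv⟩ := isUnit_iff_exists_inv.1 hgu
      refine ⟨F.chartHom n (∏ j ∈ Finset.univ.erase i, F.chartCoord n (F.leadIndex n j)) * v,
        A.mul_mem (hA _) ⟨1, 1, ?_⟩, ?_⟩
      · rw [map_one, pow_one, mul_comm, hv]
      · rw [← chartHom_leadIndex, ← mul_assoc, ← map_mul, Finset.mul_prod_erase _
          (fun j => F.chartCoord n (F.leadIndex n j)) (Finset.mem_univ i)]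
        exact hv
  exact isImmersion_specMap _ g hgu fun b => (htop ▸ Algebra.mem_top : b ∈ A)

/-- The parametrization of the jets of elements with value `n`. -/
def chart (n : Fin d →₀ ℕ) :
    specOver k F.BundleRing ⟶ projSpace k (JetIndex (F.jetOrder n)) :=
  specMap (F.chartHom n) ≫ projChart k (F.baseIndex n)

instance (n : Fin d →₀ ℕ) : IsImmersion (F.chart n).left := by
  have := F.isImmersion_chartHom n
  rw [chart, Over.comp_left]
  exact IsImmersion.comp _ _

theorem jet_chart_ne_zero (n : Fin d →₀ ℕ) {K : Type u} [Field K] [Algebra k K]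
    (χ : F.BundleRing →ₐ[k] K) : jet (F.jetOrder n)
      (tupleXPow K n * tupleMap (χ : F.BundleRing →+* K) F.bundleUnit) ≠ 0 := fun h => by
  have h1 : tupleCoeff (F.baseIndex n).1
      (tupleXPow K n * tupleMap (χ : F.BundleRing →+* K) F.bundleUnit) = 0 :=
    congrFun h (F.baseIndex n)
  rw [← tupleMap_tupleXPow (χ : F.BundleRing →+* K), ← map_mul, tupleCoeff_tupleMap,
    tupleCoeff_baseIndex] at h1
  simp at h1

theorem chart_specPoint (n : Fin d →₀ ℕ) {K : Type u} [Field K] [Algebra k K]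
    (χ : F.BundleRing →ₐ[k] K) :
    (F.chart n).left (specPoint χ) = projPoint _ (F.jet_chart_ne_zero n χ) := by
  have h1 : ∀ q : JetIndex (F.jetOrder n), jet (F.jetOrder n)
      (tupleXPow K n * tupleMap (χ : F.BundleRing →+* K) F.bundleUnit) q =
        χ (tupleCoeff q.1 (tupleXPow _ n * F.bundleUnit)) := fun q => by
    rw [jet_apply, ← tupleMap_tupleXPow (χ : F.BundleRing →+* K), ← map_mul, tupleCoeff_tupleMap]
    rfl
  refine projChart_specPoint _ (χ.comp (F.chartHom n)) _ ?_ fun q => ?_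
  · rw [h1, tupleCoeff_baseIndex, map_one]
  · rw [h1, AlgHom.comp_apply, chartHom, MvPolynomial.aeval_X]

theorem specPoint_mem_sigmaIdeals (n : Fin d →₀ ℕ) {K : Type u} [Field K] [Algebra k K]
    (χ : jacRing O →ₐ[k] K) : (specPoint χ : (jac O).left) ∈ sigmaIdeals O n ↔
      tupleXPow K n * tupleMap (χ : jacRing O →+* K) F.univNormalForm ∈ F.submodule K := by
  obtain ⟨μ, rfl⟩ := F.exists_evalUnit_comp_val_eq χ
  rw [F.tupleMap_univNormalForm]
  exact F.jacPoint_mem_sigmaIdeals μ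

theorem mul_mem_submodule_iff {R : Type*} [CommRing R] [Algebra k R] {z w : Fin d → PowerSeries R}
    (hw : IsUnit w) (hw' : w ∈ F.submodule R) : z * w ∈ F.submodule R ↔ z ∈ F.submodule R := by
  refine ⟨fun h => ?_, fun h => F.mul_mem_submodule h hw'⟩
  obtain ⟨v, hv⟩ := isUnit_iff_exists_inv.1 hw
  have := F.mul_mem_submodule h (F.inv_mem_submodule hw' hv)
  rwa [mul_assoc, hv, mul_one] at this

/-- The projection of the bundle. -/
def bundleProj : specOver k F.BundleRing ⟶ jac O :=
  affineProj k (jacRing O) F.FibreIndex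

/-- The universal unit and the normal form differ by a unit satisfying the equations of `O`, so
`t^n` times either one satisfies them simultaneously. -/
theorem specPoint_mem_preimage_bundleProj (n : Fin d →₀ ℕ) {K : Type u} [Field K] [Algebra k K]
    (χ : F.BundleRing →ₐ[k] K) :
    specPoint χ ∈ F.bundleProj.left ⁻¹' (sigmaIdeals O n) ↔
      tupleXPow K n * tupleMap (χ : F.BundleRing →+* K) F.bundleUnit ∈ F.submodule K := by
  change (specPoint (χ.comp (IsScalarTower.toAlgHom k (jacRing O) F.BundleRing)) :
    (jac O).left) ∈ sigmaIdeals O n ↔ _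
  rw [specPoint_mem_sigmaIdeals]
  have h : tupleMap ((χ.comp (IsScalarTower.toAlgHom k (jacRing O) F.BundleRing) :
      jacRing O →ₐ[k] K) : jacRing O →+* K) F.univNormalForm =
      tupleMap (χ : F.BundleRing →+* K) F.bundleUnit * F.lift (χ ∘ F.fibreCoeff) := by
    rw [← F.tupleMap_lift χ, ← map_mul, bundleUnit_mul]
    rfl
  rw [h, ← mul_assoc, F.mul_mem_submodule_iff _ (F.lift_mem _)]
  rw [← F.tupleMap_lift χ]
  exact F.isUnit_lift_fibreCoeff.map _

/-- Every unit with leading coefficient `1` is, modulo `t ^ M`, a point of the bundle. -/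
theorem exists_truncEq_tupleMap_bundleUnit {K : Type u} [Field K] [Algebra k K]
    (μ : (Fin d → PowerSeries K)ˣ)
    (hμ : tupleCoeff (F.e₀.1.1, 0) (μ : Fin d → PowerSeries K) = 1) :
    ∃ χ : F.BundleRing →ₐ[k] K,
      TruncEq F.M (tupleMap (χ : F.BundleRing →+* K) F.bundleUnit) μ := by
  let χ₀ : jacRing O →ₐ[k] K := (evalUnit (k := k) μ).comp (jacRing O).val
  let χ : F.BundleRing →ₐ[k] K :=
    { MvPolynomial.eval₂Hom (χ₀ : jacRing O →+* K) fun e : F.FibreIndex =>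
        F.sol (μ : Fin d → PowerSeries K) e.1 with
      commutes' := fun c => by
        refine (MvPolynomial.eval₂_C _ _ (algebraMap k (jacRing O) c)).trans ?_
        exact χ₀.commutes c }
  have hχ : ∀ a, χ (algebraMap (jacRing O) F.BundleRing a) = χ₀ a := fun a =>
    MvPolynomial.eval₂_C _ _ _
  have hχX : χ ∘ F.fibreCoeff = F.sol (μ : Fin d → PowerSeries K) := by
    funext e
    rw [Function.comp_apply, fibreCoeff]
    split_ifs with h
    -- Leading coefficient `1` forces the normalizing factor to have constant coefficient `1`, the
    -- value fixed for `fibreCoeff` at `e₀`.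
    · have := F.tupleCoeff_mul_sol μ.isUnit
      rw [tupleCoeff_e₀, hμ, one_mul] at this
      rw [h, this, map_one]
    · exact MvPolynomial.eval₂_X _ _ _
  refine ⟨χ, ?_⟩
  obtain ⟨v, hv⟩ := isUnit_iff_exists_inv.1 (F.isUnit_lift_sol μ.isUnit)
  have h1 : tupleMap (χ : F.BundleRing →+* K) F.bundleUnit * F.lift (F.sol (μ : _ → PowerSeries K)) =
      F.normalForm (μ : Fin d → PowerSeries K) := by
    rw [← hχX, ← F.tupleMap_lift χ, ← map_mul, bundleUnit_mul, ← F.tupleMap_univNormalForm μ]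
    exact tuple_ext fun s => by
      rw [bundleNormalForm, tupleCoeff_tupleMap, tupleCoeff_tupleMap, tupleCoeff_tupleMap]
      exact hχ _
  have h2 := (h1 ▸ F.truncEq_normalForm (μ : Fin d → PowerSeries K)).mul (TruncEq.refl F.M v)
  rwa [mul_assoc, hv, mul_one, mul_assoc, hv, mul_one] at h2

/-! ### The jets of the elements with given value -/

/-- The linear form in the coefficients of jets that expresses the equation for `O` with
index `q`. -/
def equationForm (n : Fin d →₀ ℕ) (s : {s : Fin d × ℕ // s.2 < F.M}) :
    MvPolynomial (JetIndex (F.jetOrder n)) k :=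
  MvPolynomial.X ⟨s.1, (Nat.le_sub_one_of_lt s.2).trans (Nat.le_add_left _ _)⟩ -
    ∑ e : F.E, MvPolynomial.C (tupleCoeff s.1 (F.basis e)) *
      MvPolynomial.X ⟨e.1, (Nat.le_sub_one_of_lt (F.snd_lt e)).trans (Nat.le_add_left _ _)⟩

theorem isHomogeneous_equationForm (n : Fin d →₀ ℕ) (s : {s : Fin d × ℕ // s.2 < F.M}) :
    (F.equationForm n s).IsHomogeneous 1 := by
  refine (MvPolynomial.isHomogeneous_X _ _).sub (MvPolynomial.IsHomogeneous.sum _ _ _ fun e _ => ?_)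
  simpa using (MvPolynomial.isHomogeneous_C _ _).mul (MvPolynomial.isHomogeneous_X k _)

theorem aeval_jet_equationForm (n : Fin d →₀ ℕ) {K : Type u} [Field K] [Algebra k K]
    (z : Fin d → PowerSeries K) (s : {s : Fin d × ℕ // s.2 < F.M}) :
    MvPolynomial.aeval (jet (F.jetOrder n) z) (F.equationForm n s) = F.equation z s.1 := by
  simp [equationForm, equation, jet, tupleCoeff_apply]

/-- The jets of elements with value `n`. -/
def leadSet (n : Fin d →₀ ℕ) : Set (projSpace k (JetIndex (F.jetOrder n))).left :=
  {x | (∀ q : {q : JetIndex (F.jetOrder n) // q.1.2 < n q.1.1}, VanishesAt (MvPolynomial.X q.1) x) ∧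
    ∀ i, ¬ VanishesAt (MvPolynomial.X (F.leadIndex n i)) x}

/-- The jets of elements of `O` with value `n`. -/
def jetSet (n : Fin d →₀ ℕ) : Set (projSpace k (JetIndex (F.jetOrder n))).left :=
  F.leadSet n ∩ {x | ∀ s, VanishesAt (F.equationForm n s) x}

theorem _root_.CurveZeta.isOpen_not_vanishesAt {σ : Type} (f : MvPolynomial σ k) :
    IsOpen {x : (projSpace k σ).left | ¬ VanishesAt f x} :=
  (ProjectiveSpectrum.basicOpen (MvPolynomial.homogeneousSubmodule σ k) f).2

theorem _root_.CurveZeta.isConstructible_forall_vanishesAt {σ : Type} [Finite σ] {ι : Type*}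
    (f : ι → MvPolynomial σ k) :
    Topology.IsConstructible {x : (projSpace k σ).left | ∀ a, VanishesAt (f a) x} := by
  rw [← Topology.isConstructible_compl]
  refine isConstructible_of_isOpen ?_
  have h : {x : (projSpace k σ).left | ∀ a, VanishesAt (f a) x}ᶜ =
      ⋃ a, {x | ¬ VanishesAt (f a) x} := by
    ext x
    simp
  rw [h]
  exact isOpen_iUnion fun a => isOpen_not_vanishesAt (f a)

theorem isConstructible_leadSet (n : Fin d →₀ ℕ) : Topology.IsConstructible (F.leadSet n) := by
  refine Topology.IsConstructible.inter (isConstructible_forall_vanishesAt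
    fun q : {q : JetIndex (F.jetOrder n) // q.1.2 < n q.1.1} => MvPolynomial.X q.1)
    (isConstructible_of_isOpen ?_)
  have h : {x : (projSpace k (JetIndex (F.jetOrder n))).left |
      ∀ i, ¬ VanishesAt (MvPolynomial.X (F.leadIndex n i)) x} =
      ⋂ i, {x | ¬ VanishesAt (MvPolynomial.X (F.leadIndex n i)) x} := by
    ext x
    simp
  have h' := isOpen_iInter_of_finite fun i =>
    isOpen_not_vanishesAt (MvPolynomial.X (F.leadIndex n i) : MvPolynomial _ k)
  rwa [← h] at h'

theorem isConstructible_jetSet (n : Fin d →₀ ℕ) : Topology.IsConstructible (F.jetSet n) :=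
  (F.isConstructible_leadSet n).inter (isConstructible_forall_vanishesAt _)

theorem projPoint_jet_mem_leadSet (n : Fin d →₀ ℕ) {K : Type u} [Field K] [Algebra k K]
    {z : Fin d → PowerSeries K} (hz : jet (F.jetOrder n) z ≠ 0) :
    projPoint _ hz ∈ F.leadSet n ↔
      (∀ i, ∀ j < n i, tupleCoeff (i, j) z = 0) ∧ ∀ i, tupleCoeff (i, n i) z ≠ 0 := by
  have h1 : ∀ q : JetIndex (F.jetOrder n), VanishesAt (MvPolynomial.X q) (projPoint (k := k) _ hz) ↔
      tupleCoeff q.1 z = 0 := fun q => by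
    rw [vanishesAt_projPoint _ (MvPolynomial.isHomogeneous_X k q), MvPolynomial.aeval_X]
    rfl
  simp only [leadSet, Set.mem_ofPred_eq, h1]
  exact ⟨fun ⟨ha, hc⟩ => ⟨fun i j hj =>
    ha ⟨⟨(i, j), hj.le.trans (Nat.le_add_right _ _)⟩, hj⟩, hc⟩,
    fun ⟨ha, hc⟩ => ⟨fun q => ha q.1.1.1 q.1.1.2 q.2, hc⟩⟩

theorem projPoint_jet_mem_jetSet (n : Fin d →₀ ℕ) {K : Type u} [Field K] [Algebra k K]
    {z : Fin d → PowerSeries K} (hz : jet (F.jetOrder n) z ≠ 0) :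
    projPoint _ hz ∈ F.jetSet n ↔
      ((∀ i, ∀ j < n i, tupleCoeff (i, j) z = 0) ∧ ∀ i, tupleCoeff (i, n i) z ≠ 0) ∧
        z ∈ F.submodule K := by
  have h : ∀ s, VanishesAt (F.equationForm n s) (projPoint (k := k) _ hz) ↔
      F.equation z s.1 = 0 := fun s => by
    rw [vanishesAt_projPoint _ (F.isHomogeneous_equationForm n s), aeval_jet_equationForm]
  rw [jetSet, Set.mem_inter_iff, projPoint_jet_mem_leadSet, mem_submodule_iff, Set.mem_ofPred_eq]
  simp only [h, Subtype.forall]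

theorem exists_eq_tupleXPow_mul {n : Fin d →₀ ℕ} {K : Type u} [Field K]
    {z : Fin d → PowerSeries K} (h : ∀ i, ∀ j < n i, tupleCoeff (i, j) z = 0)
    (h' : ∀ i, tupleCoeff (i, n i) z ≠ 0) :
    ∃ μ : (Fin d → PowerSeries K)ˣ, z = tupleXPow K n * (μ : Fin d → PowerSeries K) := by
  choose y hy using fun i => PowerSeries.X_pow_dvd_iff.2 (h i)
  have hzy : z = tupleXPow K n * y := funext hy
  refine ⟨(isUnit_tuple_iff.2 fun i => ?_ : IsUnit y).unit, hzy⟩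
  have := h' i
  rw [hzy, tupleCoeff_tupleXPow_mul] at this
  simpa using this

/-- A projective jet has a representative with leading coefficient `1` in the branch of `e₀`. It is
then `t^n μ`, with `μ` modulo `t^M` a point of the bundle, and it lies in `O` exactly when the class
of `μ` lies over `ℐ_n`. -/
theorem jetSet_eq (n : Fin d →₀ ℕ) : F.jetSet n = (F.chart n).left ''
    (F.bundleProj.left ⁻¹' (sigmaIdeals O n)) := by
  ext x
  constructor
  · intro hx
    obtain ⟨K, _, _, w, hw, rfl⟩ := exists_eq_projPoint x
    obtain ⟨z, rfl⟩ := exists_jet_eq _ w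
    obtain ⟨⟨h1, h2⟩, h3⟩ := (F.projPoint_jet_mem_jetSet n hw).1 hx
    obtain ⟨y, hy, hy1, hjet⟩ : ∃ y : Fin d → PowerSeries K,
        (∀ i, ∀ j < n i, tupleCoeff (i, j) y = 0) ∧
        tupleCoeff (F.e₀.1.1, n F.e₀.1.1) y = 1 ∧ ∃ c : K, c ≠ 0 ∧ y = c • z := by
      have h0 := h2 F.e₀.1.1
      refine ⟨(tupleCoeff (F.e₀.1.1, n F.e₀.1.1) z)⁻¹ • z, fun i j hj => ?_, ?_, _,
        inv_ne_zero h0, rfl⟩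
      · rw [map_smul, h1 i j hj, smul_zero]
      · rw [map_smul, smul_eq_mul, inv_mul_cancel₀ h0]
    obtain ⟨c, hc, rfl⟩ := hjet
    have hw' : c • jet (F.jetOrder n) z ≠ 0 := smul_ne_zero hc hw
    rw [← projPoint_smul hw hc hw']
    obtain ⟨μ, hμ⟩ := exists_eq_tupleXPow_mul hy fun i => by
      rw [map_smul]
      exact smul_ne_zero hc (h2 i)
    have hμ1 : tupleCoeff (F.e₀.1.1, 0) (μ : Fin d → PowerSeries K) = 1 := by
      rw [hμ, tupleCoeff_tupleXPow_mul] at hy1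
      simpa using hy1
    obtain ⟨χ, hχ⟩ := F.exists_truncEq_tupleMap_bundleUnit μ hμ1
    refine ⟨specPoint χ, ?_, ?_⟩
    · rw [specPoint_mem_preimage_bundleProj]
      refine F.mem_submodule_of_truncEq ((TruncEq.refl F.M (tupleXPow K n)).mul hχ) ?_
      rw [← hμ]
      exact Submodule.smul_mem _ _ h3
    · rw [chart_specPoint]
      have : jet (F.jetOrder n) (tupleXPow K n * tupleMap (χ : F.BundleRing →+* K) F.bundleUnit) =
          c • jet (F.jetOrder n) z := by
        rw [← jet_smul, hμ]
        funext q
        rw [jet_apply, jet_apply, tupleCoeff_tupleXPow_mul, tupleCoeff_tupleXPow_mul]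
        split_ifs with hq
        -- Jet exponents are at most `n i + M - 1`, so after division by `t^n` only exponents below
        -- `M` occur.
        · refine hχ _ ?_
          have h4 := q.2
          have h5 := F.M_pos
          rw [jetOrder_apply] at h4
          simp only
          omega
        · rfl
      simp only [this]
  · rintro ⟨y, hy, rfl⟩
    obtain ⟨K, _, _, χ, rfl⟩ := exists_eq_specPoint y
    rw [specPoint_mem_preimage_bundleProj] at hy
    rw [chart_specPoint, projPoint_jet_mem_jetSet]
    refine ⟨⟨fun i j hj => ?_, fun i => ?_⟩, hy⟩
    · rw [tupleCoeff_tupleXPow_mul, if_neg (not_le.2 hj)]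
    · rw [tupleCoeff_tupleXPow_mul]
      simp only [le_refl, if_true, Nat.sub_self]
      exact (isUnit_tuple_iff.1 (F.isUnit_bundleUnit.map
        (tupleMap (χ : F.BundleRing →+* K))) i).ne_zero

theorem hasClass_jetSet (n : Fin d →₀ ℕ) {x : K0 k} (hx : HasClass (jac O) (sigmaIdeals O n) x) :
    HasClass (projSpace k (JetIndex (F.jetOrder n))) (F.jetSet n)
      (x * K0.line k ^ Nat.card F.FibreIndex) := by
  have h : IsImmersion (𝟙 (specOver k (jacRing O)) : specOver k (jacRing O) ⟶ _).left := by
    rw [Over.id_left]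
    infer_instance
  let c : specOver k (MvPolynomial F.FibreIndex (jacRing O)) ⟶
    projSpace k (JetIndex (F.jetOrder n)) := F.chart n
  have hc : IsImmersion c.left := inferInstanceAs (IsImmersion (F.chart n).left)
  have h1 := HasClass.cylinder (V := specOver k (jacRing O)) (A := jacRing O) (ι := F.FibreIndex)
    (𝟙 (specOver k (jacRing O))) c hx
    (by
      rw [Over.id_left]
      exact fun y _ => ⟨y, rfl⟩)
  rw [F.jetSet_eq]
  exact h1

end Frame

/-! ### The integral -/

section Integral

variable {k : Type u} [Field k] {d : ℕ}

theorem forall_order_eq_iff {K : Type u} [Field K] {n : Fin d →₀ ℕ} {z : Fin d → PowerSeries K} :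
    (∀ i, (z i).order = n i) ↔
      (∀ i, ∀ j < n i, tupleCoeff (i, j) z = 0) ∧ ∀ i, tupleCoeff (i, n i) z ≠ 0 := by
  simp only [PowerSeries.order_eq_nat]
  exact ⟨fun h => ⟨fun i => (h i).2, fun i => (h i).1⟩, fun h i => ⟨h.2 i, h.1 i⟩⟩

variable (k) in
/-- The points of value `n`. -/
def valueSet (n : Fin d →₀ ℕ) : Set (PPoint k d) :=
  {z | ∀ i, (z.pt.rep i).order = n i}

theorem tPowVal_eq_monomial {z : PPoint k d} {n : Fin d →₀ ℕ} :
    tPowVal z = MvPowerSeries.monomial n 1 ↔ z ∈ valueSet k n := by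
  rw [tPowVal]
  constructor
  · intro h i
    split_ifs at h with hz
    · have h1 := congrArg (MvPowerSeries.coeff n) h
      rw [MvPowerSeries.coeff_monomial_same, MvPowerSeries.coeff_monomial] at h1
      have h2 : n = Finsupp.equivFunOnFinite.symm fun i => (z.pt.rep i).order.toNat := by
        simpa using h1
      rw [h2, ← PowerSeries.coe_toNat_order (hz i)]
      rfl
    · have h1 := congrArg (MvPowerSeries.coeff n) h
      simp at h1
  · intro h
    have hz : ∀ i, z.pt.rep i ≠ 0 := fun i h0 => by
      have := h i
      rw [h0, PowerSeries.order_zero] at this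
      exact ENat.natCast_ne_top _ this.symm
    rw [if_pos hz]
    have h1 : (Finsupp.equivFunOnFinite.symm fun i => (z.pt.rep i).order.toNat) = n := by
      ext i
      simp [h i]
    rw [h1]

theorem exists_tPowVal_eq (z : PPoint k d) :
    tPowVal z = 0 ∨ ∃ n, tPowVal z = MvPowerSeries.monomial n 1 := by
  rw [tPowVal]
  split_ifs
  · exact Or.inr ⟨_, rfl⟩
  · exact Or.inl rfl

theorem preimage_tPowVal_monomial (n : Fin d →₀ ℕ) :
    tPowVal ⁻¹' {MvPowerSeries.monomial n 1} = valueSet k n :=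
  Set.ext fun _ => tPowVal_eq_monomial

theorem preimage_tPowVal_eq_empty {a : MvPowerSeries (Fin d) ℤ} (ha : a ≠ 0)
    (h : ∀ n, a ≠ MvPowerSeries.monomial n 1) : (tPowVal (k := k)) ⁻¹' {a} = ∅ := by
  refine Set.eq_empty_of_forall_notMem fun z hz => ?_
  rw [Set.mem_preimage, Set.mem_singleton_iff] at hz
  rcases exists_tPowVal_eq z with h' | ⟨n, h'⟩
  · exact ha (hz.symm.trans h')
  · exact h n (hz.symm.trans h')

theorem isCylinderOver_empty (n : Fin d →₀ ℕ) : IsCylinderOver (k := k) ∅ n ∅ :=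
  ⟨Topology.IsConstructible.empty, by simp⟩

theorem eulerChar_empty : eulerChar (∅ : Set (PPoint k d)) = 0 := by
  rw [(isCylinderOver_empty (k := k) (0 : Fin d →₀ ℕ)).eulerChar_eq, setClass_eq (HasClass.empty _)]
  simp

/-- The only nonzero values of the function are monomials, so the coefficient of `T^m` receives a
contribution from the value `T^m` alone. -/
theorem eulerChar_mul_coeff_eq_zero (X : Set (PPoint k d)) {m : Fin d →₀ ℕ}
    {a : MvPowerSeries (Fin d) ℤ} (ha : a ≠ 0) (ham : a ≠ MvPowerSeries.monomial m 1) :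
    eulerChar (X ∩ tPowVal ⁻¹' {a}) * ((MvPowerSeries.coeff m a : ℤ) : Mot k) = 0 := by
  by_cases h : ∃ n, a = MvPowerSeries.monomial n 1
  · obtain ⟨n, rfl⟩ := h
    have hmn : m ≠ n := by
      rintro rfl
      exact ham rfl
    rw [MvPowerSeries.coeff_monomial, if_neg hmn]
    simp
  · rw [preimage_tPowVal_eq_empty ha fun n hn => h ⟨n, hn⟩, Set.inter_empty, eulerChar_empty,
      zero_mul]

theorem integral_tPowVal (X : Set (PPoint k d)) (m : Fin d →₀ ℕ) :
    MvPowerSeries.coeff m (integral X tPowVal) = eulerChar (X ∩ valueSet k m) := by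
  classical
  have h0 : (MvPowerSeries.monomial m 1 : MvPowerSeries (Fin d) ℤ) ≠ 0 := fun h => by
    have := congrArg (MvPowerSeries.coeff m) h
    simp at this
  change (∑ᶠ (a : MvPowerSeries (Fin d) ℤ) (_ : a ≠ 0),
    eulerChar (X ∩ tPowVal ⁻¹' {a}) * ((MvPowerSeries.coeff m a : ℤ) : Mot k)) = _
  rw [finsum_eq_single _ (MvPowerSeries.monomial m 1 : MvPowerSeries (Fin d) ℤ)]
  · rw [finsum_eq_if, if_pos h0, MvPowerSeries.coeff_monomial_same, preimage_tPowVal_monomial]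
    simp
  · intro a ham
    by_cases ha : a = 0
    · rw [finsum_eq_if, if_neg (not_not.2 ha)]
    · rw [finsum_eq_if, if_pos ha, eulerChar_mul_coeff_eq_zero X ha ham]

/-- If some point of `O`, with coordinates in an extension field, has value `n`, then so does
some element of `O`. -/
theorem mem_semigroup_of_mem_points (hk : (d : Cardinal.{u}) ≤ Cardinal.mk k)
    (O : Subalgebra k (Fin d → PowerSeries k)) {K : Type u} [Field K] [Algebra k K]
    {z : Fin d → PowerSeries K} (hz : z ∈ points O K) {n : Fin d →₀ ℕ}
    (hn : ∀ i, (z i).order = n i) : n ∈ semigroup O := by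
  rw [forall_order_eq_iff] at hn
  let V := Subalgebra.toSubmodule O
  let f : Fin d × ℕ → Module.Dual k V := fun s => tupleCoeff s ∘ₗ V.subtype
  let L : {p : Fin d × ℕ // p.2 < n p.1} → Module.Dual k V := fun p => f p.1
  have hfin : Finite {p : Fin d × ℕ // p.2 < n p.1} :=
    Finite.of_injective (fun p => (⟨p.1, p.2.le⟩ : JetIndex n)) fun p q h =>
      Subtype.ext (Subtype.mk.inj h)
  let N : Submodule k V := ⨅ p, LinearMap.ker (L p)
  let W : Fin d → Submodule k N := fun i => LinearMap.ker (f (i, n i) ∘ₗ N.subtype)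
  -- `N` consists of the elements of `O` with no coefficient below `n`, and `W i` of those whose
  -- coefficient at `n i` vanishes too. If all `W i` are proper, `d ≤ |k|` gives an element outside
  -- all of them. Otherwise some coefficient at `n i` is, on `O`, a combination of lower ones; this
  -- relation also holds for `z` and contradicts its value.
  by_cases hW : ∀ i, W i ≠ ⊤
  · have hd : ((Finset.univ : Finset (Fin d)).card : Cardinal.{u}) ≤ Cardinal.mk k := by
      simpa using hk
    obtain ⟨y, hy⟩ := exists_forall_notMem_of_card_le (V := N) W hW Finset.univ hd
    refine ⟨y.1.1, y.1.2, forall_order_eq_iff.2 ⟨fun i j hj => ?_, fun i => hy i (Finset.mem_univ i)⟩⟩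
    exact (Submodule.mem_iInf _).1 y.2 ⟨(i, j), hj⟩
  · push Not at hW
    obtain ⟨i, hi⟩ := hW
    have h1 : f (i, n i) ∈ Submodule.span k (Set.range L) := by
      refine mem_span_of_iInf_ker_le_ker fun y hy => ?_
      exact (hi ▸ Submodule.mem_top : (⟨y, hy⟩ : N) ∈ W i)
    obtain ⟨b, hb⟩ := (Finsupp.mem_span_range_iff_exists_finsupp).1 h1
    have h2 : ∀ (A : Type u) [Field A] [Algebra k A] (y : Fin d → PowerSeries A),
        ((Finsupp.single (i, n i) 1 - b.mapDomain Subtype.val).sum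
          fun p c => algebraMap k A c * PowerSeries.coeff p.2 (y p.1)) =
        tupleCoeff (i, n i) y - b.sum fun p c => algebraMap k A c * tupleCoeff p.1 y := by
      intro A _ _ y
      rw [Finsupp.sum_sub_index (fun p a b => by rw [map_sub, sub_mul]),
        Finsupp.sum_mapDomain_index (by simp) (fun p a b => by rw [map_add, add_mul])]
      simp [tupleCoeff_apply, Finsupp.sum_single_index]
    have h3 := hz (Finsupp.single (i, n i) 1 - b.mapDomain Subtype.val) fun y hy => by
      have h4 := h2 k y
      simp only [Algebra.algebraMap_self, RingHom.id_apply] at h4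
      have h5 := LinearMap.congr_fun hb ⟨y, hy⟩
      rw [h4, sub_eq_zero]
      rw [Finsupp.sum, LinearMap.sum_apply] at h5
      exact h5.symm
    rw [h2, sub_eq_zero] at h3
    refine (hn.2 i (h3.trans (Finset.sum_eq_zero fun p _ => ?_))).elim
    change algebraMap k K (b p) * tupleCoeff p.1 z = 0
    rw [hn.1 _ _ p.2, mul_zero]

/-! ### Cylinders of given value and their Euler characteristics. -/

namespace Frame

variable {O : Subalgebra k (Fin d → PowerSeries k)} (F : Frame O)

theorem jet_ne_zero {n : Fin d →₀ ℕ} {K : Type u} [Field K] {z : Fin d → PowerSeries K}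
    (h : ∀ i, tupleCoeff (i, n i) z ≠ 0) : jet (F.jetOrder n) z ≠ 0 := fun h0 =>
  h F.e₀.1.1 (congrFun h0 (F.baseIndex n))

theorem isCylinderOver_valueSet (n : Fin d →₀ ℕ) :
    IsCylinderOver (valueSet k n) (F.jetOrder n) (F.leadSet n) := by
  refine ⟨F.isConstructible_leadSet n, Set.ext fun z => ?_⟩
  rw [mem_preimage_jetMap]
  refine Iff.trans forall_order_eq_iff ⟨fun h => ?_, fun ⟨h, h'⟩ => ?_⟩
  · exact ⟨F.jet_ne_zero h.2, (F.projPoint_jet_mem_leadSet n _).2 h⟩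
  · exact (F.projPoint_jet_mem_leadSet n h).1 h'

theorem isCylinderOver_inter_valueSet (n : Fin d →₀ ℕ) :
    IsCylinderOver (projPoints O ∩ valueSet k n) (F.jetOrder n) (F.jetSet n) := by
  refine ⟨F.isConstructible_jetSet n, Set.ext fun z => ?_⟩
  rw [mem_preimage_jetMap]
  refine Iff.trans (and_congr F.mem_points_iff forall_order_eq_iff) ⟨fun h => ?_, fun ⟨h, h'⟩ => ?_⟩
  · exact ⟨F.jet_ne_zero h.2.2, (F.projPoint_jet_mem_jetSet n _).2 h.symm⟩
  · exact ((F.projPoint_jet_mem_jetSet n h).1 h').symm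

theorem isIntegrable (F : Frame O) : IsIntegrable (projPoints O) tPowVal := by
  refine ⟨?_, fun a ha => ?_, fun m => ?_⟩
  · refine ((Set.countable_singleton (0 : MvPowerSeries (Fin d) ℤ)).union (Set.countable_range
      fun n : Fin d →₀ ℕ => (MvPowerSeries.monomial n 1 : MvPowerSeries (Fin d) ℤ))).mono ?_
    rintro _ ⟨z, rfl⟩
    rcases exists_tPowVal_eq z with h | ⟨n, h⟩
    · exact Or.inl h
    · exact Or.inr ⟨n, h.symm⟩
  · by_cases h : ∃ n, a = MvPowerSeries.monomial n 1
    · obtain ⟨n, rfl⟩ := h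
      rw [preimage_tPowVal_monomial]
      exact ⟨⟨_, _, F.isCylinderOver_valueSet n⟩, ⟨_, _, F.isCylinderOver_inter_valueSet n⟩⟩
    · rw [preimage_tPowVal_eq_empty ha fun n hn => h ⟨n, hn⟩, Set.inter_empty]
      exact ⟨⟨0, _, isCylinderOver_empty 0⟩, ⟨0, _, isCylinderOver_empty 0⟩⟩
  · refine (Set.finite_singleton (MvPowerSeries.monomial m 1)).subset fun a ha => ?_
    by_contra hne
    exact ha.2 (eulerChar_mul_coeff_eq_zero _ ha.1 hne)

/-- The powers of `𝕃` balance: `δ + 1` and the fibre dimension `|E| - 1` add up to `d * M`, the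
excess of the number of jet coordinates over `‖n‖`. -/
theorem eulerChar_inter_valueSet (F : Frame O) (n : Fin d →₀ ℕ) :
    Mot.L k ^ (sdelta O + 1) * eulerChar (projPoints O ∩ valueSet k n) =
      algebraMap (K0 k) (Mot k) (setClass (jac O) (sigmaIdeals O n)) * Mot.Linv k ^ nrm n := by
  obtain ⟨x, hx⟩ := F.exists_hasClass_sigmaIdeals n
  rw [(F.isCylinderOver_inter_valueSet n).eulerChar_eq, setClass_eq (F.hasClass_jetSet n hx),
    setClass_eq hx, nrmSucc_jetOrder, map_mul, map_pow]
  have h : sdelta O + 1 + Nat.card F.FibreIndex = d * F.M := by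
    rw [← F.sdelta_add_card, ← F.card_fibreIndex]
    ring
  rw [← Mot.L_pow_mul_Linv_pow (d * F.M) (nrm n), ← h, pow_add _ (sdelta O + 1)]
  change _ * (_ * Mot.L k ^ _ * _) = _
  ring

end Frame

end Integral

end CurveZeta

end

theorem lemma5 {k : Type u} [Field k] {d : ℕ} (hk : (d : Cardinal.{u}) ≤ Cardinal.mk k)
    (O : Subalgebra k (Fin d → PowerSeries k)) [IsLocalRing O]
    [Module.Finite k ((Fin d → PowerSeries k) ⧸ Subalgebra.toSubmodule O)] :
    (∀ n ∈ CurveZeta.semigroup O,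
      ∃ x, CurveZeta.HasClass (CurveZeta.jac O) (CurveZeta.sigmaIdeals O n) x) ∧
    CurveZeta.IsIntegrable (CurveZeta.projPoints O) CurveZeta.tPowVal ∧
    CurveZeta.zeta O =
      MvPowerSeries.C (CurveZeta.Mot.L k ^ (CurveZeta.sdelta O + 1)) * CurveZeta.poincare O := by
  classical
  obtain ⟨F⟩ := CurveZeta.exists_frame O
  refine ⟨fun n _ => F.exists_hasClass_sigmaIdeals n, F.isIntegrable, MvPowerSeries.ext fun n => ?_⟩
  rw [MvPowerSeries.coeff_C_mul, CurveZeta.poincare, CurveZeta.integral_tPowVal]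
  change (if n ∈ CurveZeta.semigroup O then _ else 0) = _
  split_ifs with hn
  · exact (F.eulerChar_inter_valueSet n).symm
  -- For `n` outside `S` the series `Z` has coefficient `0` by definition; on the other side no
  -- point over any extension field has value `n`.
  · have h : CurveZeta.projPoints O ∩ CurveZeta.valueSet k n = ∅ :=
      Set.eq_empty_of_forall_notMem fun z hz =>
        hn (CurveZeta.mem_semigroup_of_mem_points hk O hz.1 hz.2)
    rw [h, CurveZeta.eulerChar_empty, mul_zero]
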